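/- **Setting.** Let $K\ge 1$. A memoryless 1-to-$K$ broadcast packet erasure channel is given by numbers $p_S\ge 0$, $S\subseteq[K]$, with $\sum_S p_S=1$: in each time slot, independently of the other slots, the transmitted packet is received by exactly the destinations $d_k$, $k\in S$, with probability $p_S$, and erased at the others. After each slot the source learns the set $S_{\rm rx}$ of destinations that received the packet (channel output feedback). Put $p_{\cup S}=\sum_{S'\cap S\ne\emptyset}p_{S'}$, $p_k=p_{\cup\{k\}}$, and $f_p(A\overline{B})=\sum_{S_1\supseteq A,\ S_1\cap B=\emptyset}p_{S_1}$ for disjoint $A,B\subseteq[K]$. All rates $R_k$ are non-negative. **Packet evolution (PE).** Session $k$ has $N_k$ information packets $X_{k,j}$, each a vector of $M$ symbols of a finite field $\mathrm{GF}(q_0)$. Each packet $X_{k,j}$ carries an overhearing set $S(X_{k,j})\subseteq[K]$, initially $\emptyset$, and a coding vector ${\bf v}(X_{k,j})\in\mathrm{GF}(q_0)^{\sum_i N_i}$, initially the unit vector $\delta_{k,j}$. A flag is raised initially. In a slot that starts with the flag raised, the source chooses a non-empty $T\subseteq[K]$ and, for each $k\in T$, a target packet $X_{k,j_k}$ with $T\subseteq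 S(X_{k,j_k})\cup\{k\}$ or a dummy (all-zero) packet, together with mixing coefficients $c_k\in\mathrm{GF}(q_0)$, and sets ${\bf v}_{\rm tx}=\sum_k c_k{\bf v}(X_{k,j_k})$, the sum running over the non-dummy targets. In every other slot it keeps $T$, the targets and ${\bf v}_{\rm tx}$. It transmits the combination of the information packets with coefficient vector ${\bf v}_{\rm tx}$, preceded by ${\bf v}_{\rm tx}$ as a header. After the slot, each non-dummy target packet $X$ with $S_{\rm rx}\not\subseteq S(X)$ gets $S(X)\leftarrow (T\cap S(X))\cup S_{\rm rx}$ and ${\bf v}(X)\leftarrow{\bf v}_{\rm tx}$; the flag is raised if some target's set changed, and lowered otherwise. A PE algorithm is *deterministic* if $T$, the targets and the coefficients $c_k$ are functions of the feedback of the preceding slots. Let $\Omega_{Z,k}(t)$ be the span of the coding vectors received by $d_k$ in slots $1,\dots,t$, let $\Omega_{M,k}$ be the span of the $\delta_{k,j}$, $j\le N_k$, and let $\Omega_{R,k}(t)$ be the span of the current vectors ${\bf v}(X_{k,j})$ of the packets of session $k$ with $k\notin S(X_{k,j})$ after slot $t$. The algorithm is *decodable with probability one* if $\Omega_{Z,k}(t)+\Omega_{R,k}(t)=\Omega_{Z,k}(t)+\Omega_{M,k}$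 for all $k$, all $t\ge0$ and every channel realization. A rate vector $R$ is *attained over* $\mathrm{GF}(q_0)$ if for every $\epsilon>0$ and all sufficiently large $n$ there are packet numbers $N_k$ and a deterministic PE algorithm over $\mathrm{GF}(q_0)$ that is decodable with probability one, such that * for all sufficiently large $M$ and all $k$, $nR_k\,(M+\sum_iN_i)\le N_kM$ (that is, session $k$ carries at least $R_k$ information symbols per transmitted symbol, header included), and * for every $M$ there are decoders, each $d_k$ using only what it receives in the $n$ slots, such that with probability greater than $1-\epsilon$ over the channel all destinations recover all their information packets, whatever the values of these packets. **Theorem.** Let $q_0$ be a prime power with $q_0>K$. Then: 0. For any packet numbers $N_k$ and any feedback-dependent rule for choosing $T$ and the target packets as above, there are mixing coefficients, given as functions of the feedback of the preceding slots, for which the resulting deterministic PE algorithm over $\mathrm{GF}(q_0)$ is decodable with probability one. 1. Let $K=3$ and let $R_k=0$ whenever $p_k=0$. If $\sum_{j=1}^K R_{\pi(j)}/p_{\cup\{\pi(1),\dots,\pi(j)\}}<1$ for every permutation $\pi$ of $[K]$ (with $0/0=0$), then $R$ is attained over $\mathrm{GF}(q_0)$. If only $\le1$ holds for every $\pi$,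 then $R$ is in the closure of the set of rate vectors attained over $\mathrm{GF}(q_0)$. 2. Let $\prec$ be a strict total order on the subsets of $[K]$ with $|S_1|<|S_2|\Rightarrow S_1\prec S_2$. Then $R$ is attained over $\mathrm{GF}(q_0)$ if there are $x_S\ge0$ ($S\subseteq[K]$) and $w_{k;S\to T}\ge0$ ($T\subseteq S\subseteq[K]\setminus k$) such that * $\sum_S x_S<1$; * $x_T\ge\sum_{S:\,T\setminus k\subseteq S\subseteq[K]\setminus k}w_{k;S\to T\setminus k}$ for all $T$ and $k\in T$; * $w_{k;\emptyset\to\emptyset}\,p_{\cup[K]}\ge R_k$ for all $k$; * for all $k$ and $\emptyset\neq S\subseteq[K]\setminus k$, $$\Big(\sum_{T_1\subseteq S}w_{k;S\to T_1}\Big)p_{\cup([K]\setminus S)}\ \ge\ \sum_{\substack{T_1\subseteq S_1\subseteq[K]\setminus k\\ T_1\subseteq S,\ S\not\subseteq S_1}}w_{k;S_1\to T_1}\,f_p\big((S\setminus T_1)\overline{([K]\setminus S)}\big);$$ * for all $k$ and $T\subsetneq S\subseteq[K]\setminus k$, $$\Big(w_{k;S\to T}+\sum_{\substack{T_1\subseteq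 S\\ T_1\cup k\,\prec\, T\cup k}}w_{k;S\to T_1}\Big)p_{\cup([K]\setminus S)}\ \le\ \sum_{\substack{S_1\prec S\\ T\subseteq S_1\subseteq[K]\setminus k}}w_{k;S_1\to T}\,f_p\big((S\setminus T)\overline{([K]\setminus S)}\big)+\sum_{\substack{T_1\subseteq S_1\subseteq[K]\setminus k\\ T_1\cup k\,\prec\, T\cup k\\ T_1\subseteq S,\ S\not\subseteq S_1}}w_{k;S_1\to T_1}\,f_p\big((S\setminus T_1)\overline{([K]\setminus S)}\big).$$ 3. If the channel is symmetric ($p_S$ depends only on $|S|$), both assertions of 1 hold for every $K$. 4. Suppose that the channel is spatially independent ($p_S=\prod_{k\in S}p_k\prod_{k\notin S}(1-p_k)$ for all $S$), that $0<p_1\le\dots\le p_K$, and that $R$ is one-sidedly fair: $R_i(1-p_i)\ge R_j(1-p_j)$ for $i<j$. If $\sum_{k=1}^K R_k/\big(1-\prod_{l=1}^k(1-p_l)\big)<1$, then $R$ is attained over $\mathrm{GF}(q_0)$; if the sum is $\le1$, then $R$ is in the closure of the set of rate vectors attained over $\mathrm{GF}(q_0)$. -/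

import Mathlib

namespace BroadcastPEC

/-! ### The memoryless 1-to-`K` broadcast packet erasure channel -/

/-- `p S` is the probability that a transmitted symbol is received by and only by the
destinations in `S`. -/
def IsPEC {K : ℕ} (p : Finset (Fin K) → ℝ) : Prop :=
  (∀ S, 0 ≤ p S) ∧ ∑ S, p S = 1

/-- Probability that at least one destination of `S` receives the symbol. -/
def pUnion {K : ℕ} (p : Finset (Fin K) → ℝ) (S : Finset (Fin K)) : ℝ :=
  ∑ S' : Finset (Fin K) with (S' ∩ S).Nonempty, p S'

/-- Marginal success probability of destination `k`. -/
def pMarg {K : ℕ} (p : Finset (Fin K) → ℝ) (k : Fin K) : ℝ := pUnion p {k}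

/-- Probability that all destinations of `A` and none of those of `B` receive the symbol. -/
def fp {K : ℕ} (p : Finset (Fin K) → ℝ) (A B : Finset (Fin K)) : ℝ :=
  ∑ S₁ : Finset (Fin K) with A ⊆ S₁ ∧ B ⊆ S₁ᶜ, p S₁

/-- The channel is symmetric. -/
def IsSymmetric {K : ℕ} (p : Finset (Fin K) → ℝ) : Prop :=
  ∀ S₁ S₂ : Finset (Fin K), S₁.card = S₂.card → p S₁ = p S₂

/-- The channel is spatially independent. -/
def IsSpatiallyIndependent {K : ℕ} (p : Finset (Fin K) → ℝ) : Prop :=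
  ∀ S : Finset (Fin K), p S = (∏ k ∈ S, pMarg p k) * ∏ k ∈ Sᶜ, (1 - pMarg p k)

/-- Channel output feedback of a number of time slots, most recent slot first: the set of
destinations that received the packet of each slot. -/
abbrev History (K : ℕ) : Type := List (Finset (Fin K))

open Classical in
/-- Probability of the event `E` about the feedback of `n` uses of the memoryless channel. -/
noncomputable def channelProb {K : ℕ} (p : Finset (Fin K) → ℝ) (n : ℕ) (E : History K → Prop) : ℝ :=
  ∑ ω : Fin n → Finset (Fin K),
    if E (List.ofFn ω).reverse then ∏ t, p (ω t) else 0

/-! ### Packet evolution algorithms -/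

/-- Session `k` has the `N k` information packets `⟨k, j⟩`, `j < N k`. -/
abbrev Packet {K : ℕ} (N : Fin K → ℕ) : Type := Σ k : Fin K, Fin (N k)

/-- A mixing set `T` with one target packet per session `k ∈ T`. The value `none` stands for an
auxiliary dummy (all-zero) packet; values of `target` outside `T` are ignored. -/
structure Selection {K : ℕ} (N : Fin K → ℕ) where
  T : Finset (Fin K)
  target : (k : Fin K) → Option (Fin (N k))

/-- `X` is one of the (non-dummy) target packets. -/
def Selection.IsTarget {K : ℕ} {N : Fin K → ℕ} (s : Selection N) (X : Packet N) : Prop :=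
  X.1 ∈ s.T ∧ s.target X.1 = some X.2

instance {K : ℕ} {N : Fin K → ℕ} (s : Selection N) (X : Packet N) : Decidable (s.IsTarget X) :=
  inferInstanceAs (Decidable (_ ∧ _))

/-- A deterministic packet evolution algorithm with coefficients in `F`: the mixing set, the target
packets and the mixing coefficients are functions of the feedback so far. They are consulted in the
slots in which the flag of the scheme is raised. -/
structure Algorithm (F : Type*) {K : ℕ} (N : Fin K → ℕ) where
  select : History K → Selection N
  coeff : History K → Fin K → F

/-- The variables of the packet evolution scheme: overhearing sets, coding vectors, the flag, and the
selection and coding vector last used for transmission. -/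
structure State (F : Type*) {K : ℕ} (N : Fin K → ℕ) where
  S : Packet N → Finset (Fin K)
  v : Packet N → Packet N → F
  change : Bool
  sel : Selection N
  vtx : Packet N → F

section Dynamics

variable {F : Type*} [Field F] {K : ℕ} {N : Fin K → ℕ}

/-- State before the first slot. -/
def State.init : State F N where
  S _ := ∅
  v X := Pi.single X 1
  change := true
  sel := ⟨∅, fun _ => none⟩
  vtx := 0

/-- Beginning of a slot: if the flag is raised, choose a new selection and mix the coding vectors of
the target packets; otherwise keep the previous coding vector. -/
def State.beginSlot (alg : Algorithm F N) (h : History K) (s : State F N) : State F N :=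
  if s.change then
    { s with
      sel := alg.select h
      vtx := ∑ X : Packet N with (alg.select h).IsTarget X, alg.coeff h X.1 • s.v X }
  else s

/-- End of a slot whose packet was received by exactly the destinations in `A`: update the target
packets and the flag. -/
def State.endSlot (A : Finset (Fin K)) (s : State F N) : State F N :=
  let S' : Packet N → Finset (Fin K) := fun X =>
    if s.sel.IsTarget X ∧ ¬ A ⊆ s.S X then (s.sel.T ∩ s.S X) ∪ A else s.S X
  { s with
    S := S'
    v := fun X => if s.sel.IsTarget X ∧ ¬ A ⊆ s.S X then s.vtx else s.v X
    change := decide (∃ X, s.sel.IsTarget X ∧ S' X ≠ s.S X) }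

/-- State after the slots recorded in the history. -/
def Algorithm.state (alg : Algorithm F N) : History K → State F N
  | [] => State.init
  | A :: h => ((alg.state h).beginSlot alg h).endSlot A

/-- Coding vector transmitted in the slot following the history `h`. -/
def Algorithm.tx (alg : Algorithm F N) (h : History K) : Packet N → F :=
  ((alg.state h).beginSlot alg h).vtx

/-- Whenever a selection is made, `T` is non-empty and every target packet `X` of a session `k` has
`T ⊆ S(X) ∪ {k}`. -/
def Algorithm.Valid (alg : Algorithm F N) : Prop :=
  ∀ h : History K, (alg.state h).change = true →
    (alg.select h).T.Nonempty ∧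
    ∀ X : Packet N, (alg.select h).IsTarget X →
      (alg.select h).T ⊆ insert X.1 ((alg.state h).S X)

/-- Knowledge space of destination `k`: the span of the coding vectors it has received. -/
def Algorithm.knowledge (alg : Algorithm F N) (k : Fin K) : History K → Submodule F (Packet N → F)
  | [] => ⊥
  | A :: h => alg.knowledge k h ⊔ (if k ∈ A then Submodule.span F {alg.tx h} else ⊥)

/-- Message space of destination `k`. -/
def messageSpace (F : Type*) [Field F] {K : ℕ} (N : Fin K → ℕ) (k : Fin K) :
    Submodule F (Packet N → F) :=
  Submodule.span F (Set.range fun j : Fin (N k) => Pi.single (⟨k, j⟩ : Packet N) (1 : F))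

/-- Remaining space of destination `k`: the span of the current coding vectors of those packets of
session `k` whose overhearing set does not contain `k`. -/
def Algorithm.remaining (alg : Algorithm F N) (k : Fin K) (h : History K) :
    Submodule F (Packet N → F) :=
  Submodule.span F
    {u | ∃ j : Fin (N k), k ∉ (alg.state h).S ⟨k, j⟩ ∧ u = (alg.state h).v ⟨k, j⟩}

/-- Decodability with probability one: after any number of slots and for every channel realization,
each destination can recover its message from its knowledge space and its remaining space. -/
def Algorithm.SurelyDecodable (alg : Algorithm F N) : Prop :=
  ∀ (h : History K) (k : Fin K),
    alg.knowledge k h ⊔ alg.remaining k h = alg.knowledge k h ⊔ messageSpace F N k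

/-- What destination `k` observes (most recent slot first) if the information packets are the
vectors `X`, of `M` symbols each: an erasure, or a packet made of its coding vector (the header)
and the coded symbols. -/
def Algorithm.observe (alg : Algorithm F N) {M : ℕ} (X : Packet N → Fin M → F) (k : Fin K) :
    History K → List (Option ((Packet N → F) × (Fin M → F)))
  | [] => []
  | A :: h =>
      (if k ∈ A then some (alg.tx h, ∑ Y, alg.tx h Y • X Y) else none) :: alg.observe X k h

end Dynamics

/-- The rate vector `R` is attained over the channel `p` by deterministic packet evolution
algorithms on `F`: for every `ε > 0` and all sufficiently large `n` there are such an algorithm,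
surely decodable, and decoders, each using only the observations of its own destination, that after
`n` slots recover all messages with probability greater than `1 - ε`. A transmitted packet consists
of `∑ i, N i` header symbols and `M` coded symbols, and session `k` carries `N k * M` information
symbols, which for large `M` is at least the rate `R k` per transmitted symbol. -/
def Attains (F : Type*) [Field F] {K : ℕ} (p : Finset (Fin K) → ℝ) (R : Fin K → ℝ) : Prop :=
  ∀ ε : ℝ, 0 < ε → ∃ n₀ : ℕ, ∀ n : ℕ, n₀ ≤ n →
    ∃ (N : Fin K → ℕ) (alg : Algorithm F N), alg.Valid ∧ alg.SurelyDecodable ∧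
      (∃ M₀ : ℕ, ∀ M : ℕ, M₀ ≤ M →
        ∀ k, (n : ℝ) * R k * ((M : ℝ) + ∑ i, (N i : ℝ)) ≤ (N k : ℝ) * (M : ℝ)) ∧
      ∀ M : ℕ, ∃ g : (k : Fin K) → List (Option ((Packet N → F) × (Fin M → F))) →
          Fin (N k) → Fin M → F,
        1 - ε < channelProb p n (fun h =>
          ∀ (X : Packet N → Fin M → F) (k : Fin K) (j : Fin (N k)),
            g k (alg.observe X k h) j = X ⟨k, j⟩)

/-! ### The rate regions -/

/-- Non-negative rates, with rate zero for destinations that never receive anything. The latter is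
what `R k / 0 ≤ 1` means in the outer bound. -/
def IsRateVector {K : ℕ} (p : Finset (Fin K) → ℝ) (R : Fin K → ℝ) : Prop :=
  (∀ k, 0 ≤ R k) ∧ ∀ k, pMarg p k = 0 → R k = 0

/-- Left-hand side of the outer bound inequality of the permutation `π`. -/
noncomputable def outerSum {K : ℕ} (p : Finset (Fin K) → ℝ) (R : Fin K → ℝ)
    (π : Equiv.Perm (Fin K)) : ℝ :=
  ∑ j, R (π j) / pUnion p ((Finset.Iic j).image π)

/-- The ordering is compatible with cardinality. -/
def CardCompatible {K : ℕ} (prec : Finset (Fin K) → Finset (Fin K) → Prop) : Prop :=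
  ∀ S₁ S₂ : Finset (Fin K), S₁.card < S₂.card → prec S₁ S₂

open Classical in
/-- The linear program of the inner bound for the ordering `prec`; `w k S T` is used only for
`T ⊆ S` and `k ∉ S`. -/
def InnerBound {K : ℕ} (p : Finset (Fin K) → ℝ)
    (prec : Finset (Fin K) → Finset (Fin K) → Prop) (R : Fin K → ℝ) : Prop :=
  ∃ (x : Finset (Fin K) → ℝ) (w : Fin K → Finset (Fin K) → Finset (Fin K) → ℝ),
    (∀ S, 0 ≤ x S) ∧
    (∀ k S T, T ⊆ S → k ∉ S → 0 ≤ w k S T) ∧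
    ∑ S, x S < 1 ∧
    (∀ T, ∀ k ∈ T,
      ∑ S : Finset (Fin K) with T.erase k ⊆ S ∧ k ∉ S, w k S (T.erase k) ≤ x T) ∧
    (∀ k, R k ≤ w k ∅ ∅ * pUnion p Finset.univ) ∧
    (∀ k S, k ∉ S → S ≠ ∅ →
      ∑ q : Finset (Fin K) × Finset (Fin K)
          with q.2 ⊆ q.1 ∧ k ∉ q.1 ∧ q.2 ⊆ S ∧ ¬ S ⊆ q.1,
        w k q.1 q.2 * fp p (S \ q.2) Sᶜ
      ≤ (∑ T₁ : Finset (Fin K) with T₁ ⊆ S, w k S T₁) * pUnion p Sᶜ) ∧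
    (∀ k S T, T ⊆ S → k ∉ S → T ≠ S →
      (w k S T + ∑ T₁ : Finset (Fin K) with T₁ ⊆ S ∧ prec (insert k T₁) (insert k T), w k S T₁)
          * pUnion p Sᶜ
      ≤ (∑ S₁ : Finset (Fin K) with prec S₁ S ∧ T ⊆ S₁ ∧ k ∉ S₁,
            w k S₁ T * fp p (S \ T) Sᶜ)
        + ∑ q : Finset (Fin K) × Finset (Fin K)
            with q.2 ⊆ q.1 ∧ k ∉ q.1 ∧ prec (insert k q.2) (insert k T) ∧ q.2 ⊆ S ∧ ¬ S ⊆ q.1,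
          w k q.1 q.2 * fp p (S \ q.2) Sᶜ)

/-- One-sided fairness (destinations labelled so that the marginals are non-decreasing). -/
def OneSidedlyFair {K : ℕ} (p : Finset (Fin K) → ℝ) (R : Fin K → ℝ) : Prop :=
  ∀ i j : Fin K, i < j → R j * (1 - pMarg p j) ≤ R i * (1 - pMarg p i)

/-- Left-hand side of the inequality describing the one-sidedly fair capacity. -/
noncomputable def osfSum {K : ℕ} (p : Finset (Fin K) → ℝ) (R : Fin K → ℝ) : ℝ :=
  ∑ k, R k / (1 - ∏ l ∈ Finset.Iic k, (1 - pMarg p l))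

end BroadcastPEC

namespace BroadcastPEC

/-! ### Avoiding few proper subspaces over a finite field -/

theorem exists_notMem_of_card_lt {F V ι : Type*} [Field F] [Fintype F] [AddCommGroup V] [Module F V]
    (s : Finset ι) (p : ι → Submodule F V) (hp : ∀ i ∈ s, p i ≠ ⊤) (hs : s.card < Fintype.card F) :
    ∃ x, ∀ i ∈ s, x ∉ p i := by
  classical
  induction s using Finset.induction_on with
  | empty => exact ⟨0, by simp⟩
  | insert j s hj ih =>
    rw [Finset.card_insert_of_notMem hj] at hs
    obtain ⟨x, hx⟩ := ih (fun i hi => hp i (Finset.mem_insert_of_mem hi)) (by omega)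
    by_cases hxj : x ∈ p j
    swap
    · exact ⟨x, by simpa [hxj] using hx⟩
    obtain ⟨y, hy⟩ : ∃ y, y ∉ p j := by
      by_contra! h
      exact hp j (Finset.mem_insert_self _ _) (by ext z; simp [h z])
    have key : ∃ a : F, ∀ i ∈ s, y + a • x ∉ p i := by
      by_contra! h
      choose f hf hfp using h
      have hinj : Function.Injective f := by
        intro a b hab
        by_contra hne
        have h1 := (p (f a)).sub_mem (hfp a) (hab ▸ hfp b)
        rw [add_sub_add_left_eq_sub, ← sub_smul,
          Submodule.smul_mem_iff _ (sub_ne_zero.2 hne)] at h1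
        exact hx _ (hf a) h1
      have := Finset.card_le_card_of_injOn (s := Finset.univ) f (fun a _ => hf a) hinj.injOn
      rw [Finset.card_univ] at this
      omega
    obtain ⟨a, ha⟩ := key
    refine ⟨y + a • x, fun i hi => ?_⟩
    rcases Finset.mem_insert.1 hi with rfl | hi
    · rwa [Submodule.add_mem_iff_left _ (Submodule.smul_mem _ _ hxj)]
    · exact ha i hi

/-! ### Mixing coefficients that preserve decodability -/

section Decodability

variable {F : Type*} [Field F] {K : ℕ} {N : Fin K → ℕ}

/-- The span of the remaining vectors of the session of `X`, without that of `X` itself. -/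
def State.remainingExcept (s : State F N) (X : Packet N) : Submodule F (Packet N → F) :=
  Submodule.span F {u | ∃ j : Fin (N X.1), X.1 ∉ s.S ⟨X.1, j⟩ ∧ j ≠ X.2 ∧ u = s.v ⟨X.1, j⟩}

/-- Sending `u` to the targets of `sel` is as useful for each of them as sending it uncoded. -/
def State.Innovative (s : State F N) (kn : Fin K → Submodule F (Packet N → F)) (sel : Selection N)
    (u : Packet N → F) : Prop :=
  ∀ X : Packet N, sel.IsTarget X → X.1 ∉ s.S X → s.v X ∉ kn X.1 ⊔ s.remainingExcept X →
    u ∉ kn X.1 ⊔ s.remainingExcept X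

theorem State.exists_innovative [Fintype F] (hF : K < Fintype.card F) (s : State F N)
    (kn : Fin K → Submodule F (Packet N → F)) (sel : Selection N) :
    ∃ c : Fin K → F,
      s.Innovative kn sel (∑ X : Packet N with sel.IsTarget X, c X.1 • s.v X) := by
  classical
  let L : (Fin K → F) →ₗ[F] (Packet N → F) :=
    ∑ X : Packet N with sel.IsTarget X, (LinearMap.proj X.1).smulRight (s.v X)
  have hL : ∀ c, L c = ∑ X : Packet N with sel.IsTarget X, c X.1 • s.v X := fun c => by
    simp [L, LinearMap.sum_apply]
  let I : Finset (Packet N) := {X | sel.IsTarget X ∧ s.v X ∉ kn X.1 ⊔ s.remainingExcept X}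
  have hI : I.card ≤ K := by
    have h := Finset.card_le_card_of_injOn (s := I) (t := Finset.univ) (fun X => X.1)
      (fun _ _ => Finset.mem_univ _) (by
        rintro ⟨k, j⟩ hX ⟨k', j'⟩ hY (rfl : k = k')
        have h1 := (Finset.mem_filter.1 hX).2.1.2
        have h2 := (Finset.mem_filter.1 hY).2.1.2
        simp only at h1 h2
        rw [h1] at h2
        simpa using h2)
    simpa using h
  obtain ⟨c, hc⟩ := exists_notMem_of_card_lt I
    (fun X => (kn X.1 ⊔ s.remainingExcept X).comap L) (by
      intro X hX htop
      obtain ⟨hXt, hXv⟩ := (Finset.mem_filter.1 hX).2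
      apply hXv
      have h1 : Pi.single X.1 1 ∈ (kn X.1 ⊔ s.remainingExcept X).comap L := htop ▸ trivial
      rw [Submodule.mem_comap, hL, Finset.sum_eq_single X] at h1
      · simpa using h1
      · rintro ⟨k, j⟩ hY hne
        have hY := (Finset.mem_filter.1 hY).2
        have : k ≠ X.1 := by
          rintro rfl
          apply hne
          have := hY.2.symm.trans hXt.2
          obtain ⟨a, b⟩ := X
          simpa using this
        simp [this]
      · intro h
        exact absurd (Finset.mem_filter.2 ⟨Finset.mem_univ _, hXt⟩) h) (hI.trans_lt hF)
  refine ⟨c, fun X hX _ hv => ?_⟩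
  have := hc X (Finset.mem_filter.2 ⟨Finset.mem_univ _, hX, hv⟩)
  rwa [Submodule.mem_comap, hL] at this

/-- Coefficients chosen so as to keep the transmitted vector innovative. -/
noncomputable def State.goodCoeff [Fintype F] (hF : K < Fintype.card F) (s : State F N)
    (kn : Fin K → Submodule F (Packet N → F)) (sel : Selection N) : Fin K → F :=
  (s.exists_innovative hF kn sel).choose

/-- State and knowledge spaces if the good coefficients are used throughout. -/
noncomputable def goodRun [Fintype F] (hF : K < Fintype.card F) (select : History K → Selection N) :
    History K → State F N × (Fin K → Submodule F (Packet N → F))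
  | [] => (State.init, fun _ => ⊥)
  | A :: h =>
    let r := goodRun hF select h
    let s := r.1.beginSlot ⟨select, fun _ => r.1.goodCoeff hF r.2 (select h)⟩ h
    (s.endSlot A, fun k => r.2 k ⊔ (if k ∈ A then Submodule.span F {s.vtx} else ⊥))

/-- The algorithm with the given selections and the good coefficients. -/
noncomputable def goodAlgorithm [Fintype F] (hF : K < Fintype.card F)
    (select : History K → Selection N) : Algorithm F N where
  select := select
  coeff h := (goodRun hF select h).1.goodCoeff hF (goodRun hF select h).2 (select h)

theorem State.beginSlot_congr {alg alg' : Algorithm F N} {h : History K} (s : State F N)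
    (h1 : alg.select h = alg'.select h) (h2 : alg.coeff h = alg'.coeff h) :
    s.beginSlot alg h = s.beginSlot alg' h := by
  simp [State.beginSlot, h1, h2]

theorem goodRun_eq [Fintype F] (hF : K < Fintype.card F) (select : History K → Selection N)
    (h : History K) :
    goodRun hF select h =
      ((goodAlgorithm hF select).state h, fun k => (goodAlgorithm hF select).knowledge k h) := by
  induction h with
  | nil => rfl
  | cons A h ih =>
    have hb : (goodRun hF select h).1.beginSlot ⟨select, fun _ =>
        (goodRun hF select h).1.goodCoeff hF (goodRun hF select h).2 (select h)⟩ h =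
        ((goodAlgorithm hF select).state h).beginSlot (goodAlgorithm hF select) h := by
      rw [show (goodAlgorithm hF select).state h = (goodRun hF select h).1 by rw [ih]]
      exact State.beginSlot_congr _ rfl rfl
    rw [goodRun]
    simp only [hb, Algorithm.state, Algorithm.knowledge, Algorithm.tx]
    rw [ih]

theorem goodAlgorithm_innovative [Fintype F] (hF : K < Fintype.card F)
    (select : History K → Selection N) (h : History K) :
    ((goodAlgorithm hF select).state h).Innovative
      (fun k => (goodAlgorithm hF select).knowledge k h) (select h)
      (∑ X : Packet N with (select h).IsTarget X,
        (goodAlgorithm hF select).coeff h X.1 • ((goodAlgorithm hF select).state h).v X) := by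
  have h1 := (State.exists_innovative hF ((goodAlgorithm hF select).state h)
      (fun k => (goodAlgorithm hF select).knowledge k h) (select h)).choose_spec
  have h2 : (goodAlgorithm hF select).coeff h =
    ((goodAlgorithm hF select).state h).goodCoeff hF
      (fun k => (goodAlgorithm hF select).knowledge k h) (select h) := by
    have h3 := goodRun_eq hF select h
    change (goodRun hF select h).1.goodCoeff hF (goodRun hF select h).2 (select h) = _
    rw [h3]
  rw [h2]
  exact h1

/-- Overhearing sets, flag and selection do not depend on the mixing coefficients. -/
theorem Algorithm.state_congr {F' : Type*} [Field F'] {alg : Algorithm F N} {alg' : Algorithm F' N}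
    (hs : alg.select = alg'.select) (h : History K) :
    (alg.state h).S = (alg'.state h).S ∧ (alg.state h).change = (alg'.state h).change ∧
      (alg.state h).sel = (alg'.state h).sel := by
  induction h with
  | nil => exact ⟨rfl, rfl, rfl⟩
  | cons A h ih =>
    obtain ⟨h1, h2, h3⟩ := ih
    have hb : ((alg.state h).beginSlot alg h).sel = ((alg'.state h).beginSlot alg' h).sel := by
      unfold State.beginSlot
      rw [h2, hs]
      split_ifs
      · rfl
      · exact h3
    have hS : ((alg.state h).beginSlot alg h).S = ((alg'.state h).beginSlot alg' h).S := by
      unfold State.beginSlot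
      rw [h2]
      split_ifs <;> exact h1
    simp only [Algorithm.state, State.endSlot, hb, hS, and_self]

theorem Algorithm.Valid.congr {F' : Type*} [Field F'] {alg : Algorithm F N} {alg' : Algorithm F' N}
    (hs : alg.select = alg'.select) (h : alg.Valid) : alg'.Valid := by
  intro g hg
  obtain ⟨h1, h2, -⟩ := Algorithm.state_congr hs g
  have := h g (h2.trans hg)
  rwa [h1, hs] at this

/-- The transmission of a slot, with the state `s` at its beginning, can be used by all destinations
of the mixing set. -/
structure SlotInvariant (kn : Fin K → Submodule F (Packet N → F)) (s : State F N) : Prop where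
  noninterfering : ∀ i ∈ s.sel.T, s.vtx ∈ kn i ⊔ messageSpace F N i
  subset : ∀ X, s.sel.IsTarget X → s.sel.T ⊆ insert X.1 (s.S X)
  innovative : s.Innovative kn s.sel s.vtx

/-- Packets do not interfere with the destinations that overheard them, and the remaining spaces
complement the knowledge spaces. -/
structure RunInvariant (kn : Fin K → Submodule F (Packet N → F)) (s : State F N) : Prop where
  noninterfering : ∀ X : Packet N, ∀ i ∈ insert X.1 (s.S X), s.v X ∈ kn i ⊔ messageSpace F N i
  decodable : ∀ k, kn k ⊔ Submodule.span F {u | ∃ j : Fin (N k), k ∉ s.S ⟨k, j⟩ ∧ u = s.v ⟨k, j⟩}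
    = kn k ⊔ messageSpace F N k

theorem State.remaining_eq (s : State F N) (X : Packet N) (hX : X.1 ∉ s.S X) :
    Submodule.span F {u | ∃ j : Fin (N X.1), X.1 ∉ s.S ⟨X.1, j⟩ ∧ u = s.v ⟨X.1, j⟩} =
      s.remainingExcept X ⊔ Submodule.span F {s.v X} := by
  rw [State.remainingExcept, ← Submodule.span_union]
  congr 1
  ext u
  constructor
  · rintro ⟨j, hj, rfl⟩
    by_cases h : j = X.2
    · subst h; right; rfl
    · exact Or.inl ⟨j, hj, h, rfl⟩
  · rintro (⟨j, hj, h, rfl⟩ | rfl)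
    · exact ⟨j, hj, rfl⟩
    · exact ⟨X.2, hX, rfl⟩

theorem sup_span_singleton_eq {V : Type*} [AddCommGroup V] [Module F V] {W D : Submodule F V}
    {v u : V} (hW : W ⊔ Submodule.span F {v} = D) (hu : u ∈ D) (h : v ∉ W → u ∉ W) :
    W ⊔ Submodule.span F {u} = D := by
  apply le_antisymm
  · exact sup_le (hW ▸ le_sup_left) ((Submodule.span_singleton_le_iff_mem _ _).2 hu)
  · rw [← hW]
    refine sup_le le_sup_left ((Submodule.span_singleton_le_iff_mem _ _).2 ?_)
    by_cases hv : v ∈ W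
    · exact Submodule.mem_sup_left hv
    have hu' := h hv
    rw [← hW, Submodule.mem_sup] at hu
    obtain ⟨w, hw, z, hz, rfl⟩ := hu
    obtain ⟨a, rfl⟩ := Submodule.mem_span_singleton.1 hz
    have ha : a ≠ 0 := by
      rintro rfl
      simp [hw] at hu'
    have hmem : a⁻¹ • ((w + a • v) - w) ∈ W ⊔ Submodule.span F {w + a • v} :=
      Submodule.smul_mem _ _ (Submodule.sub_mem _
        (Submodule.mem_sup_right (Submodule.mem_span_singleton_self _)) (Submodule.mem_sup_left hw))
    rwa [add_sub_cancel_left, smul_smul, inv_mul_cancel₀ ha, one_smul] at hmem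

/-- Knowledge spaces after the vector `u` was received by the destinations in `A`. -/
def knowledgeStep (kn : Fin K → Submodule F (Packet N → F)) (u : Packet N → F)
    (A : Finset (Fin K)) (k : Fin K) : Submodule F (Packet N → F) :=
  kn k ⊔ (if k ∈ A then Submodule.span F {u} else ⊥)

variable {kn : Fin K → Submodule F (Packet N → F)} {s : State F N}

theorem RunInvariant.endSlot (hr : RunInvariant kn s) (hs : SlotInvariant kn s)
    (A : Finset (Fin K)) : RunInvariant (knowledgeStep kn s.vtx A) (s.endSlot A) := by
  have hmono : ∀ i, kn i ⊔ messageSpace F N i ≤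
      knowledgeStep kn s.vtx A i ⊔ messageSpace F N i :=
    fun i => sup_le_sup_right le_sup_left _
  refine ⟨fun X i hi => ?_, fun k => ?_⟩
  · simp only [State.endSlot] at hi ⊢
    split_ifs at hi ⊢ with hX
    · by_cases hiA : i ∈ A
      · refine Submodule.mem_sup_left (Submodule.mem_sup_right ?_)
        rw [if_pos hiA]
        exact Submodule.mem_span_singleton_self _
      · refine hmono i (hs.noninterfering i ?_)
        simp only [Finset.mem_insert, Finset.mem_union, Finset.mem_inter, hiA, or_false] at hi
        rcases hi with rfl | hi
        · exact hX.1.1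
        · exact hi.1
    · exact hmono i (hr.noninterfering X i hi)
  · by_cases hX : ∃ j : Fin (N k), s.sel.IsTarget ⟨k, j⟩ ∧ k ∉ s.S ⟨k, j⟩ ∧ ¬ A ⊆ s.S ⟨k, j⟩
    · obtain ⟨j, hj, hkj, hA⟩ := hX
      have huniq : ∀ j', s.sel.IsTarget ⟨k, j'⟩ → j' = j := by
        intro j' hj'
        simpa using hj'.2.symm.trans hj.2
      have hne : ∀ j', j' ≠ j → ¬ s.sel.IsTarget ⟨k, j'⟩ := fun j' h h' => h (huniq j' h')
      have hrem : ({u | ∃ j' : Fin (N k), k ∉ (s.endSlot A).S ⟨k, j'⟩ ∧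
          u = (s.endSlot A).v ⟨k, j'⟩} : Set (Packet N → F)) =
          {u | ∃ j' : Fin (N k), k ∉ s.S ⟨k, j'⟩ ∧ j' ≠ j ∧ u = s.v ⟨k, j'⟩} ∪
            (if k ∈ A then ∅ else {s.vtx}) := by
        ext u
        constructor
        · rintro ⟨j', h1, h2⟩
          by_cases hjj : j' = j
          · subst hjj
            right
            simp only [State.endSlot, hj, hA, not_false_eq_true, and_self, if_true,
              Finset.mem_union, not_or] at h1 h2
            rw [if_neg h1.2]
            exact h2
          · left
            refine ⟨j', ?_, hjj, ?_⟩
            · simpa [State.endSlot, hne j' hjj] using h1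
            · simpa [State.endSlot, hne j' hjj] using h2
        · rintro (⟨j', h1, h2, h3⟩ | h)
          · refine ⟨j', ?_, ?_⟩
            · simpa [State.endSlot, hne j' h2] using h1
            · simpa [State.endSlot, hne j' h2] using h3
          · split_ifs at h with hk
            · exact absurd h (Set.notMem_empty _)
            · refine ⟨j, ?_, ?_⟩
              · simp [State.endSlot, hj, hA, hkj, hk]
              · simpa [State.endSlot, hj, hA] using h
      have hD : (kn k ⊔ s.remainingExcept ⟨k, j⟩) ⊔ Submodule.span F {s.v ⟨k, j⟩} =
          kn k ⊔ messageSpace F N k := by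
        rw [← hr.decodable k, s.remaining_eq ⟨k, j⟩ hkj, sup_assoc]
      have hD' := sup_span_singleton_eq hD (hs.noninterfering k hj.1)
        (hs.innovative ⟨k, j⟩ hj hkj)
      rw [hrem]
      have hre : Submodule.span F {u | ∃ j' : Fin (N k), k ∉ s.S ⟨k, j'⟩ ∧ j' ≠ j ∧
          u = s.v ⟨k, j'⟩} = s.remainingExcept ⟨k, j⟩ := rfl
      rw [Submodule.span_union, hre]
      unfold knowledgeStep
      split_ifs with hk
      · have hle : Submodule.span F {s.vtx} ≤ kn k ⊔ messageSpace F N k :=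
          (Submodule.span_singleton_le_iff_mem _ _).2 (hs.noninterfering k hj.1)
        rw [Submodule.span_empty, sup_bot_eq, sup_right_comm, hD', sup_right_comm,
          sup_eq_left.2 hle]
      · rw [sup_bot_eq, ← sup_assoc, hD']
    · push Not at hX
      have hrem : ({u | ∃ j' : Fin (N k), k ∉ (s.endSlot A).S ⟨k, j'⟩ ∧
          u = (s.endSlot A).v ⟨k, j'⟩} : Set (Packet N → F)) =
          {u | ∃ j' : Fin (N k), k ∉ s.S ⟨k, j'⟩ ∧ u = s.v ⟨k, j'⟩} := by
        ext u
        refine exists_congr fun j => ?_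
        by_cases hj : s.sel.IsTarget ⟨k, j⟩
        · by_cases hk : k ∈ s.S ⟨k, j⟩
          · have : k ∈ (s.endSlot A).S ⟨k, j⟩ := by
              simp only [State.endSlot]
              split_ifs
              · exact Finset.mem_union_left _ (Finset.mem_inter.2 ⟨hj.1, hk⟩)
              · exact hk
            simp [hk, this]
          · simp [State.endSlot, hX j hj hk]
        · simp [State.endSlot, hj]
      rw [hrem]
      unfold knowledgeStep
      rw [sup_right_comm, hr.decodable k, sup_right_comm]

theorem SlotInvariant.endSlot (hs : SlotInvariant kn s)
    (A : Finset (Fin K)) (hc : (s.endSlot A).change = false) :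
    SlotInvariant (knowledgeStep kn s.vtx A) (s.endSlot A) := by
  have hA : ∀ X, s.sel.IsTarget X → A ⊆ s.S X := by
    intro X hX
    by_contra hne
    have : (s.endSlot A).change = true := by
      simp only [State.endSlot, decide_eq_true_eq]
      refine ⟨X, hX, fun h => hne ?_⟩
      rw [if_pos ⟨hX, hne⟩] at h
      rw [← h]
      exact Finset.subset_union_right
    simp [hc] at this
  have hS : (s.endSlot A).S = s.S := by
    funext X
    simp only [State.endSlot]
    rw [if_neg fun h => h.2 (hA X h.1)]
  have hv : (s.endSlot A).v = s.v := by
    funext X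
    simp only [State.endSlot]
    rw [if_neg fun h => h.2 (hA X h.1)]
  refine ⟨fun i hi => ?_, fun X hX => ?_, fun X hX hk => ?_⟩
  · exact (sup_le_sup_right le_sup_left (messageSpace F N i) :
      kn i ⊔ messageSpace F N i ≤ _) (hs.noninterfering i hi)
  · rw [hS]; exact hs.subset X hX
  · have h1 : (s.endSlot A).remainingExcept X = s.remainingExcept X := by
      unfold State.remainingExcept
      rw [hS, hv]
    rw [hS] at hk
    have h2 : knowledgeStep kn s.vtx A X.1 = kn X.1 := by
      unfold knowledgeStep
      rw [if_neg fun h => hk (hA X hX h), sup_bot_eq]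
    rw [h1, h2, hv]
    exact hs.innovative X hX hk

theorem RunInvariant.init : RunInvariant (fun _ => ⊥) (State.init : State F N) := by
  refine ⟨fun X i hi => ?_, fun k => ?_⟩
  · simp only [State.init, Finset.mem_insert, Finset.notMem_empty, or_false] at hi ⊢
    subst hi
    exact Submodule.mem_sup_right (Submodule.subset_span ⟨X.2, rfl⟩)
  · congr 2
    ext u
    simp [State.init, Set.mem_range, eq_comm]

theorem goodAlgorithm_invariant [Fintype F] (hF : K < Fintype.card F)
    (select : History K → Selection N) (hv : (goodAlgorithm hF select).Valid) (h : History K) :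
    RunInvariant (fun k => (goodAlgorithm hF select).knowledge k h)
        ((goodAlgorithm hF select).state h) ∧
      SlotInvariant (fun k => (goodAlgorithm hF select).knowledge k h)
        (((goodAlgorithm hF select).state h).beginSlot (goodAlgorithm hF select) h) := by
  set alg := goodAlgorithm hF select with halg
  have hslot : ∀ h, RunInvariant (fun k => alg.knowledge k h) (alg.state h) →
      (alg.state h).change = true →
      SlotInvariant (fun k => alg.knowledge k h) ((alg.state h).beginSlot alg h) := by
    intro h hr hc
    have hb : (alg.state h).beginSlot alg h =
      { alg.state h with
        sel := alg.select h
        vtx := ∑ X : Packet N with (alg.select h).IsTarget X,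
          alg.coeff h X.1 • (alg.state h).v X } := by
      rw [State.beginSlot, if_pos hc]
    have hsub := (hv h hc).2
    rw [hb]
    refine ⟨fun i hi => ?_, hsub, goodAlgorithm_innovative hF select h⟩
    refine Submodule.sum_mem _ fun X hX => Submodule.smul_mem _ _ ?_
    exact hr.noninterfering X i (hsub X (Finset.mem_filter.1 hX).2 hi)
  have hrun : ∀ h, RunInvariant (fun k => alg.knowledge k h) (alg.state h) →
      RunInvariant (fun k => alg.knowledge k h) ((alg.state h).beginSlot alg h) := by
    intro h hr
    unfold State.beginSlot
    split_ifs
    · exact ⟨hr.1, hr.2⟩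
    · exact hr
  induction h with
  | nil => exact ⟨RunInvariant.init, hslot [] RunInvariant.init rfl⟩
  | cons A h ih =>
    have hr : RunInvariant (fun k => alg.knowledge k (A :: h)) (alg.state (A :: h)) :=
      (hrun h ih.1).endSlot ih.2 A
    refine ⟨hr, ?_⟩
    by_cases hc : (alg.state (A :: h)).change = true
    · exact hslot _ hr hc
    · have := ih.2.endSlot A (by simpa [Algorithm.state] using hc)
      rw [State.beginSlot, if_neg hc]
      exact this

theorem goodAlgorithm_surelyDecodable [Fintype F] (hF : K < Fintype.card F)
    (select : History K → Selection N) (hv : (goodAlgorithm hF select).Valid) :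
    (goodAlgorithm hF select).SurelyDecodable :=
  fun h k => (goodAlgorithm_invariant hF select hv h).1.decodable k

/-! ### Decoders -/

/-- The span of the received pairs of a coding vector and the coded symbols. -/
def observedSpan {M : ℕ} (O : List (Option ((Packet N → F) × (Fin M → F)))) :
    Submodule F ((Packet N → F) × (Fin M → F)) :=
  Submodule.span F {z | some z ∈ O}

theorem Algorithm.mem_observedSpan (alg : Algorithm F N) {M : ℕ} (X : Packet N → Fin M → F)
    (k : Fin K) (h : History K) {u : Packet N → F} (hu : u ∈ alg.knowledge k h) :
    (u, ∑ Y, u Y • X Y) ∈ observedSpan (alg.observe X k h) := by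
  have h0 : ((0 : Packet N → F), ∑ Y, (0 : Packet N → F) Y • X Y) = 0 := by
    ext <;> simp
  induction h generalizing u with
  | nil =>
    simp only [Algorithm.knowledge, Submodule.mem_bot] at hu
    subst hu
    rw [h0]
    exact Submodule.zero_mem _
  | cons A h ih =>
    simp only [Algorithm.knowledge] at hu
    obtain ⟨a, ha, b, hb, rfl⟩ := Submodule.mem_sup.1 hu
    have h1 : observedSpan (alg.observe X k h) ≤ observedSpan (alg.observe X k (A :: h)) :=
      Submodule.span_mono fun z hz => List.mem_cons_of_mem _ hz
    have h2 : (b, ∑ Y, b Y • X Y) ∈ observedSpan (alg.observe X k (A :: h)) := by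
      split_ifs at hb with hk
      · obtain ⟨c, rfl⟩ := Submodule.mem_span_singleton.1 hb
        have : (c • alg.tx h, ∑ Y, (c • alg.tx h) Y • X Y) =
            c • (alg.tx h, ∑ Y, alg.tx h Y • X Y) := by
          simp [Finset.smul_sum, smul_smul]
        rw [this]
        refine Submodule.smul_mem _ _ (Submodule.subset_span ?_)
        simp [Algorithm.observe, hk]
      · rw [Submodule.mem_bot] at hb
        subst hb
        rw [h0]
        exact Submodule.zero_mem _
    have : (a + b, ∑ Y, (a + b) Y • X Y) =
        (a, ∑ Y, a Y • X Y) + (b, ∑ Y, b Y • X Y) := by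
      simp [add_smul, Finset.sum_add_distrib]
    rw [this]
    exact Submodule.add_mem _ (h1 (ih ha)) h2

theorem Algorithm.eq_of_mem_observedSpan (alg : Algorithm F N) {M : ℕ} (X : Packet N → Fin M → F)
    (k : Fin K) (h : History K) {z : (Packet N → F) × (Fin M → F)}
    (hz : z ∈ observedSpan (alg.observe X k h)) : z.2 = ∑ Y, z.1 Y • X Y := by
  unfold observedSpan at hz
  induction hz using Submodule.span_induction with
  | mem z hz =>
    simp only [Set.mem_ofPred_eq] at hz
    induction h with
    | nil => simp [Algorithm.observe] at hz
    | cons A h ih =>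
      simp only [Algorithm.observe, List.mem_cons] at hz
      rcases hz with hz | hz
      · split_ifs at hz with hk
        cases hz
        rfl
      · exact ih hz
  | zero => simp
  | add x y _ _ hx hy => simp [hx, hy, add_smul, Finset.sum_add_distrib]
  | smul a x _ hx => simp [hx, Finset.smul_sum, smul_smul]

/-- Decoders exist that recover all messages once the message spaces are known. -/
theorem Algorithm.exists_decoder (alg : Algorithm F N) (M : ℕ) :
    ∃ g : (k : Fin K) → List (Option ((Packet N → F) × (Fin M → F))) → Fin (N k) → Fin M → F,
      ∀ h : History K, (∀ k, messageSpace F N k ≤ alg.knowledge k h) →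
        ∀ (X : Packet N → Fin M → F) (k : Fin K) (j : Fin (N k)),
          g k (alg.observe X k h) j = X ⟨k, j⟩ := by
  classical
  refine ⟨fun k O j => if hy : ∃ y, ((Pi.single (⟨k, j⟩ : Packet N) (1 : F) : Packet N → F), y) ∈
    observedSpan O then hy.choose else 0, fun h hk X k j => ?_⟩
  have hsum : ∑ Y, (Pi.single (⟨k, j⟩ : Packet N) (1 : F) : Packet N → F) Y • X Y = X ⟨k, j⟩ := by
    rw [Finset.sum_eq_single ⟨k, j⟩]
    · simp
    · intro Y _ hY
      simp [hY]
    · simp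
  have h1 := alg.mem_observedSpan X k h (hk k (Submodule.subset_span ⟨j, rfl⟩))
  have h2 : ∃ y, ((Pi.single (⟨k, j⟩ : Packet N) (1 : F) : Packet N → F), y) ∈
    observedSpan (alg.observe X k h) := ⟨_, h1⟩
  simp only [dif_pos h2]
  exact (alg.eq_of_mem_observedSpan X k h h2.choose_spec).trans hsum

end Decodability

end BroadcastPEC

namespace BroadcastPEC

/-! ### Deviations of the feedback from its mean -/

section Deviation

variable {K : ℕ}

/-- Expectation of `f` of the feedback of `n` uses of the channel. -/
noncomputable def channelExp (p : Finset (Fin K) → ℝ) (n : ℕ) (f : History K → ℝ) : ℝ :=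
  ∑ ω : Fin n → Finset (Fin K), f (List.ofFn ω).reverse * ∏ t, p (ω t)

theorem channelExp_zero (p : Finset (Fin K) → ℝ) (f : History K → ℝ) :
    channelExp p 0 f = f [] := by
  simp [channelExp]

theorem channelExp_succ (p : Finset (Fin K) → ℝ) (n : ℕ) (f : History K → ℝ) :
    channelExp p (n + 1) f = channelExp p n fun h => ∑ A, p A * f (A :: h) := by
  unfold channelExp
  rw [← (Fin.snocEquiv (fun _ => Finset (Fin K))).sum_comp, Fintype.sum_prod_type, Finset.sum_comm]
  refine Finset.sum_congr rfl fun ω _ => ?_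
  rw [Finset.sum_mul]
  refine Finset.sum_congr rfl fun A _ => ?_
  simp only [Fin.snocEquiv_apply, List.ofFn_succ', Fin.snoc_castSucc, Fin.snoc_last,
    Fin.prod_univ_castSucc, List.concat_eq_append, List.reverse_append, List.reverse_cons,
    List.reverse_nil, List.nil_append, List.singleton_append]
  ring

variable {p : Finset (Fin K) → ℝ}

theorem channelExp_mono (hp : IsPEC p) (n : ℕ) {f g : History K → ℝ}
    (h : ∀ x : History K, x.length = n → f x ≤ g x) : channelExp p n f ≤ channelExp p n g :=
  Finset.sum_le_sum fun ω _ => mul_le_mul_of_nonneg_right (h _ (by simp))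
    (Finset.prod_nonneg fun t _ => hp.1 _)

theorem channelExp_const (hp : IsPEC p) (n : ℕ) (c : ℝ) : channelExp p n (fun _ => c) = c := by
  induction n with
  | zero => exact channelExp_zero p _
  | succ n ih => rw [channelExp_succ]; simp only [← Finset.sum_mul, hp.2, one_mul, ih]

theorem channelExp_add (n : ℕ) (f g : History K → ℝ) :
    channelExp p n (fun h => f h + g h) = channelExp p n f + channelExp p n g := by
  simp [channelExp, add_mul, Finset.sum_add_distrib]

theorem channelExp_mul_left (n : ℕ) (c : ℝ) (f : History K → ℝ) :
    channelExp p n (fun h => c * f h) = c * channelExp p n f := by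
  simp [channelExp, mul_assoc, Finset.mul_sum]

theorem channelExp_sum {ι : Type*} (s : Finset ι) (n : ℕ) (f : ι → History K → ℝ) :
    channelExp p n (fun h => ∑ i ∈ s, f i h) = ∑ i ∈ s, channelExp p n (f i) := by
  unfold channelExp
  rw [Finset.sum_comm]
  exact Finset.sum_congr rfl fun ω _ => Finset.sum_mul _ _ _

open Classical in
theorem channelProb_eq_channelExp (n : ℕ) (E : History K → Prop) :
    channelProb p n E = channelExp p n fun h => if E h then 1 else 0 := by
  unfold channelProb channelExp
  exact Finset.sum_congr rfl fun ω _ => by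
    by_cases hE : E (List.ofFn ω).reverse <;> simp [hE]

theorem channelProb_mono (hp : IsPEC p) (n : ℕ) {E E' : History K → Prop}
    (h : ∀ x : History K, x.length = n → E x → E' x) : channelProb p n E ≤ channelProb p n E' := by
  classical
  rw [channelProb_eq_channelExp, channelProb_eq_channelExp]
  refine channelExp_mono hp n fun x hx => ?_
  have := h x hx
  split_ifs with h1 h2
  · rfl
  · exact absurd (this h1) h2
  · exact zero_le_one
  · rfl

open Classical in
/-- Number of slots before which `a` holds and in which the set of receivers lies in `E`. -/
noncomputable def visits (a : History K → Prop) (E : Finset (Finset (Fin K))) : History K → ℕ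
  | [] => 0
  | A :: h => visits a E h + if a h ∧ A ∈ E then 1 else 0

/-- Deviation of the number of visits from what the channel statistics predict. -/
noncomputable def deviation (p : Finset (Fin K) → ℝ) (a : History K → Prop)
    (E : Finset (Finset (Fin K))) (h : History K) : ℝ :=
  visits a E h - (∑ A ∈ E, p A) * visits a Finset.univ h

theorem channelExp_deviation_sq_le (hp : IsPEC p) (a : History K → Prop)
    (E : Finset (Finset (Fin K))) (n : ℕ) :
    channelExp p n (fun h => deviation p a E h ^ 2) ≤ n := by
  classical
  induction n with
  | zero => simp [channelExp_zero, deviation, visits]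
  | succ n ih =>
    rw [channelExp_succ]
    set P := ∑ A ∈ E, p A with hP
    have hP0 : 0 ≤ P := Finset.sum_nonneg fun A _ => hp.1 A
    have hP1 : P ≤ 1 := by
      rw [← hp.2]
      exact Finset.sum_le_sum_of_subset_of_nonneg (Finset.subset_univ _) fun A _ _ => hp.1 A
    have hsum : ∑ A, p A * (if A ∈ E then (1 : ℝ) else 0) = P := by
      simp [Finset.sum_ite_mem, hP]
    have hstep : ∀ h : History K, ∑ A, p A * deviation p a E (A :: h) ^ 2 ≤
        deviation p a E h ^ 2 + 1 := by
      intro h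
      by_cases ha : a h
      · have h1 : ∀ A, p A * deviation p a E (A :: h) ^ 2 =
            p A * (deviation p a E h - P) ^ 2 +
            p A * (if A ∈ E then (1 : ℝ) else 0) * (1 + 2 * (deviation p a E h - P)) := by
          intro A
          have h2 : deviation p a E (A :: h) =
              deviation p a E h - P + (if A ∈ E then (1 : ℝ) else 0) := by
            simp only [deviation, visits, ha, true_and, Finset.mem_univ, if_true, ← hP]
            push_cast
            ring
          rw [h2]
          split_ifs <;> ring
        simp only [h1]
        rw [Finset.sum_add_distrib, ← Finset.sum_mul, ← Finset.sum_mul, hp.2, hsum]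
        nlinarith
      · have h1 : ∀ A, deviation p a E (A :: h) = deviation p a E h := by
          intro A
          simp [deviation, visits, ha]
        simp only [h1]
        rw [← Finset.sum_mul, hp.2]
        linarith
    refine (channelExp_mono hp n (fun h _ => hstep h)).trans ?_
    rw [channelExp_add, channelExp_const hp]
    push_cast
    linarith

theorem le_channelProb_deviation (hp : IsPEC p) {ι : Type*} [Fintype ι] (a : ι → History K → Prop)
    (E : ι → Finset (Finset (Fin K))) {δ : ℝ} (hδ : 0 < δ) {n : ℕ} (hn : 0 < n) :
    1 - Fintype.card ι / (δ ^ 2 * n) ≤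
      channelProb p n fun h => ∀ i, |deviation p (a i) (E i) h| ≤ δ * n := by
  classical
  have hn' : (0 : ℝ) < n := by exact_mod_cast hn
  rw [channelProb_eq_channelExp]
  have h1 : ∀ h : History K, 1 + (-(1 / (δ * n) ^ 2)) * ∑ i, deviation p (a i) (E i) h ^ 2 ≤
      if ∀ i, |deviation p (a i) (E i) h| ≤ δ * n then 1 else 0 := by
    intro h
    have h0 : ∀ i, 0 ≤ deviation p (a i) (E i) h ^ 2 := fun i => sq_nonneg _
    split_ifs with hE
    · have : 0 ≤ 1 / (δ * n) ^ 2 * ∑ i, deviation p (a i) (E i) h ^ 2 :=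
        mul_nonneg (by positivity) (Finset.sum_nonneg fun i _ => h0 i)
      linarith
    · push Not at hE
      obtain ⟨i, hi⟩ := hE
      have h2 : (δ * n) ^ 2 ≤ deviation p (a i) (E i) h ^ 2 := by
        rw [← sq_abs (deviation p (a i) (E i) h)]
        exact pow_le_pow_left₀ (by positivity) hi.le 2
      have h3 := Finset.single_le_sum (fun i _ => h0 i) (Finset.mem_univ i)
      have h4 : 1 ≤ 1 / (δ * n) ^ 2 * ∑ i, deviation p (a i) (E i) h ^ 2 := by
        rw [one_div, ← div_eq_inv_mul, one_le_div (by positivity)]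
        exact h2.trans h3
      linarith
  refine le_trans ?_ (channelExp_mono hp n
    (f := fun h => 1 + (-(1 / (δ * n) ^ 2)) * ∑ i, deviation p (a i) (E i) h ^ 2)
    fun h _ => by convert h1 h)
  rw [channelExp_add, channelExp_const hp, channelExp_mul_left, channelExp_sum]
  have h5 : ∑ i, channelExp p n (fun h => deviation p (a i) (E i) h ^ 2) ≤
      Fintype.card ι * n := by
    refine (Finset.sum_le_card_nsmul _ _ _
      fun i _ => channelExp_deviation_sq_le hp (a i) (E i) n).trans ?_
    simp
  have h6 : 1 / (δ * n) ^ 2 * ∑ i, channelExp p n (fun h => deviation p (a i) (E i) h ^ 2) ≤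
      Fintype.card ι / (δ ^ 2 * n) := by
    refine (mul_le_mul_of_nonneg_left h5 (by positivity)).trans (le_of_eq ?_)
    field_simp
  linarith

end Deviation

end BroadcastPEC

namespace BroadcastPEC

/-! ### Packet evolution along a schedule of phases -/

/-- A schedule: for each phase its mixing set, and for each session and overhearing set a bound for
the number of packets that may leave the overhearing set during the phase. -/
structure Schedule (K : ℕ) where
  len : ℕ
  mix : ℕ → Finset (Fin K)
  quota : ℕ → Fin K → Finset (Fin K) → ℕ∞

/-- Overhearing sets, the phase of the preceding slot, and for each phase, session and overhearing
set the number of packets that have left it. -/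
structure Progress {K : ℕ} (N : Fin K → ℕ) where
  S : Packet N → Finset (Fin K)
  phase : ℕ
  cnt : ℕ → Fin K → Finset (Fin K) → ℕ

section Schedule

variable {K : ℕ} (D : Schedule K) {N : Fin K → ℕ}

/-- `X` may be a target packet in phase `i`. -/
def Progress.Eligible (m : Progress N) (i : ℕ) (X : Packet N) : Prop :=
  X.1 ∈ D.mix i ∧ X.1 ∉ m.S X ∧ D.mix i ⊆ insert X.1 (m.S X) ∧
    (m.cnt i X.1 (m.S X) : ℕ∞) < D.quota i X.1 (m.S X)

/-- The phase of the next slot: the first one that has eligible packets. -/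
noncomputable def Progress.cur (m : Progress N) : ℕ :=
  sInf {i | m.phase ≤ i ∧ (D.len ≤ i ∨ ∃ X, m.Eligible D i X)}

open Classical in
/-- In each phase, every session of the mixing set sends an eligible packet if it has one. -/
noncomputable def Progress.sel (m : Progress N) : Selection N :=
  if m.cur D < D.len then
    ⟨D.mix (m.cur D), fun k =>
      if h : ∃ j, m.Eligible D (m.cur D) ⟨k, j⟩ then some h.choose else none⟩
  else ⟨Finset.univ, fun _ => none⟩

open Classical in
/-- Progress made in a slot whose packet was received by the destinations in `A`. -/
noncomputable def Progress.step (m : Progress N) (A : Finset (Fin K)) : Progress N where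
  S X := if (m.sel D).IsTarget X ∧ ¬ A ⊆ m.S X then ((m.sel D).T ∩ m.S X) ∪ A else m.S X
  phase := m.cur D
  cnt i k S := m.cnt i k S +
    if (∃ X, (m.sel D).IsTarget X ∧ X.1 = k ∧ m.S X = S ∧ m.cur D = i) ∧ ¬ A ⊆ S then 1 else 0

/-- Progress made during the slots of a history. -/
noncomputable def progress (N : Fin K → ℕ) : History K → Progress N
  | [] => ⟨fun _ => ∅, 0, fun _ _ _ => 0⟩
  | A :: h => (progress N h).step D A

theorem Progress.cur_mem (m : Progress N) :
    m.cur D ∈ {i | m.phase ≤ i ∧ (D.len ≤ i ∨ ∃ X, m.Eligible D i X)} :=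
  Nat.sInf_mem ⟨max m.phase D.len, le_max_left _ _, Or.inl (le_max_right _ _)⟩

variable {D}

theorem Progress.phase_le_cur (m : Progress N) : m.phase ≤ m.cur D := (m.cur_mem D).1

theorem Progress.exists_eligible {m : Progress N} (h : m.cur D < D.len) :
    ∃ X, m.Eligible D (m.cur D) X :=
  (m.cur_mem D).2.resolve_left h.not_ge

theorem Progress.not_eligible {m : Progress N} {i : ℕ} (h1 : m.phase ≤ i) (h2 : i < m.cur D)
    (X : Packet N) : ¬ m.Eligible D i X :=
  fun h => Nat.notMem_of_lt_sInf h2 ⟨h1, Or.inr ⟨X, h⟩⟩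

theorem Progress.eligible_of_isTarget {m : Progress N} {X : Packet N}
    (h : (m.sel D).IsTarget X) : m.cur D < D.len ∧ m.Eligible D (m.cur D) X := by
  unfold Progress.sel Selection.IsTarget at h
  split_ifs at h with hc
  · refine ⟨hc, ?_⟩
    obtain ⟨k, j⟩ := X
    obtain ⟨-, h⟩ := h
    simp only at h
    split_ifs at h with he
    · cases h
      exact he.choose_spec
  · simp at h

theorem Progress.exists_isTarget {m : Progress N} (hc : m.cur D < D.len) {k : Fin K}
    {j : Fin (N k)} (h : m.Eligible D (m.cur D) ⟨k, j⟩) :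
    ∃ j', (m.sel D).IsTarget ⟨k, j'⟩ := by
  have he : ∃ j, m.Eligible D (m.cur D) ⟨k, j⟩ := ⟨j, h⟩
  refine ⟨he.choose, ?_⟩
  unfold Progress.sel Selection.IsTarget
  rw [if_pos hc]
  exact ⟨h.1, by simp only [dif_pos he]⟩

theorem Progress.sel_T {m : Progress N} (hc : m.cur D < D.len) :
    (m.sel D).T = D.mix (m.cur D) := by
  unfold Progress.sel
  rw [if_pos hc]

theorem Progress.sel_T_nonempty (hK : 0 < K) (m : Progress N) : (m.sel D).T.Nonempty := by
  by_cases hc : m.cur D < D.len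
  · rw [Progress.sel_T hc]
    obtain ⟨X, hX⟩ := Progress.exists_eligible hc
    exact ⟨X.1, hX.1⟩
  · unfold Progress.sel
    rw [if_neg hc]
    exact ⟨⟨0, hK⟩, Finset.mem_univ _⟩

theorem Selection.IsTarget.unique {s : Selection N} {k : Fin K} {j j' : Fin (N k)}
    (h : s.IsTarget ⟨k, j⟩) (h' : s.IsTarget ⟨k, j'⟩) : j = j' := by
  simpa using h.2.symm.trans h'.2

theorem Progress.cur_step (m : Progress N) (A : Finset (Fin K)) :
    m.cur D ≤ (m.step D A).cur D :=
  (m.step D A).phase_le_cur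

theorem Progress.sel_step {m : Progress N} {A : Finset (Fin K)}
    (h : ∀ X, (m.sel D).IsTarget X → A ⊆ m.S X) : (m.step D A).sel D = m.sel D := by
  have hstep : m.step D A = ⟨m.S, m.cur D, m.cnt⟩ := by
    unfold Progress.step
    congr 1
    · funext X
      rw [if_neg fun hX => hX.2 (h X hX.1)]
    · funext i k S
      rw [if_neg, add_zero]
      rintro ⟨⟨X, hX, rfl, rfl, rfl⟩, hA⟩
      exact hA (h X hX)
  have hcur : (m.step D A).cur D = m.cur D := by
    refine le_antisymm (Nat.sInf_le ⟨?_, ?_⟩) (m.cur_step A)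
    · rw [hstep]
    · rw [hstep]
      exact (m.cur_mem D).2
  have hel : (m.step D A).Eligible D = m.Eligible D := by
    rw [hstep]
    rfl
  unfold Progress.sel
  rw [hcur, hel]

variable (D)

theorem state_eq_progress {F : Type*} [Field F] (alg : Algorithm F N)
    (ha : alg.select = fun h => (progress D N h).sel D) (h : History K) :
    (alg.state h).S = (progress D N h).S ∧
      ((alg.state h).beginSlot alg h).sel = (progress D N h).sel D := by
  induction h with
  | nil =>
    refine ⟨rfl, ?_⟩
    simp [Algorithm.state, State.beginSlot, State.init, ha]
  | cons A h ih =>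
    obtain ⟨h1, h2⟩ := ih
    have hS : ((alg.state h).beginSlot alg h).S = (progress D N h).S := by
      rw [← h1]
      unfold State.beginSlot
      split_ifs <;> rfl
    have h3 : (alg.state (A :: h)).S = (progress D N (A :: h)).S := by
      funext X
      simp only [Algorithm.state, State.endSlot, progress, Progress.step, hS, h2]
    refine ⟨h3, ?_⟩
    by_cases hc : (alg.state (A :: h)).change = true
    · rw [State.beginSlot, if_pos hc, ha]
    · rw [State.beginSlot, if_neg hc]
      simp only [Algorithm.state, State.endSlot, hS, h2, decide_eq_true_eq, not_exists, not_and,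
        ne_eq, not_not] at hc ⊢
      symm
      rw [progress]
      apply Progress.sel_step
      intro X hX
      by_contra hA
      have := hc X hX
      rw [if_pos ⟨hX, hA⟩] at this
      exact hA (this ▸ Finset.subset_union_right)

theorem valid_of_select_eq {F : Type*} [Field F] (hK : 0 < K) (alg : Algorithm F N)
    (ha : alg.select = fun h => (progress D N h).sel D) : alg.Valid := by
  intro h _
  rw [ha]
  refine ⟨Progress.sel_T_nonempty hK _, fun X hX => ?_⟩
  obtain ⟨hc, he⟩ := Progress.eligible_of_isTarget hX
  rw [(state_eq_progress D alg ha h).1]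
  simp only
  rw [Progress.sel_T hc]
  exact he.2.2.1

/-! ### Bookkeeping -/

variable (N)

/-- In the next slot, which belongs to phase `i`, a packet with overhearing set `S` is the target of
session `k`. -/
def Active (i : ℕ) (k : Fin K) (S : Finset (Fin K)) (h : History K) : Prop :=
  ∃ X, ((progress D N h).sel D).IsTarget X ∧ X.1 = k ∧ (progress D N h).S X = S ∧
    (progress D N h).cur D = i

/-- Receptions by which a packet leaves the overhearing set `S`. -/
def escapes (S : Finset (Fin K)) : Finset (Finset (Fin K)) := {A | ¬ A ⊆ S}

/-- Receptions by which a packet moves from `S` to `S'` if its share of the mixing set is `T`. -/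
def moves (T S S' : Finset (Fin K)) : Finset (Finset (Fin K)) := {A | ¬ A ⊆ S ∧ T ∪ A = S'}

/-- Number of packets of session `k` with overhearing set `S`. -/
noncomputable def stock (k : Fin K) (S : Finset (Fin K)) (h : History K) : ℕ :=
  Finset.card {j : Fin (N k) | (progress D N h).S ⟨k, j⟩ = S}

/-- Number of packets of session `k` with overhearing set `S` after the phases before `i`. -/
noncomputable def stockBefore (i : ℕ) (k : Fin K) (S : Finset (Fin K)) : History K → ℕ
  | [] => stock D N k S []
  | A :: h => if (progress D N h).cur D < i then stock D N k S (A :: h) else stockBefore i k S h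

/-- Number of packets of session `k` that enter the overhearing set `S'` in phase `i`. -/
noncomputable def inflow (i : ℕ) (k : Fin K) (S' : Finset (Fin K)) (h : History K) : ℕ :=
  ∑ S, visits (Active D N i k S) (moves ((D.mix i).erase k) S S') h

/-- Number of slots of phase `i`. -/
noncomputable def slots (i : ℕ) (h : History K) : ℕ :=
  visits (fun h => (progress D N h).cur D = i ∧ i < D.len) Finset.univ h

variable {D N}

theorem Active.cur_eq {i : ℕ} {k : Fin K} {S : Finset (Fin K)} {h : History K}
    (ha : Active D N i k S h) : (progress D N h).cur D = i := by
  obtain ⟨X, -, -, -, hi⟩ := ha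
  exact hi

theorem Active.eligible {i : ℕ} {k : Fin K} {S : Finset (Fin K)} {h : History K}
    (ha : Active D N i k S h) : i < D.len ∧ k ∈ D.mix i ∧ k ∉ S ∧ D.mix i ⊆ insert k S ∧
      ((progress D N h).cnt i k S : ℕ∞) < D.quota i k S := by
  obtain ⟨X, hX, rfl, rfl, rfl⟩ := ha
  obtain ⟨h1, h2⟩ := Progress.eligible_of_isTarget hX
  exact ⟨h1, h2⟩

theorem Active.set_eq {i i' : ℕ} {k : Fin K} {S S' : Finset (Fin K)} {h : History K}
    (ha : Active D N i k S h) (ha' : Active D N i' k S' h) : S = S' := by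
  obtain ⟨⟨k, j⟩, hX, rfl, rfl, rfl⟩ := ha
  obtain ⟨⟨k', j'⟩, hX', h1, rfl, -⟩ := ha'
  simp only at h1
  subst h1
  rw [hX.unique hX']

theorem cur_mono (A : Finset (Fin K)) (h : History K) :
    (progress D N h).cur D ≤ (progress D N (A :: h)).cur D := Progress.cur_step _ _

theorem visits_eq_zero {a : History K → Prop} {E : Finset (Finset (Fin K))} {i : ℕ}
    (ha : ∀ h, a h → (progress D N h).cur D = i) {h : History K}
    (hi : (progress D N h).cur D < i) : visits a E h = 0 := by
  induction h with
  | nil => rfl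
  | cons A h ih =>
    have h1 := (cur_mono A h).trans_lt hi
    rw [visits, ih h1, if_neg fun hh => h1.ne (ha h hh.1)]

theorem visits_eq_zero_of_forall {a : History K → Prop} {E : Finset (Finset (Fin K))}
    (ha : ∀ h, ¬ a h) (h : History K) : visits a E h = 0 := by
  induction h with
  | nil => rfl
  | cons A h ih => rw [visits, ih, if_neg fun hh => ha h hh.1]

theorem visits_eq_sum (a : History K → Prop) (E : Finset (Finset (Fin K))) (h : History K) :
    visits a E h = ∑ A ∈ E, visits a {A} h := by
  classical
  induction h with
  | nil => simp [visits]
  | cons A h ih =>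
    simp only [visits]
    rw [Finset.sum_add_distrib, ← ih]
    by_cases ha : a h <;> simp [ha]

theorem cnt_eq_visits (i : ℕ) (k : Fin K) (S : Finset (Fin K)) (h : History K) :
    (progress D N h).cnt i k S = visits (Active D N i k S) (escapes S) h := by
  induction h with
  | nil => rfl
  | cons A h ih =>
    rw [visits, ← ih]
    have hA : A ∈ escapes S ↔ ¬ A ⊆ S := by simp [escapes]
    simp only [progress, Progress.step]
    by_cases ha : Active D N i k S h ∧ A ∈ escapes S
    · rw [if_pos ha, if_pos ⟨ha.1, hA.1 ha.2⟩]
    · rw [if_neg ha, if_neg fun hh => ha ⟨hh.1, hA.2 hh.2⟩]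

theorem outflow_le_quota (i : ℕ) (k : Fin K) (S : Finset (Fin K)) (h : History K) :
    (visits (Active D N i k S) (escapes S) h : ℕ∞) ≤ D.quota i k S := by
  induction h with
  | nil => simp [visits]
  | cons A h ih =>
    rw [visits]
    split_ifs with ha
    · have := ha.1.eligible.2.2.2.2
      rw [cnt_eq_visits] at this
      push_cast
      exact Order.add_one_le_of_lt this
    · simpa using ih

theorem stock_cons_of_no_target {k : Fin K} {h : History K}
    (hk : ∀ i S, ¬ Active D N i k S h) (A S : Finset (Fin K)) :
    stock D N k S (A :: h) = stock D N k S h := by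
  unfold stock
  congr 1
  refine Finset.filter_congr fun j _ => ?_
  have : (progress D N (A :: h)).S ⟨k, j⟩ = (progress D N h).S ⟨k, j⟩ := by
    simp only [progress, Progress.step]
    rw [if_neg]
    exact fun hX => hk _ _ ⟨⟨k, j⟩, hX.1, rfl, rfl, rfl⟩
  rw [this]

theorem stock_cons_of_active {i : ℕ} {k : Fin K} {S : Finset (Fin K)} {h : History K}
    (ha : Active D N i k S h) (A S' : Finset (Fin K)) :
    stock D N k S' (A :: h) + (if S = S' ∧ ¬ A ⊆ S then 1 else 0) =
      stock D N k S' h + if A ∈ moves ((D.mix i).erase k) S S' then 1 else 0 := by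
  classical
  have hel := ha.eligible
  obtain ⟨⟨k, j⟩, hX, rfl, rfl, rfl⟩ := ha
  simp only at hel ⊢
  have hT : (((progress D N h).sel D).T ∩ (progress D N h).S ⟨k, j⟩) =
      (D.mix ((progress D N h).cur D)).erase k := by
    rw [Progress.sel_T hel.1]
    ext l
    simp only [Finset.mem_inter, Finset.mem_erase]
    constructor
    · rintro ⟨h1, h2⟩
      exact ⟨fun h3 => hel.2.2.1 (h3 ▸ h2), h1⟩
    · rintro ⟨h1, h2⟩
      exact ⟨h2, (Finset.mem_insert.1 (hel.2.2.2.1 h2)).resolve_left h1⟩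
  set S := (progress D N h).S ⟨k, j⟩ with hS
  have hother : ∀ j', j' ≠ j → (progress D N (A :: h)).S ⟨k, j'⟩ = (progress D N h).S ⟨k, j'⟩ := by
    intro j' hj
    simp only [progress, Progress.step]
    rw [if_neg fun hh => hj (hh.1.unique hX)]
  have hself : (progress D N (A :: h)).S ⟨k, j⟩ =
      if A ⊆ S then S else (D.mix ((progress D N h).cur D)).erase k ∪ A := by
    simp only [progress, Progress.step, ← hS, hT, hX, true_and]
    split_ifs <;> rfl
  have hcard : ∀ g : History K, stock D N k S' g =
      Finset.card {j' ∈ Finset.univ.erase j | (progress D N g).S ⟨k, j'⟩ = S'} +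
        if (progress D N g).S ⟨k, j⟩ = S' then 1 else 0 := by
    intro g
    unfold stock
    rw [Finset.card_filter, Finset.card_filter, ← Finset.sum_erase_add _ _ (Finset.mem_univ j)]
  have hsame : ({j' ∈ Finset.univ.erase j | (progress D N (A :: h)).S ⟨k, j'⟩ = S'} : Finset _) =
      {j' ∈ Finset.univ.erase j | (progress D N h).S ⟨k, j'⟩ = S'} := by
    refine Finset.filter_congr fun j' hj' => ?_
    rw [hother j' (Finset.ne_of_mem_erase hj')]
  rw [hcard, hcard h, hsame, hself, ← hS]
  simp only [moves, Finset.mem_filter, Finset.mem_univ, true_and]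
  clear_value S
  by_cases hSS : S = S'
  · subst hSS
    by_cases hA : A ⊆ S
    · simp [hA]
    · simp only [hA, not_false_eq_true, and_self, if_true, if_false, true_and]
      omega
  · by_cases hA : A ⊆ S <;> simp [hA, hSS]

theorem stockBefore_eq_stock {i : ℕ} {k : Fin K} {S : Finset (Fin K)} {h : History K}
    (hi : (progress D N h).cur D < i) : stockBefore D N i k S h = stock D N k S h := by
  cases h with
  | nil => rfl
  | cons A h => rw [stockBefore, if_pos ((cur_mono A h).trans_lt hi)]

theorem stockBefore_zero (k : Fin K) (S : Finset (Fin K)) (h : History K) :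
    stockBefore D N 0 k S h = if S = ∅ then N k else 0 := by
  induction h with
  | nil =>
    simp only [stockBefore, stock, progress]
    split_ifs with hS
    · simp [hS]
    · simp [Ne.symm hS]
  | cons A h ih => rw [stockBefore, if_neg (Nat.not_lt_zero _), ih]

theorem stockBefore_succ (i : ℕ) (k : Fin K) (S' : Finset (Fin K)) (h : History K) :
    stockBefore D N (i + 1) k S' h + visits (Active D N i k S') (escapes S') h =
      stockBefore D N i k S' h + inflow D N i k S' h := by
  classical
  induction h with
  | nil => simp [stockBefore, inflow, visits]
  | cons A h ih =>
    unfold inflow at ih ⊢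
    simp only [visits]
    rw [Finset.sum_add_distrib]
    rcases lt_trichotomy ((progress D N h).cur D) i with hc | hc | hc
    · have h1 : ∀ S E, visits (Active D N i k S) E h = 0 := fun S E =>
        visits_eq_zero (fun _ => Active.cur_eq) hc
      have h2 : ∀ S, ¬ Active D N i k S h := fun S ha => hc.ne ha.cur_eq
      rw [stockBefore, if_pos (Nat.lt_succ_of_lt hc), stockBefore, if_pos hc]
      simp [h1, h2]
    · rw [stockBefore, if_pos (hc ▸ Nat.lt_succ_self _), stockBefore, if_neg hc.not_lt]
      rw [stockBefore_eq_stock (hc ▸ Nat.lt_succ_self _)] at ih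
      by_cases ha : ∃ S, Active D N i k S h
      · obtain ⟨S, ha⟩ := ha
        have huniq : ∀ S₁, Active D N i k S₁ h ↔ S₁ = S :=
          fun S₁ => ⟨fun h1 => h1.set_eq ha, fun h1 => h1 ▸ ha⟩
        have h1 := stock_cons_of_active ha A S'
        have h2 : (∑ S₁, if Active D N i k S₁ h ∧ A ∈ moves ((D.mix i).erase k) S₁ S' then 1 else 0)
            = if A ∈ moves ((D.mix i).erase k) S S' then 1 else 0 := by
          simp only [huniq]
          rw [Finset.sum_eq_single S]
          · simp
          · intro b _ hb
            simp [hb]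
          · simp
        have h3 : (if Active D N i k S' h ∧ A ∈ escapes S' then 1 else 0) =
            if S = S' ∧ ¬ A ⊆ S then 1 else 0 := by
          simp only [huniq, escapes, Finset.mem_filter, Finset.mem_univ, true_and]
          by_cases hSS : S = S'
          · subst hSS; simp
          · simp [hSS, Ne.symm hSS]
        rw [h2, h3]
        omega
      · push Not at ha
        have h1 : ∀ i' S, ¬ Active D N i' k S h := by
          intro i' S h2
          have : i' = i := h2.cur_eq.symm.trans hc
          exact ha S (this ▸ h2)
        rw [stock_cons_of_no_target h1]
        simp only [ha, false_and, if_false, add_zero, Finset.sum_const_zero]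
        exact ih
    · have h2 : ∀ S, ¬ Active D N i k S h := fun S ha => hc.ne' ha.cur_eq
      rw [stockBefore, if_neg (by omega), stockBefore, if_neg hc.not_gt]
      simp only [h2, false_and, if_false, add_zero, Finset.sum_const_zero]
      exact ih

theorem quota_or_stockBefore_eq_zero {i : ℕ} {k : Fin K} {S : Finset (Fin K)} {h : History K}
    (hi : i < (progress D N h).cur D) (h1 : k ∈ D.mix i) (h2 : k ∉ S)
    (h3 : D.mix i ⊆ insert k S) :
    D.quota i k S ≤ visits (Active D N i k S) (escapes S) h ∨
      stockBefore D N (i + 1) k S h = 0 := by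
  have key : ∀ g : History K, (progress D N g).phase ≤ i → i < (progress D N g).cur D →
      D.quota i k S ≤ visits (Active D N i k S) (escapes S) g ∨ stock D N k S g = 0 := by
    intro g hg1 hg2
    by_contra! hne
    obtain ⟨hq, hs⟩ := hne
    obtain ⟨j, hj⟩ := Finset.card_pos.1 (Nat.pos_of_ne_zero hs)
    have hj : (progress D N g).S ⟨k, j⟩ = S := (Finset.mem_filter.1 hj).2
    apply Progress.not_eligible hg1 hg2 ⟨k, j⟩
    unfold Progress.Eligible
    simp only [hj, cnt_eq_visits]
    exact ⟨h1, h2, h3, hq⟩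
  induction h with
  | nil => exact key [] (Nat.zero_le _) hi
  | cons A h ih =>
    rw [stockBefore]
    split_ifs with hc
    · exact key (A :: h) (Nat.lt_succ_iff.1 hc) hi
    · have hc : i < (progress D N h).cur D := by omega
      rw [visits, if_neg fun hh => hc.ne' hh.1.cur_eq, add_zero]
      exact ih hc

theorem slots_le_of_eligible {i : ℕ} {h : History K} (hi : (progress D N h).cur D = i)
    (hl : i < D.len) {k : Fin K} {j : Fin (N k)} (he : (progress D N h).Eligible D i ⟨k, j⟩) :
    slots D N i h ≤ ∑ S, visits (Active D N i k S) Finset.univ h := by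
  classical
  induction h generalizing j with
  | nil => simp [slots, visits]
  | cons A h ih =>
    unfold slots at ih ⊢
    simp only [visits]
    rcases (hi ▸ cur_mono A h : (progress D N h).cur D ≤ i).lt_or_eq with hc | hc
    · rw [visits_eq_zero (fun _ hh => hh.1) hc, if_neg fun hh => hc.ne hh.1.1]
      exact Nat.zero_le _
    · have hex : ∃ j', (progress D N h).Eligible D i ⟨k, j'⟩ := by
        by_contra! hne
        have hnt : ∀ j', ¬ ((progress D N h).sel D).IsTarget ⟨k, j'⟩ := fun j' ht =>
          hne j' (hc ▸ (Progress.eligible_of_isTarget ht).2)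
        apply hne j
        have hS : (progress D N (A :: h)).S ⟨k, j⟩ = (progress D N h).S ⟨k, j⟩ := by
          simp [progress, Progress.step, hnt j]
        have hcnt : ∀ S, (progress D N (A :: h)).cnt i k S = (progress D N h).cnt i k S := by
          intro S
          simp only [progress, Progress.step]
          rw [if_neg, add_zero]
          rintro ⟨⟨⟨k', j'⟩, hX, rfl, -, -⟩, -⟩
          exact hnt j' hX
        simpa only [Progress.Eligible, hS, hcnt] using he
      obtain ⟨j', hj'⟩ := hex
      obtain ⟨j₁, ht⟩ := Progress.exists_isTarget (hc ▸ hl) (hc ▸ hj')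
      have hact : Active D N i k ((progress D N h).S ⟨k, j₁⟩) h := ⟨⟨k, j₁⟩, ht, rfl, rfl, hc⟩
      rw [Finset.sum_add_distrib]
      refine add_le_add (ih hc hj') ?_
      rw [if_pos ⟨⟨hc, hl⟩, Finset.mem_univ _⟩]
      refine le_trans (le_of_eq ?_)
        (Finset.single_le_sum (f := fun S => if Active D N i k S h ∧ A ∈ Finset.univ then 1 else 0)
          (fun _ _ => Nat.zero_le _) (Finset.mem_univ ((progress D N h).S ⟨k, j₁⟩)))
      rw [if_pos ⟨hact, Finset.mem_univ _⟩]

theorem visits_le_cons (a : History K → Prop) (E : Finset (Finset (Fin K))) (A : Finset (Fin K))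
    (h : History K) : visits a E h ≤ visits a E (A :: h) := Nat.le_add_right _ _

/-- In every phase some session is active in all slots. -/
theorem exists_slots_le (i : ℕ) (h : History K) : slots D N i h = 0 ∨
    ∃ k ∈ D.mix i, slots D N i h ≤ ∑ S, visits (Active D N i k S) Finset.univ h := by
  classical
  induction h with
  | nil => exact Or.inl rfl
  | cons A h ih =>
    by_cases hc : (progress D N h).cur D = i ∧ i < D.len
    · right
      obtain ⟨⟨k, j⟩, he⟩ := Progress.exists_eligible (hc.1.symm ▸ hc.2 :
        (progress D N h).cur D < D.len)
      obtain ⟨j₁, ht⟩ := Progress.exists_isTarget (hc.1.symm ▸ hc.2) he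
      have h1 := slots_le_of_eligible hc.1 hc.2 (hc.1 ▸ he)
      have hact : Active D N i k ((progress D N h).S ⟨k, j₁⟩) h := ⟨⟨k, j₁⟩, ht, rfl, rfl, hc.1⟩
      refine ⟨k, hc.1 ▸ he.1, ?_⟩
      unfold slots at h1 ⊢
      simp only [visits]
      rw [Finset.sum_add_distrib]
      refine add_le_add h1 ?_
      rw [if_pos ⟨hc, Finset.mem_univ _⟩]
      refine le_trans (le_of_eq ?_)
        (Finset.single_le_sum (f := fun S => if Active D N i k S h ∧ A ∈ Finset.univ then 1 else 0)
          (fun _ _ => Nat.zero_le _) (Finset.mem_univ ((progress D N h).S ⟨k, j₁⟩)))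
      rw [if_pos ⟨hact, Finset.mem_univ _⟩]
    · have h1 : slots D N i (A :: h) = slots D N i h := by
        rw [slots, visits, if_neg fun hh => hc hh.1, add_zero, slots]
      rw [h1]
      refine ih.imp_right ?_
      rintro ⟨k, hk, hle⟩
      exact ⟨k, hk, hle.trans (Finset.sum_le_sum fun S _ => visits_le_cons _ _ _ _)⟩

theorem sum_slots {h : History K} (hc : (progress D N h).cur D < D.len) :
    ∑ i ∈ Finset.range D.len, slots D N i h = h.length := by
  classical
  induction h with
  | nil => simp [slots, visits]
  | cons A h ih =>
    have hc' := (cur_mono A h).trans_lt hc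
    unfold slots at ih ⊢
    simp only [visits, Finset.sum_add_distrib, ih hc', List.length_cons]
    congr 1
    rw [Finset.sum_eq_single ((progress D N h).cur D)]
    · simp [hc']
    · intro b _ hb
      rw [if_neg fun hh => hb hh.1.1.symm]
    · intro hh
      exact absurd (Finset.mem_range.2 hc') hh

/-- After a phase without quota that serves session `k` alone, session `k` is finished. -/
theorem mem_S_of_lt_cur {i : ℕ} {k : Fin K} (hm : D.mix i = {k}) (hq : ∀ S, D.quota i k S = ⊤)
    {h : History K} (hi : i < (progress D N h).cur D) (j : Fin (N k)) :
    k ∈ (progress D N h).S ⟨k, j⟩ := by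
  have key : ∀ g : History K, (progress D N g).phase ≤ i → i < (progress D N g).cur D →
      k ∈ (progress D N g).S ⟨k, j⟩ := by
    intro g hg1 hg2
    by_contra hne
    apply Progress.not_eligible hg1 hg2 ⟨k, j⟩
    unfold Progress.Eligible
    simp only [hm, hq]
    exact ⟨by simp, hne, by simp, ENat.natCast_lt_top _⟩
  induction h with
  | nil => exact key [] (Nat.zero_le _) hi
  | cons A h ih =>
    by_cases hc : i < (progress D N h).cur D
    · have := ih hc
      simp only [progress, Progress.step]
      rw [if_neg]
      · exact this
      · exact fun hX => (Progress.eligible_of_isTarget hX.1).2.2.1 this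
    · exact key (A :: h) (not_lt.1 hc) hi

/-- Number of packets of session `k` not received by destination `k` after the phases before `i`. -/
noncomputable def undelivered (D : Schedule K) (N : Fin K → ℕ) (i : ℕ) (k : Fin K)
    (h : History K) : ℕ :=
  ∑ S : Finset (Fin K) with k ∉ S, stockBefore D N i k S h

theorem undelivered_succ (i : ℕ) (k : Fin K) (h : History K) :
    undelivered D N (i + 1) k h + ∑ S, visits (Active D N i k S) {A | k ∈ A} h =
      undelivered D N i k h := by
  classical
  have h0 : ∀ S E, k ∈ S → visits (Active D N i k S) E h = 0 := fun S E hS =>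
    visits_eq_zero_of_forall (fun g hg => hg.eligible.2.2.1 hS) h
  have h1 : ∑ S : Finset (Fin K) with k ∉ S, visits (Active D N i k S) (escapes S) h =
      ∑ S, visits (Active D N i k S) (escapes S) h := by
    refine Finset.sum_filter_of_ne fun S _ hS hk => hS (h0 S _ hk)
  have h2 : ∑ S' : Finset (Fin K) with k ∉ S', inflow D N i k S' h =
      ∑ S, visits (Active D N i k S) {A | ¬ A ⊆ S ∧ k ∉ A} h := by
    unfold inflow
    rw [Finset.sum_comm]
    refine Finset.sum_congr rfl fun S _ => ?_
    rw [visits_eq_sum _ {A | ¬ A ⊆ S ∧ k ∉ A}]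
    refine Eq.trans ?_ (Finset.sum_fiberwise_of_maps_to (t := {S' : Finset (Fin K) | k ∉ S'})
      (g := fun A => (D.mix i).erase k ∪ A) ?_ _)
    · refine Finset.sum_congr rfl fun S' hS' => ?_
      rw [visits_eq_sum]
      refine Finset.sum_congr ?_ fun _ _ => rfl
      ext A
      simp only [moves, Finset.mem_filter, Finset.mem_univ, true_and] at hS' ⊢
      constructor
      · rintro ⟨ha, hb⟩
        exact ⟨⟨ha, fun hk => hS' (hb ▸ Finset.mem_union_right _ hk)⟩, hb⟩
      · rintro ⟨⟨ha, -⟩, hb⟩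
        exact ⟨ha, hb⟩
    · intro A hA
      simp only [Finset.mem_filter, Finset.mem_univ, true_and] at hA ⊢
      simp [hA.2]
  have h3 : ∀ S, visits (Active D N i k S) {A | ¬ A ⊆ S ∧ k ∉ A} h +
      visits (Active D N i k S) {A | k ∈ A} h = visits (Active D N i k S) (escapes S) h := by
    intro S
    by_cases hk : k ∈ S
    · simp [h0 S _ hk]
    · rw [visits_eq_sum _ (escapes S), visits_eq_sum _ {A | ¬ A ⊆ S ∧ k ∉ A},
        visits_eq_sum _ {A | k ∈ A}, ← Finset.sum_union]
      · refine Finset.sum_congr ?_ fun _ _ => rfl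
        ext A
        simp only [escapes, Finset.mem_union, Finset.mem_filter, Finset.mem_univ, true_and]
        constructor
        · rintro (⟨ha, -⟩ | ha)
          · exact ha
          · exact fun hA => hk (hA ha)
        · intro ha
          by_cases hkA : k ∈ A
          · exact Or.inr hkA
          · exact Or.inl ⟨ha, hkA⟩
      · rw [Finset.disjoint_filter]
        exact fun A _ ha => ha.2
  have h4 : undelivered D N (i + 1) k h +
      ∑ S : Finset (Fin K) with k ∉ S, visits (Active D N i k S) (escapes S) h =
      undelivered D N i k h + ∑ S' : Finset (Fin K) with k ∉ S', inflow D N i k S' h := by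
    unfold undelivered
    rw [← Finset.sum_add_distrib, ← Finset.sum_add_distrib]
    exact Finset.sum_congr rfl fun S _ => stockBefore_succ i k S h
  rw [h1, h2] at h4
  have h5 : ∑ S, visits (Active D N i k S) (escapes S) h =
      ∑ S, visits (Active D N i k S) {A | ¬ A ⊆ S ∧ k ∉ A} h +
        ∑ S, visits (Active D N i k S) {A | k ∈ A} h := by
    rw [← Finset.sum_add_distrib]
    exact Finset.sum_congr rfl fun S _ => (h3 S).symm
  omega

end Schedule

end BroadcastPEC

namespace BroadcastPEC

/-! ### Fluid limits of packet evolution -/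

/-- A queue that receives `inc` periodically, up to an error, and is nearly stable stays bounded. -/
theorem queue_le {Z inc : ℕ → ℝ} {L m : ℕ} (hL : 0 < L) {a err e₀ : ℝ} (ha : 0 ≤ a)
    (herr : 0 ≤ err) (he : 0 ≤ e₀) (hsum : ∑ j ∈ Finset.range L, inc j ≤ 0) (h0 : Z 0 ≤ e₀)
    (hstep : ∀ i < m, Z (i + 1) ≤ Z i + a * inc (i % L) + err ∨ Z (i + 1) ≤ 0) :
    Z m ≤ a * (2 * ∑ j ∈ Finset.range L, |inc j|) + m * err + e₀ := by
  set H := ∑ j ∈ Finset.range L, |inc j| with hH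
  have habs : ∀ i, |∑ j ∈ Finset.range (i % L), inc j| ≤ H := fun i =>
    (Finset.abs_sum_le_sum_abs _ _).trans (Finset.sum_le_sum_of_subset_of_nonneg
      (Finset.range_mono (Nat.mod_lt i hL).le) fun _ _ _ => abs_nonneg _)
  have hpos : ∀ i, 0 ≤ ∑ j ∈ Finset.range (i % L), inc j + H := fun i => by
    have := (abs_le.1 (habs i)).1
    linarith
  have key : ∀ i ≤ m, Z i ≤ a * (∑ j ∈ Finset.range (i % L), inc j + H) + i * err + e₀ := by
    intro i
    induction i with
    | zero =>
      intro _
      have := mul_nonneg ha (hpos 0)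
      push_cast
      linarith
    | succ i ih =>
      intro hi
      rcases hstep i hi with h | h
      · have h1 : ∑ j ∈ Finset.range (i % L), inc j + inc (i % L) ≤
            ∑ j ∈ Finset.range ((i + 1) % L), inc j := by
          rw [← Finset.sum_range_succ]
          have := Nat.mod_lt i hL
          rcases (Nat.succ_le_of_lt this).lt_or_eq with h2 | h2
          · have h3 : (i + 1) % L = i % L + 1 := by
              rw [Nat.add_mod, Nat.mod_eq_of_lt (show 1 < L by omega)]
              exact Nat.mod_eq_of_lt h2
            rw [h3]
          · have h3 : (i + 1) % L = 0 := by
              rw [← Nat.mod_add_mod, ← Nat.succ_eq_add_one, h2, Nat.mod_self]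
            rw [h3, ← Nat.succ_eq_add_one, h2]
            simpa using hsum
        have h2 := ih (Nat.le_of_succ_le hi)
        have h3 := mul_le_mul_of_nonneg_left h1 ha
        push_cast
        nlinarith
      · have := mul_nonneg ha (hpos (i + 1))
        have h4 : (0 : ℝ) ≤ (i + 1 : ℕ) * err := by positivity
        linarith
  refine (key m le_rfl).trans ?_
  have h1 : ∑ j ∈ Finset.range (m % L), inc j + H ≤ 2 * H := by
    have := (abs_le.1 (habs m)).2
    linarith
  have := mul_le_mul_of_nonneg_left h1 ha
  linarith

/-- Fractions of time `y k T S` in which session `k` mixes packets with overhearing set `S` into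
combinations for `T ∪ {k}`, fractions of time `x` for the mixing sets, such that all packets that
arrive somewhere are sent on. -/
structure FlowPlan {K : ℕ} (p : Finset (Fin K) → ℝ) (R : Fin K → ℝ) where
  x : Finset (Fin K) → ℝ
  y : Fin K → Finset (Fin K) → Finset (Fin K) → ℝ
  x_nonneg : ∀ M, 0 ≤ x M
  sum_x_lt : ∑ M, x M < 1
  y_nonneg : ∀ k T S, 0 ≤ y k T S
  y_eq_zero : ∀ k T S, ¬ (T ⊆ S ∧ k ∉ S) → y k T S = 0
  sum_y_le : ∀ M, ∀ k ∈ M, ∑ S, y k (M.erase k) S ≤ x M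
  flow : ∀ k S', k ∉ S' → (if S' = ∅ then R k else 0) +
    ∑ T, ∑ S, y k T S * ∑ A ∈ moves T S S', p A ≤ (∑ T, y k T S') * pUnion p S'ᶜ
  rate_nonneg : ∀ k, 0 ≤ R k
  rate_eq_zero : ∀ k, pMarg p k = 0 → R k = 0

section Channel

variable {K : ℕ} {p : Finset (Fin K) → ℝ}

theorem sum_escapes (S : Finset (Fin K)) : ∑ A ∈ escapes S, p A = pUnion p Sᶜ := by
  unfold escapes pUnion
  refine Finset.sum_congr (Finset.filter_congr fun A _ => ?_) fun _ _ => rfl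
  rw [Finset.not_subset]
  simp [Finset.Nonempty]

theorem sum_mem_eq_pMarg (k : Fin K) :
    ∑ A ∈ ({A | k ∈ A} : Finset (Finset (Fin K))), p A = pMarg p k := by
  unfold pMarg pUnion
  refine Finset.sum_congr (Finset.filter_congr fun A _ => ?_) fun _ _ => rfl
  simp [Finset.Nonempty]

theorem IsPEC.sum_nonneg (hp : IsPEC p) (E : Finset (Finset (Fin K))) : 0 ≤ ∑ A ∈ E, p A :=
  Finset.sum_nonneg fun A _ => hp.1 A

theorem IsPEC.sum_le_one (hp : IsPEC p) (E : Finset (Finset (Fin K))) : ∑ A ∈ E, p A ≤ 1 := by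
  rw [← hp.2]
  exact Finset.sum_le_sum_of_subset_of_nonneg (Finset.subset_univ _) fun A _ _ => hp.1 A

theorem IsPEC.pUnion_mono (hp : IsPEC p) {S S' : Finset (Fin K)} (h : S ⊆ S') :
    pUnion p S ≤ pUnion p S' := by
  refine Finset.sum_le_sum_of_subset_of_nonneg (fun A hA => ?_) fun A _ _ => hp.1 A
  simp only [Finset.mem_filter, Finset.mem_univ, true_and] at hA ⊢
  exact hA.mono (Finset.inter_subset_inter_left h)

theorem IsPEC.pMarg_le (hp : IsPEC p) {k : Fin K} {S : Finset (Fin K)} (h : k ∈ S) :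
    pMarg p k ≤ pUnion p S :=
  hp.pUnion_mono (Finset.singleton_subset_iff.2 h)

theorem IsPEC.pUnion_nonneg (hp : IsPEC p) (S : Finset (Fin K)) : 0 ≤ pUnion p S :=
  hp.sum_nonneg _

theorem IsPEC.pMarg_nonneg (hp : IsPEC p) (k : Fin K) : 0 ≤ pMarg p k := hp.pUnion_nonneg _

end Channel

/-- Number of subsets of `Fin K`. -/
abbrev numSets (K : ℕ) : ℕ := Fintype.card (Finset (Fin K))

/-- An enumeration of the subsets of `Fin K`. -/
noncomputable def setEnum (K i : ℕ) : Finset (Fin K) :=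
  if h : i < numSets K then (Fintype.equivFin _).symm ⟨i, h⟩ else ∅

theorem sum_setEnum (K : ℕ) (g : Finset (Fin K) → ℝ) :
    ∑ i ∈ Finset.range (numSets K), g (setEnum K i) = ∑ S, g S := by
  rw [← Fin.sum_univ_eq_sum_range (fun i => g (setEnum K i)),
    ← (Fintype.equivFin (Finset (Fin K))).symm.sum_comp]
  refine Finset.sum_congr rfl fun i _ => ?_
  rw [setEnum, dif_pos i.2]

theorem sum_erase_eq {K : ℕ} (k : Fin K) (g : Finset (Fin K) → ℝ) (hg : ∀ T, k ∈ T → g T = 0) :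
    (∑ M : Finset (Fin K), if k ∈ M then g (M.erase k) else 0) = ∑ T, g T := by
  have h1 : ∑ T, g T = ∑ T : Finset (Fin K) with k ∉ T, g T :=
    by
    refine (Finset.sum_filter_of_ne fun T _ hT => ?_).symm
    exact fun hk => hT (hg T hk)
  rw [h1, ← Finset.sum_filter]
  refine Finset.sum_nbij' (fun M => M.erase k) (fun T => insert k T) ?_ ?_ ?_ ?_ ?_
  · simp
  · simp
  · intro M hM
    exact Finset.insert_erase (Finset.mem_filter.1 hM).2
  · intro T hT
    exact Finset.erase_insert (Finset.mem_filter.1 hT).2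
  · intro _ _
    rfl

namespace FlowPlan

variable {K : ℕ} {p : Finset (Fin K) → ℝ} {R : Fin K → ℝ} (F : FlowPlan p R)

/-- Number of packets for `n` slots. -/
noncomputable def packets (_F : FlowPlan p R) (n : ℕ) (k : Fin K) : ℕ :=
  if R k = 0 then 0 else ⌊n * R k⌋₊ + 1

/-- The plan is carried out in `B` rounds; finally each session sends its remaining packets. -/
noncomputable def schedule (n B : ℕ) : Schedule K where
  len := B * (numSets K) + K
  mix i := if i < B * (numSets K) then setEnum K (i % (numSets K)) else
    if h : i - B * (numSets K) < K then {⟨i - B * (numSets K), h⟩} else ∅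
  quota i k S := if i < B * (numSets K) then
    ((⌊n * (F.y k ((setEnum K (i % (numSets K))).erase k) S * pUnion p Sᶜ) / B⌋₊ : ℕ) : ℕ∞) else ⊤

/-- Net inflow of the fluid model. -/
noncomputable def inc (k : Fin K) (S : Finset (Fin K)) (j : ℕ) : ℝ :=
  (if k ∈ setEnum K j then ∑ S₁, F.y k ((setEnum K j).erase k) S₁ *
    ∑ A ∈ moves ((setEnum K j).erase k) S₁ S, p A else 0) +
  (if S = ∅ then R k else 0) / (numSets K) -
  (if k ∈ setEnum K j then F.y k ((setEnum K j).erase k) S * pUnion p Sᶜ else 0)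

theorem y_eq_zero_of_mem {k : Fin K} {T : Finset (Fin K)} (h : k ∈ T) (S : Finset (Fin K)) :
    F.y k T S = 0 :=
  F.y_eq_zero k T S fun hh => hh.2 (hh.1 h)

theorem numSets_pos : 0 < numSets K := Fintype.card_pos

theorem sum_inc_le {k : Fin K} {S : Finset (Fin K)} (hk : k ∉ S) :
    ∑ j ∈ Finset.range (numSets K), F.inc k S j ≤ 0 := by
  have hL : (0 : ℝ) < (numSets K) := by exact_mod_cast numSets_pos
  unfold inc
  rw [Finset.sum_sub_distrib, Finset.sum_add_distrib]
  rw [sum_setEnum K (fun M => if k ∈ M then ∑ S₁, F.y k (M.erase k) S₁ *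
    ∑ A ∈ moves (M.erase k) S₁ S, p A else 0),
    sum_setEnum K (fun M => if k ∈ M then F.y k (M.erase k) S * pUnion p Sᶜ else 0),
    sum_erase_eq k (fun T => ∑ S₁, F.y k T S₁ * ∑ A ∈ moves T S₁ S, p A),
    sum_erase_eq k (fun T => F.y k T S * pUnion p Sᶜ), Finset.sum_const, Finset.card_range,
    nsmul_eq_mul, mul_div_cancel₀ _ hL.ne', ← Finset.sum_mul]
  · have := F.flow k S hk
    linarith
  · intro T hT
    simp [F.y_eq_zero_of_mem hT]
  · intro T hT
    simp [F.y_eq_zero_of_mem hT]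

variable {F} {n B : ℕ} {δ c : ℝ} {h : History K}

theorem visits_le_mul {E : Finset (Finset (Fin K))} {a : History K → Prop}
    (ht : |deviation p a E h| ≤ δ * n) :
    (visits a E h : ℝ) ≤ (∑ A ∈ E, p A) * visits a Finset.univ h + δ * n := by
  have := (abs_le.1 ht).2
  unfold deviation at this
  linarith

theorem mul_le_visits {E : Finset (Finset (Fin K))} {a : History K → Prop}
    (ht : |deviation p a E h| ≤ δ * n) :
    (∑ A ∈ E, p A) * visits a Finset.univ h ≤ visits a E h + δ * n := by
  have := (abs_le.1 ht).1
  unfold deviation at this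
  linarith

theorem packets_eq_zero {k : Fin K} (hk : pMarg p k = 0) : F.packets n k = 0 :=
  if_pos (F.rate_eq_zero k hk)

theorem packets_le (k : Fin K) : (F.packets n k : ℝ) ≤ n * R k + 1 := by
  unfold packets
  split_ifs with hR
  · simp [hR]
  · push_cast
    have := Nat.floor_le (mul_nonneg (Nat.cast_nonneg n) (F.rate_nonneg k))
    linarith

theorem not_active_of_pMarg_eq_zero {k : Fin K} (hk : pMarg p k = 0) (i : ℕ) (S : Finset (Fin K))
    (g : History K) : ¬ Active (F.schedule n B) (F.packets n) i k S g := by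
  rintro ⟨⟨k', j⟩, -, rfl, -⟩
  have h1 : F.packets n k' = 0 := packets_eq_zero hk
  have h2 := j.2
  omega

theorem mix_of_lt {i : ℕ} (hi : i < B * (numSets K)) : (F.schedule n B).mix i = setEnum K (i % (numSets K)) := if_pos hi

theorem quota_of_lt {i : ℕ} (hi : i < B * (numSets K)) (k : Fin K) (S : Finset (Fin K)) :
    (F.schedule n B).quota i k S =
      ((⌊n * (F.y k ((setEnum K (i % (numSets K))).erase k) S * pUnion p Sᶜ) / B⌋₊ : ℕ) : ℕ∞) := if_pos hi

theorem mix_flush (k : Fin K) : (F.schedule n B).mix (B * (numSets K) + k) = {k} := by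
  have h1 : ¬ (B * (numSets K) + (k : ℕ) < B * (numSets K)) := by omega
  have h2 : B * (numSets K) + (k : ℕ) - B * (numSets K) = k := by omega
  simp only [schedule]
  rw [if_neg h1, dif_pos (h2.trans_lt k.2)]
  simp only [h2, Fin.eta]

theorem quota_flush (k : Fin K) (S : Finset (Fin K)) :
    (F.schedule n B).quota (B * (numSets K) + k) k S = ⊤ := if_neg (by omega)

/-- The feedback is typical: the counts of all kinds are close to their predictions. -/
def Typical (F : FlowPlan p R) (n B : ℕ) (δ : ℝ) (h : History K) : Prop :=
  ∀ i < (F.schedule n B).len, ∀ k S E, |deviation p (Active (F.schedule n B) (F.packets n) i k S) E h| ≤ δ * n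

theorem visits_univ_le (hp : IsPEC p) (hc : ∀ k, 1 / pMarg p k ≤ c) (hδ : 0 ≤ δ)
    (ht : F.Typical n B δ h) {i : ℕ} (hi : i < B * (numSets K)) (k : Fin K) (S : Finset (Fin K)) :
    (visits (Active (F.schedule n B) (F.packets n) i k S) Finset.univ h : ℝ) ≤
      n / B * (F.y k ((setEnum K (i % (numSets K))).erase k) S) + c * δ * n := by
  have hc0 : 0 ≤ c := (one_div_nonneg.2 (hp.pMarg_nonneg k)).trans (hc k)
  have hy := F.y_nonneg k ((setEnum K (i % (numSets K))).erase k) S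
  have hR : 0 ≤ n / B * (F.y k ((setEnum K (i % (numSets K))).erase k) S) + c * δ * n := by positivity
  by_cases hk : k ∈ S
  · rw [visits_eq_zero_of_forall fun g hg => hg.eligible.2.2.1 hk]
    exact_mod_cast hR
  by_cases hpk : pMarg p k = 0
  · rw [visits_eq_zero_of_forall fun g hg => not_active_of_pMarg_eq_zero hpk _ _ g hg]
    exact_mod_cast hR
  have hpk : 0 < pMarg p k := (hp.pMarg_nonneg k).lt_of_ne' hpk
  have hP : pMarg p k ≤ pUnion p Sᶜ := hp.pMarg_le (Finset.mem_compl.2 hk)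
  have hP0 : 0 < pUnion p Sᶜ := hpk.trans_le hP
  have h1 := mul_le_visits (ht i (hi.trans_le (Nat.le_add_right _ _)) k S (escapes S))
  rw [sum_escapes] at h1
  have h2 := outflow_le_quota (D := F.schedule n B) (N := F.packets n) i k S h
  rw [quota_of_lt hi] at h2
  have h3 : (visits (Active (F.schedule n B) (F.packets n) i k S) (escapes S) h : ℝ) ≤
      n * (F.y k ((setEnum K (i % (numSets K))).erase k) S * pUnion p Sᶜ) / B :=
    (Nat.cast_le.2 (Nat.cast_le.1 h2)).trans (Nat.floor_le (by positivity))
  have h4 : (1 : ℝ) ≤ c * pUnion p Sᶜ := by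
    have := (div_le_iff₀ hpk).1 (hc k)
    exact this.trans (mul_le_mul_of_nonneg_left hP hc0)
  have h5 : δ * n ≤ pUnion p Sᶜ * (c * δ * n) := by
    have : 0 ≤ δ * n := by positivity
    nlinarith
  refine le_of_mul_le_mul_left ?_ hP0
  calc _ ≤ _ := h1
    _ ≤ n * (F.y k ((setEnum K (i % (numSets K))).erase k) S * pUnion p Sᶜ) / B +
        pUnion p Sᶜ * (c * δ * n) := add_le_add h3 h5
    _ = _ := by ring

theorem inflow_le (hp : IsPEC p) (hc : ∀ k, 1 / pMarg p k ≤ c) (hδ : 0 ≤ δ)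
    (ht : F.Typical n B δ h) {i : ℕ} (hi : i < B * (numSets K)) (k : Fin K) (S : Finset (Fin K)) :
    (inflow (F.schedule n B) (F.packets n) i k S h : ℝ) ≤
      n / B * (if k ∈ setEnum K (i % (numSets K)) then
        ∑ S₁, F.y k ((setEnum K (i % (numSets K))).erase k) S₁ *
          ∑ A ∈ moves ((setEnum K (i % (numSets K))).erase k) S₁ S, p A else 0) + (numSets K) * ((c + 1) * δ * n) := by
  have hc0 : 0 ≤ c := (one_div_nonneg.2 (hp.pMarg_nonneg k)).trans (hc k)
  by_cases hk : k ∈ setEnum K (i % (numSets K))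
  · rw [if_pos hk]
    unfold inflow
    push_cast
    rw [mix_of_lt hi]
    have h1 : ∀ S₁, (visits (Active (F.schedule n B) (F.packets n) i k S₁)
        (moves ((setEnum K (i % (numSets K))).erase k) S₁ S) h : ℝ) ≤
        n / B * (F.y k ((setEnum K (i % (numSets K))).erase k) S₁ *
          ∑ A ∈ moves ((setEnum K (i % (numSets K))).erase k) S₁ S, p A) + (c + 1) * δ * n := by
      intro S₁
      have h2 := visits_le_mul (ht i (hi.trans_le (Nat.le_add_right _ _)) k S₁
        (moves ((setEnum K (i % (numSets K))).erase k) S₁ S))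
      have h3 := visits_univ_le hp hc hδ ht hi k S₁
      have h4 := hp.sum_nonneg (moves ((setEnum K (i % (numSets K))).erase k) S₁ S)
      have h5 := hp.sum_le_one (moves ((setEnum K (i % (numSets K))).erase k) S₁ S)
      set q := ∑ A ∈ moves ((setEnum K (i % (numSets K))).erase k) S₁ S, p A
      have h6 := mul_le_mul_of_nonneg_left h3 h4
      have h7 : q * (c * δ * n) ≤ c * δ * n := mul_le_of_le_one_left (by positivity) h5
      linarith
    refine (Finset.sum_le_sum fun S₁ _ => h1 S₁).trans (le_of_eq ?_)
    rw [Finset.sum_add_distrib, ← Finset.mul_sum, Finset.sum_const, Finset.card_univ, nsmul_eq_mul]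
  · rw [if_neg hk]
    have : inflow (F.schedule n B) (F.packets n) i k S h = 0 := by
      unfold inflow
      refine Finset.sum_eq_zero fun S₁ _ => visits_eq_zero_of_forall (fun g hg => hk ?_) h
      have := hg.eligible.2.1
      rwa [mix_of_lt hi] at this
    rw [this]
    push_cast
    positivity

/-- Bound for the fluctuations of the fluid model. -/
noncomputable def swing (F : FlowPlan p R) : ℝ :=
  ∑ k, ∑ S, ∑ j ∈ Finset.range (numSets K), |F.inc k S j|

theorem stockBefore_le (hp : IsPEC p) (hc : ∀ k, 1 / pMarg p k ≤ c) (hδ : 0 ≤ δ) (hB : 0 < B)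
    (ht : F.Typical n B δ h) (hcur : B * (numSets K) ≤ (progress (F.schedule n B) (F.packets n) h).cur (F.schedule n B)) {k : Fin K}
    {S : Finset (Fin K)} (hk : k ∉ S) :
    (stockBefore (F.schedule n B) (F.packets n) (B * (numSets K)) k S h : ℝ) ≤
      n / B * (2 * F.swing) + (B * (numSets K) : ℕ) * ((numSets K) * ((c + 1) * δ * n) + 1) + 1 := by
  have hc0 : 0 ≤ c := (one_div_nonneg.2 (hp.pMarg_nonneg k)).trans (hc k)
  have hBr : (0 : ℝ) < B := by exact_mod_cast hB
  have hLr : (0 : ℝ) < (numSets K) := by exact_mod_cast numSets_pos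
  set r : ℝ := if S = ∅ then R k else 0 with hr
  have hr0 : 0 ≤ r := by
    rw [hr]
    split_ifs
    · exact F.rate_nonneg k
    · exact le_rfl
  set Z : ℕ → ℝ := fun i => stockBefore (F.schedule n B) (F.packets n) i k S h - n * r * (1 - i / (B * (numSets K))) with hZ
  have hstep : ∀ i < B * (numSets K), Z (i + 1) ≤ Z i + n / B * F.inc k S (i % (numSets K)) +
      ((numSets K) * ((c + 1) * δ * n) + 1) ∨ Z (i + 1) ≤ 0 := by
    intro i hi
    have hin := inflow_le hp hc hδ ht hi k S
    have hrec := stockBefore_succ (D := F.schedule n B) (N := F.packets n) i k S h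
    have hrec' : (stockBefore (F.schedule n B) (F.packets n) (i + 1) k S h : ℝ) +
        visits (Active (F.schedule n B) (F.packets n) i k S) (escapes S) h =
        stockBefore (F.schedule n B) (F.packets n) i k S h + inflow (F.schedule n B) (F.packets n) i k S h := by exact_mod_cast hrec
    have hZs : Z (i + 1) - Z i = stockBefore (F.schedule n B) (F.packets n) (i + 1) k S h - stockBefore (F.schedule n B) (F.packets n) i k S h +
        n / B * (r / (numSets K)) := by
      simp only [hZ]
      push_cast
      field_simp
      ring
    have hout : (stockBefore (F.schedule n B) (F.packets n) (i + 1) k S h = 0) ∨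
        n / B * (if k ∈ setEnum K (i % (numSets K)) then
          F.y k ((setEnum K (i % (numSets K))).erase k) S * pUnion p Sᶜ else 0) ≤
        visits (Active (F.schedule n B) (F.packets n) i k S) (escapes S) h + 1 := by
      split_ifs with hm
      · by_cases hsub : setEnum K (i % (numSets K)) ⊆ insert k S
        · rcases quota_or_stockBefore_eq_zero (D := F.schedule n B) (N := F.packets n) (h := h) (hi.trans_le hcur)
            (by rwa [mix_of_lt hi]) hk (by rwa [mix_of_lt hi]) with hq | hq
          · right
            rw [quota_of_lt hi] at hq
            have h1 := Nat.lt_floor_add_one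
              (n * (F.y k ((setEnum K (i % (numSets K))).erase k) S * pUnion p Sᶜ) / B)
            have h2 : ((⌊n * (F.y k ((setEnum K (i % (numSets K))).erase k) S * pUnion p Sᶜ) / B⌋₊ : ℕ) : ℝ)
                ≤ visits (Active (F.schedule n B) (F.packets n) i k S) (escapes S) h := Nat.cast_le.2 (Nat.cast_le.1 hq)
            have h3 : n / B * (F.y k ((setEnum K (i % (numSets K))).erase k) S * pUnion p Sᶜ) =
              n * (F.y k ((setEnum K (i % (numSets K))).erase k) S * pUnion p Sᶜ) / B := by ring
            linarith
          · exact Or.inl hq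
        · right
          rw [F.y_eq_zero]
          · simp only [zero_mul, mul_zero]
            positivity
          · rintro ⟨h1, -⟩
            exact hsub (Finset.subset_insert_iff.2 h1)
      · right
        simp only [mul_zero]
        positivity
    rcases hout with h0 | hout
    · right
      simp only [hZ, h0]
      have h1 : ((i + 1 : ℕ) : ℝ) / (B * (numSets K)) ≤ 1 := by
        rw [div_le_one (by positivity)]
        exact_mod_cast hi
      have : 0 ≤ n * r * (1 - ((i + 1 : ℕ) : ℝ) / (B * (numSets K))) :=
        mul_nonneg (by positivity) (by linarith)
      push_cast at this ⊢
      linarith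
    · left
      have hinc : F.inc k S (i % (numSets K)) = (if k ∈ setEnum K (i % (numSets K)) then
          ∑ S₁, F.y k ((setEnum K (i % (numSets K))).erase k) S₁ *
            ∑ A ∈ moves ((setEnum K (i % (numSets K))).erase k) S₁ S, p A else 0) + r / (numSets K) -
          (if k ∈ setEnum K (i % (numSets K)) then
            F.y k ((setEnum K (i % (numSets K))).erase k) S * pUnion p Sᶜ else 0) := rfl
      rw [hinc, mul_sub, mul_add]
      linarith
  have h0 : Z 0 ≤ 1 := by
    simp only [hZ, stockBefore_zero]
    have := packets_le (F := F) (n := n) k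
    rw [hr]
    split_ifs
    · push_cast
      simp only [zero_div, sub_zero, mul_one]
      linarith
    · simp
  have hq := queue_le numSets_pos (by positivity : (0 : ℝ) ≤ n / B) (by positivity) zero_le_one
    (F.sum_inc_le hk) h0 hstep
  have hZm : Z (B * (numSets K)) = stockBefore (F.schedule n B) (F.packets n) (B * (numSets K)) k S h := by
    simp only [hZ]
    push_cast
    rw [div_self (by positivity)]
    ring
  have hsw : ∑ j ∈ Finset.range (numSets K), |F.inc k S j| ≤ F.swing := by
    have h1 := Finset.single_le_sum (f := fun S => ∑ j ∈ Finset.range (numSets K), |F.inc k S j|)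
      (fun _ _ => Finset.sum_nonneg fun _ _ => abs_nonneg _) (Finset.mem_univ S)
    have h2 := Finset.single_le_sum (f := fun k => ∑ S, ∑ j ∈ Finset.range (numSets K), |F.inc k S j|)
      (fun _ _ => Finset.sum_nonneg fun _ _ => Finset.sum_nonneg fun _ _ => abs_nonneg _)
      (Finset.mem_univ k)
    exact h1.trans h2
  rw [hZm] at hq
  refine hq.trans ?_
  gcongr

theorem undelivered_antitone {N' : Fin K → ℕ} {D' : Schedule K} {i j : ℕ} (hij : i ≤ j)
    (k : Fin K) : undelivered D' N' j k h ≤ undelivered D' N' i k h := by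
  induction j, hij using Nat.le_induction with
  | base => exact le_rfl
  | succ j _ ih =>
    have := undelivered_succ (D := D') (N := N') j k h
    omega

theorem flush_le (hp : IsPEC p) (hc : ∀ k, 1 / pMarg p k ≤ c) (hδ : 0 ≤ δ) (hB : 0 < B)
    (ht : F.Typical n B δ h) (k : Fin K) :
    (slots (F.schedule n B) (F.packets n) (B * (numSets K) + k) h : ℝ) ≤ c * ((numSets K) * (n / B * (2 * F.swing) +
      (B * (numSets K) : ℕ) * ((numSets K) * ((c + 1) * δ * n) + 1) + 1) + (numSets K) * (δ * n)) := by
  have hc0 : 0 ≤ c := (one_div_nonneg.2 (hp.pMarg_nonneg k)).trans (hc k)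
  have hsw : 0 ≤ F.swing := Finset.sum_nonneg fun _ _ => Finset.sum_nonneg fun _ _ =>
    Finset.sum_nonneg fun _ _ => abs_nonneg _
  set V := n / B * (2 * F.swing) + (B * (numSets K) : ℕ) * ((numSets K) * ((c + 1) * δ * n) + 1) + 1 with hV
  have hV0 : 0 ≤ V := by positivity
  have hRHS : 0 ≤ c * ((numSets K) * V + (numSets K) * (δ * n)) := by positivity
  rcases exists_slots_le (D := F.schedule n B) (N := F.packets n) (B * (numSets K) + k) h with h0 | ⟨k', hk', hs⟩
  · rw [h0]
    exact_mod_cast hRHS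
  rw [mix_flush, Finset.mem_singleton] at hk'
  subst hk'
  by_cases hpk : pMarg p k' = 0
  · have : slots (F.schedule n B) (F.packets n) (B * (numSets K) + k') h = 0 := by
      refine Nat.le_zero.1 (hs.trans (le_of_eq (Finset.sum_eq_zero fun S _ => ?_)))
      exact visits_eq_zero_of_forall (fun g hg => not_active_of_pMarg_eq_zero hpk _ _ g hg) h
    rw [this]
    exact_mod_cast hRHS
  have hpk : 0 < pMarg p k' := (hp.pMarg_nonneg k').lt_of_ne' hpk
  by_cases hcur : B * (numSets K) ≤ (progress (F.schedule n B) (F.packets n) h).cur (F.schedule n B)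
  swap
  · have : slots (F.schedule n B) (F.packets n) (B * (numSets K) + k') h = 0 := by
      unfold slots
      exact visits_eq_zero (D := F.schedule n B) (N := F.packets n) (i := B * (numSets K) + k') (fun g hg => hg.1) (by omega)
    rw [this]
    exact_mod_cast hRHS
  have h1 : (undelivered (F.schedule n B) (F.packets n) (B * (numSets K)) k' h : ℝ) ≤ (numSets K) * V := by
    unfold undelivered
    push_cast
    have : ∀ S ∈ ({S | k' ∉ S} : Finset (Finset (Fin K))),
        (stockBefore (F.schedule n B) (F.packets n) (B * (numSets K)) k' S h : ℝ) ≤ V := fun S hS =>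
      stockBefore_le hp hc hδ hB ht hcur (Finset.mem_filter.1 hS).2
    refine (Finset.sum_le_card_nsmul _ _ _ this).trans ?_
    rw [nsmul_eq_mul]
    gcongr
    exact Finset.card_le_univ _
  have h2 := undelivered_antitone (D' := (F.schedule n B)) (N' := (F.packets n)) (h := h)
    (Nat.le_add_right (B * (numSets K)) (k' : ℕ)) k'
  have h3 := undelivered_succ (D := F.schedule n B) (N := F.packets n) (B * (numSets K) + k') k' h
  have h4 : (∑ S, visits (Active (F.schedule n B) (F.packets n) (B * (numSets K) + k') k' S) {A | k' ∈ A} h : ℝ) ≤ (numSets K) * V := by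
    refine le_trans ?_ h1
    exact_mod_cast (by omega : ∑ S, visits (Active (F.schedule n B) (F.packets n) (B * (numSets K) + k') k' S) {A | k' ∈ A} h ≤
      undelivered (F.schedule n B) (F.packets n) (B * (numSets K)) k' h)
  have hlen : B * (numSets K) + (k' : ℕ) < (F.schedule n B).len := Nat.add_lt_add_left k'.2 _
  have h5 : ∀ S, pMarg p k' * visits (Active (F.schedule n B) (F.packets n) (B * (numSets K) + k') k' S) Finset.univ h ≤
      visits (Active (F.schedule n B) (F.packets n) (B * (numSets K) + k') k' S) {A | k' ∈ A} h + δ * n := by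
    intro S
    have := mul_le_visits (ht (B * (numSets K) + k') hlen k' S {A | k' ∈ A})
    rwa [sum_mem_eq_pMarg] at this
  have h6 : pMarg p k' * (slots (F.schedule n B) (F.packets n) (B * (numSets K) + k') h : ℝ) ≤ (numSets K) * V + (numSets K) * (δ * n) := by
    have h7 : (slots (F.schedule n B) (F.packets n) (B * (numSets K) + k') h : ℝ) ≤
        ∑ S, (visits (Active (F.schedule n B) (F.packets n) (B * (numSets K) + k') k' S) Finset.univ h : ℝ) := by exact_mod_cast hs
    refine (mul_le_mul_of_nonneg_left h7 hpk.le).trans ?_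
    rw [Finset.mul_sum]
    refine (Finset.sum_le_sum fun S _ => h5 S).trans ?_
    rw [Finset.sum_add_distrib, Finset.sum_const, Finset.card_univ, nsmul_eq_mul]
    linarith
  have h8 : (1 : ℝ) ≤ c * pMarg p k' := (div_le_iff₀ hpk).1 (hc k')
  calc (slots (F.schedule n B) (F.packets n) (B * (numSets K) + k') h : ℝ) = 1 * (slots (F.schedule n B) (F.packets n) (B * (numSets K) + k') h : ℝ) := (one_mul _).symm
    _ ≤ c * pMarg p k' * (slots (F.schedule n B) (F.packets n) (B * (numSets K) + k') h : ℝ) := by gcongr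
    _ = c * (pMarg p k' * (slots (F.schedule n B) (F.packets n) (B * (numSets K) + k') h : ℝ)) := by ring
    _ ≤ _ := by gcongr

theorem round_le (hp : IsPEC p) (hc : ∀ k, 1 / pMarg p k ≤ c) (hc0 : 0 ≤ c) (hδ : 0 ≤ δ)
    (ht : F.Typical n B δ h) {i : ℕ} (hi : i < B * (numSets K)) :
    (slots (F.schedule n B) (F.packets n) i h : ℝ) ≤ n / B * F.x (setEnum K (i % (numSets K))) + (numSets K) * (c * δ * n) := by
  have hx := F.x_nonneg (setEnum K (i % (numSets K)))
  rcases exists_slots_le (D := F.schedule n B) (N := F.packets n) i h with h0 | ⟨k, hk, hs⟩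
  · rw [h0]
    have : 0 ≤ n / B * F.x (setEnum K (i % (numSets K))) + (numSets K) * (c * δ * n) := by positivity
    exact_mod_cast this
  rw [mix_of_lt hi] at hk
  have h1 : (slots (F.schedule n B) (F.packets n) i h : ℝ) ≤ ∑ S, (visits (Active (F.schedule n B) (F.packets n) i k S) Finset.univ h : ℝ) := by
    exact_mod_cast hs
  refine h1.trans ((Finset.sum_le_sum fun S _ => visits_univ_le hp hc hδ ht hi k S).trans ?_)
  rw [Finset.sum_add_distrib, ← Finset.mul_sum, Finset.sum_const, Finset.card_univ, nsmul_eq_mul]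
  have := F.sum_y_le _ k hk
  gcongr

theorem sum_range_mul_mod {m : ℕ} (B : ℕ) (g : ℕ → ℝ) :
    ∑ i ∈ Finset.range (B * m), g (i % m) = B * ∑ j ∈ Finset.range m, g j := by
  induction B with
  | zero => simp
  | succ B ih =>
    rw [Nat.succ_mul, Finset.sum_range_add, ih]
    have : ∀ j ∈ Finset.range m, g ((B * m + j) % m) = g j := fun j hj => by
      rw [Nat.add_comm, Nat.add_mul_mod_self_right, Nat.mod_eq_of_lt (Finset.mem_range.1 hj)]
    rw [Finset.sum_congr rfl this]
    push_cast
    ring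

/-- With typical feedback, the plan is completed unless the number of slots is too small. -/
theorem length_le (hp : IsPEC p) (hc : ∀ k, 1 / pMarg p k ≤ c) (hc0 : 0 ≤ c) (hδ : 0 ≤ δ)
    (hB : 0 < B) (ht : F.Typical n B δ h)
    (hcur : (progress (F.schedule n B) (F.packets n) h).cur (F.schedule n B) < (F.schedule n B).len) :
    (h.length : ℝ) ≤ n * ∑ M, F.x M + (B * (numSets K) : ℕ) * ((numSets K) * (c * δ * n)) +
      K * (c * ((numSets K) * (n / B * (2 * F.swing) +
      (B * (numSets K) : ℕ) * ((numSets K) * ((c + 1) * δ * n) + 1) + 1) + (numSets K) * (δ * n))) := by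
  have hBr : (0 : ℝ) < B := by exact_mod_cast hB
  rw [← sum_slots hcur]
  have hlen : (F.schedule n B).len = B * (numSets K) + K := rfl
  rw [hlen, Finset.sum_range_add]
  push_cast
  refine add_le_add ?_ ?_
  · refine (Finset.sum_le_sum fun i hi =>
      round_le hp hc hc0 hδ ht (Finset.mem_range.1 hi)).trans (le_of_eq ?_)
    rw [Finset.sum_add_distrib, ← Finset.mul_sum,
      sum_range_mul_mod B (fun j => F.x (setEnum K j)), sum_setEnum, Finset.sum_const,
      Finset.card_range, nsmul_eq_mul]
    push_cast
    field_simp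
  · rw [← Fin.sum_univ_eq_sum_range (fun i => (slots (F.schedule n B) (F.packets n) (B * (numSets K) + i) h : ℝ))]
    refine (Finset.sum_le_sum fun k _ => flush_le hp hc hδ hB ht k).trans (le_of_eq ?_)
    rw [Finset.sum_const, Finset.card_univ, Fintype.card_fin, nsmul_eq_mul]
    push_cast
    rfl

end FlowPlan

end BroadcastPEC

namespace BroadcastPEC

section Attains

variable {K : ℕ} {p : Finset (Fin K) → ℝ} {R : Fin K → ℝ}

theorem FlowPlan.exists_length_bound (F : FlowPlan p R) (hp : IsPEC p) :
    ∃ B : ℕ, ∃ δ : ℝ, 0 < δ ∧ ∃ n₀ : ℕ, ∀ n : ℕ, n₀ ≤ n → ∀ h : History K, h.length = n →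
      F.Typical n B δ h →
        (F.schedule n B).len ≤ (progress (F.schedule n B) (F.packets n) h).cur (F.schedule n B) := by
  set c : ℝ := ∑ k, 1 / pMarg p k with hc_def
  have hc0 : 0 ≤ c := Finset.sum_nonneg fun k _ => one_div_nonneg.2 (hp.pMarg_nonneg k)
  have hc : ∀ k, 1 / pMarg p k ≤ c := fun k =>
    Finset.single_le_sum (f := fun k => 1 / pMarg p k)
      (fun k _ => one_div_nonneg.2 (hp.pMarg_nonneg k)) (Finset.mem_univ k)
  have hW : 0 ≤ F.swing := Finset.sum_nonneg fun _ _ => Finset.sum_nonneg fun _ _ =>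
    Finset.sum_nonneg fun _ _ => abs_nonneg _
  set W := F.swing
  set X := ∑ M, F.x M
  have hX : X < 1 := F.sum_x_lt
  set g := 1 - X with hg_def
  have hg : 0 < g := by linarith
  set s : ℝ := (numSets K : ℝ) with hs
  have hs0 : 0 ≤ s := Nat.cast_nonneg _
  set V : ℝ := K * c * s * 2 * W with hV
  have hV0 : 0 ≤ V := by positivity
  set B : ℕ := ⌈V * 4 / g⌉₊ + 1 with hB
  have hBpos : 0 < B := Nat.succ_pos _
  have hBr : (0 : ℝ) < B := by exact_mod_cast hBpos
  have hVB : V / B ≤ g / 4 := by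
    rw [div_le_iff₀ hBr]
    have h1 : V * 4 / g ≤ B := (Nat.le_ceil _).trans (by rw [hB]; push_cast; linarith)
    rw [div_le_iff₀ hg] at h1
    linarith
  set C₁ : ℝ := B * s * (s * c) + K * c * (s * (B * s * (s * (c + 1))) + s) with hC₁
  have hC₁0 : 0 ≤ C₁ := by positivity
  set C₂ : ℝ := K * c * (s * (B * s + 1)) with hC₂
  refine ⟨B, g / (4 * (C₁ + 1)), by positivity, ⌊4 * C₂ / g⌋₊ + 1, fun n hn h hlen ht => ?_⟩
  set δ := g / (4 * (C₁ + 1)) with hδ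
  have hδ0 : 0 < δ := by positivity
  have hδC : δ * C₁ ≤ g / 4 := by
    have : δ * (C₁ + 1) = g / 4 := by
      rw [hδ]
      field_simp
    linarith
  have hnC : C₂ < g / 4 * n := by
    have h1 : 4 * C₂ / g < n := (Nat.lt_floor_add_one _).trans_le (by exact_mod_cast hn)
    rw [div_lt_iff₀ hg] at h1
    linarith
  by_contra! hcur
  have h1 := F.length_le hp hc hc0 hδ0.le hBpos ht hcur
  rw [hlen] at h1
  have h2 : n * X + (B * numSets K : ℕ) * (s * (c * δ * n)) +
      K * (c * (s * (n / B * (2 * W) +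
      (B * numSets K : ℕ) * (s * ((c + 1) * δ * n) + 1) + 1) + s * (δ * n))) =
      n * X + n * (V / B) + n * (δ * C₁) + C₂ := by
    rw [hV, hC₁, hC₂]
    push_cast
    rw [← hs]
    ring
  have h3 := h1.trans_eq h2
  have hn0 : (0 : ℝ) ≤ n := Nat.cast_nonneg _
  have h4 := mul_le_mul_of_nonneg_left hVB hn0
  have h5 := mul_le_mul_of_nonneg_left hδC hn0
  have h6 : (n : ℝ) * X = n - n * g := by rw [hg_def]; ring
  have h7 : (0 : ℝ) ≤ n * g := by positivity
  linarith

theorem FlowPlan.exists_header_bound (F : FlowPlan p R) (n : ℕ) :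
    ∃ M₀ : ℕ, ∀ M : ℕ, M₀ ≤ M → ∀ k, (n : ℝ) * R k * ((M : ℝ) + ∑ i, (F.packets n i : ℝ)) ≤
      (F.packets n k : ℝ) * (M : ℝ) := by
  set P : ℝ := ∑ i, (F.packets n i : ℝ)
  have key : ∀ k, ∃ M₀ : ℕ, ∀ M : ℕ, M₀ ≤ M →
      (n : ℝ) * R k * ((M : ℝ) + P) ≤ (F.packets n k : ℝ) * (M : ℝ) := by
    intro k
    by_cases hR : R k = 0
    · refine ⟨0, fun M _ => ?_⟩
      rw [hR, mul_zero, zero_mul]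
      positivity
    · have hgap : 0 < (F.packets n k : ℝ) - n * R k := by
        rw [FlowPlan.packets, if_neg hR]
        push_cast
        have := Nat.lt_floor_add_one (n * R k)
        linarith
      refine ⟨⌈n * R k * P / ((F.packets n k : ℝ) - n * R k)⌉₊, fun M hM => ?_⟩
      have h1 := Nat.ceil_le.1 hM
      rw [div_le_iff₀ hgap] at h1
      linarith
  choose f hf using key
  exact ⟨Finset.univ.sup f, fun M hM k => hf k M ((Finset.le_sup (Finset.mem_univ k)).trans hM)⟩

/-- A flow plan that leaves time unused can be carried out. -/
theorem FlowPlan.attains (F : FlowPlan p R) (hp : IsPEC p) (hK : 0 < K) {𝔽 : Type*} [Field 𝔽]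
    [Fintype 𝔽] (hF : K < Fintype.card 𝔽) : Attains 𝔽 p R := by
  intro ε hε
  obtain ⟨B, δ, hδ, n₀, hn₀⟩ := F.exists_length_bound hp
  let ι := Fin (B * numSets K + K) × Fin K × Finset (Fin K) × Finset (Finset (Fin K))
  refine ⟨max n₀ (⌊Fintype.card ι / (δ ^ 2 * ε)⌋₊ + 1), fun n hn => ?_⟩
  have hn1 := hn₀ n ((le_max_left _ _).trans hn)
  have hn2 : ⌊Fintype.card ι / (δ ^ 2 * ε)⌋₊ + 1 ≤ n := (le_max_right _ _).trans hn
  have hnpos : 0 < n := (Nat.succ_pos _).trans_le hn2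
  have hnr : (0 : ℝ) < n := by exact_mod_cast hnpos
  set N := F.packets n
  set D := F.schedule n B
  set alg : Algorithm 𝔽 N := goodAlgorithm hF fun h => (progress D N h).sel D with halg
  have hsel : alg.select = fun h => (progress D N h).sel D := rfl
  have hvalid : alg.Valid := valid_of_select_eq D hK alg hsel
  have hdec : alg.SurelyDecodable := goodAlgorithm_surelyDecodable hF _ hvalid
  refine ⟨N, alg, hvalid, hdec, F.exists_header_bound n, fun M => ?_⟩
  obtain ⟨g, hg⟩ := alg.exists_decoder M
  refine ⟨g, ?_⟩
  have h1 := le_channelProb_deviation hp (ι := ι)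
    (fun i => Active D N i.1 i.2.1 i.2.2.1) (fun i => i.2.2.2) hδ hnpos
  have h2 : Fintype.card ι / (δ ^ 2 * n) < ε := by
    have h3 : Fintype.card ι / (δ ^ 2 * ε) < n :=
      (Nat.lt_floor_add_one _).trans_le (by exact_mod_cast hn2)
    rw [div_lt_iff₀ (by positivity)] at h3 ⊢
    linarith
  refine lt_of_lt_of_le (by linarith) (h1.trans (channelProb_mono hp n fun h hlen hdev => ?_))
  refine hg h fun k => ?_
  have ht : F.Typical n B δ h := fun i hi k S E => hdev (⟨i, hi⟩, k, S, E)
  have hcur := hn1 h hlen ht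
  have hS : ∀ j, k ∈ (alg.state h).S ⟨k, j⟩ := by
    intro j
    rw [(state_eq_progress D alg hsel h).1]
    refine mem_S_of_lt_cur (i := B * numSets K + k) (FlowPlan.mix_flush k)
      (FlowPlan.quota_flush k) (lt_of_lt_of_le ?_ hcur) j
    exact Nat.add_lt_add_left k.2 _
  have hrem : alg.remaining k h = ⊥ := by
    unfold Algorithm.remaining
    rw [Submodule.span_eq_bot]
    rintro u ⟨j, hj, -⟩
    exact absurd (hS j) hj
  have := hdec h k
  rw [hrem, sup_bot_eq] at this
  exact this ▸ le_sup_right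

/-! ### The linear program of the inner bound -/

theorem sum_moves_eq {T S S' : Finset (Fin K)} (hT : T ⊆ S) :
    ∑ A ∈ moves T S S', p A = if T ⊆ S' ∧ ¬ S' ⊆ S then fp p (S' \ T) S'ᶜ else 0 := by
  classical
  unfold moves fp
  split_ifs with h
  · refine Finset.sum_congr (Finset.filter_congr fun A _ => ?_) fun _ _ => rfl
    rw [Finset.compl_subset_compl]
    constructor
    · rintro ⟨-, rfl⟩
      exact ⟨by simp [sdiff_le_iff], Finset.subset_union_right⟩
    · rintro ⟨h1, h2⟩
      have h3 : T ∪ A = S' :=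
        (Finset.union_subset h.1 h2).antisymm (sdiff_le_iff.1 h1)
      exact ⟨fun hA => h.2 (h3 ▸ Finset.union_subset hT hA), h3⟩
  · refine Finset.sum_eq_zero fun A hA => absurd ?_ h
    obtain ⟨h1, rfl⟩ := (Finset.mem_filter.1 hA).2
    exact ⟨Finset.subset_union_left, fun hh => h1 (Finset.subset_union_right.trans hh)⟩

theorem moves_empty_right (T S : Finset (Fin K)) : moves T S ∅ = ∅ := by
  unfold moves
  rw [Finset.filter_eq_empty_iff]
  rintro A - ⟨h1, h2⟩
  apply h1
  rw [(Finset.union_eq_empty.1 h2).2]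
  exact Finset.empty_subset _

/-- A session whose destination never receives anything has rate zero. -/
theorem rate_nonpos_of_flow (hp : IsPEC p) {k : Fin K}
    {y : Finset (Fin K) → Finset (Fin K) → ℝ} (hy : ∀ T S, ¬ (T ⊆ S ∧ k ∉ S) → y T S = 0)
    (hflow : ∀ S', k ∉ S' → (if S' = ∅ then R k else 0) +
      ∑ T, ∑ S, y T S * ∑ A ∈ moves T S S', p A ≤ (∑ T, y T S') * pUnion p S'ᶜ)
    (hk : pMarg p k = 0) : R k ≤ 0 := by
  classical
  have hpA : ∀ A, k ∈ A → p A = 0 := by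
    intro A hA
    rw [← sum_mem_eq_pMarg, Finset.sum_eq_zero_iff_of_nonneg fun A _ => hp.1 A] at hk
    exact hk A (by simpa using hA)
  have hsum := Finset.sum_le_sum (s := {S' : Finset (Fin K) | k ∉ S'})
    fun S' hS' => hflow S' (Finset.mem_filter.1 hS').2
  have h1 : ∑ S' : Finset (Fin K) with k ∉ S', (if S' = ∅ then R k else 0) = R k := by
    rw [Finset.sum_ite_eq' _ ∅ (fun _ => R k), if_pos (by simp)]
  have h2 : ∑ S' : Finset (Fin K) with k ∉ S', ∑ T, ∑ S, y T S * ∑ A ∈ moves T S S', p A =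
      ∑ S' : Finset (Fin K) with k ∉ S', (∑ T, y T S') * pUnion p S'ᶜ := by
    have h3 : ∑ S' : Finset (Fin K) with k ∉ S', ∑ T, ∑ S, y T S * ∑ A ∈ moves T S S', p A =
        ∑ T, ∑ S, y T S * ∑ S' : Finset (Fin K) with k ∉ S', ∑ A ∈ moves T S S', p A := by
      rw [Finset.sum_comm]
      refine Finset.sum_congr rfl fun T _ => ?_
      rw [Finset.sum_comm]
      exact Finset.sum_congr rfl fun S _ => (Finset.mul_sum _ _ _).symm
    have h4 : ∀ T S, y T S * ∑ S' : Finset (Fin K) with k ∉ S', ∑ A ∈ moves T S S', p A =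
        y T S * pUnion p Sᶜ := by
      intro T S
      by_cases hTS : T ⊆ S ∧ k ∉ S
      swap
      · rw [hy T S hTS, zero_mul, zero_mul]
      congr 1
      rw [← sum_escapes]
      have h5 : ∑ A ∈ escapes S, p A =
          ∑ A ∈ ({A | ¬ A ⊆ S ∧ k ∉ A} : Finset (Finset (Fin K))), p A := by
        unfold escapes
        rw [← Finset.filter_filter, Finset.sum_filter_of_ne (p := fun A => k ∉ A)]
        intro A _ hA hkA
        exact hA (hpA A hkA)
      rw [h5]
      refine Eq.trans ?_ (Finset.sum_fiberwise_of_maps_to (t := {S' : Finset (Fin K) | k ∉ S'})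
        (g := fun A => T ∪ A) ?_ _)
      · refine Finset.sum_congr rfl fun S' hS' => Finset.sum_congr ?_ fun _ _ => rfl
        ext A
        simp only [moves, Finset.mem_filter, Finset.mem_univ, true_and] at hS' ⊢
        constructor
        · rintro ⟨ha, hb⟩
          exact ⟨⟨ha, fun hk => hS' (hb ▸ Finset.mem_union_right _ hk)⟩, hb⟩
        · rintro ⟨⟨ha, -⟩, hb⟩
          exact ⟨ha, hb⟩
      · intro A hA
        simp only [Finset.mem_filter, Finset.mem_univ, true_and] at hA ⊢
        simp only [Finset.mem_union, hA.2, or_false]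
        exact fun hkT => hTS.2 (hTS.1 hkT)
    rw [h3]
    simp only [h4]
    rw [Finset.sum_comm]
    have h6 : ∑ S' : Finset (Fin K) with k ∉ S', (∑ T, y T S') * pUnion p S'ᶜ =
        ∑ S', (∑ T, y T S') * pUnion p S'ᶜ := by
      refine Finset.sum_filter_of_ne fun S' _ hS' hkS => hS' ?_
      rw [Finset.sum_eq_zero fun T _ => hy T S' fun hh => hh.2 hkS, zero_mul]
    rw [h6]
    exact Finset.sum_congr rfl fun S' _ => (Finset.sum_mul _ _ _).symm
  rw [Finset.sum_add_distrib, h1, h2] at hsum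
  linarith

open Classical in
theorem InnerBound.nonempty_flowPlan (hp : IsPEC p)
    {prec : Finset (Fin K) → Finset (Fin K) → Prop} (hR : ∀ k, 0 ≤ R k)
    (h : InnerBound p prec R) : Nonempty (FlowPlan p R) := by
  obtain ⟨x, w, hx, hw, hx1, hxw, hRw, hin, -⟩ := h
  let y : Fin K → Finset (Fin K) → Finset (Fin K) → ℝ := fun k T S =>
    if T ⊆ S ∧ k ∉ S then w k S T else 0
  have hy0 : ∀ k T S, ¬ (T ⊆ S ∧ k ∉ S) → y k T S = 0 := fun k T S h => if_neg h
  have hyT : ∀ k S', k ∉ S' → ∑ T, y k T S' = ∑ T : Finset (Fin K) with T ⊆ S', w k S' T := by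
    intro k S' hk
    rw [Finset.sum_filter]
    exact Finset.sum_congr rfl fun T _ => by simp [y, hk]
  have hflow : ∀ k S', k ∉ S' → (if S' = ∅ then R k else 0) +
      ∑ T, ∑ S, y k T S * ∑ A ∈ moves T S S', p A ≤ (∑ T, y k T S') * pUnion p S'ᶜ := by
    intro k S' hk
    by_cases hS' : S' = ∅
    · subst hS'
      rw [hyT k ∅ hk]
      simp only [moves_empty_right, Finset.sum_empty, mul_zero, Finset.sum_const_zero, add_zero,
        if_true, Finset.compl_empty, Finset.subset_empty]
      have := hRw k
      rwa [Finset.filter_eq', if_pos (Finset.mem_univ _), Finset.sum_singleton]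
    · rw [if_neg hS', zero_add, hyT k S' hk]
      refine le_trans (le_of_eq ?_) (hin k S' hk hS')
      rw [Finset.sum_comm, ← Fintype.sum_prod_type', Finset.sum_filter]
      refine Finset.sum_congr rfl fun q _ => ?_
      simp only [y]
      by_cases h1 : q.2 ⊆ q.1
      · rw [sum_moves_eq h1]
        by_cases h2 : k ∉ q.1 <;> by_cases h3 : q.2 ⊆ S' <;> by_cases h4 : S' ⊆ q.1 <;>
          simp [h1, h2, h3, h4]
      · simp [h1]
  refine ⟨⟨x, y, hx, hx1, fun k T S => ?_, hy0, fun M k hk => ?_, hflow, hR, fun k hk => ?_⟩⟩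
  · simp only [y]
    split_ifs with h
    · exact hw k S T h.1 h.2
    · exact le_rfl
  · refine le_trans (le_of_eq ?_) (hxw M k hk)
    rw [Finset.sum_filter]
  · exact le_antisymm (rate_nonpos_of_flow hp (hy0 k) (hflow k) hk) (hR k)

end Attains

end BroadcastPEC

namespace BroadcastPEC

section Dwell

variable {K : ℕ} {p : Finset (Fin K) → ℝ} {R : Fin K → ℝ}

/-- Expected number of slots for which the set of destinations that have received a repeatedly sent
packet is exactly `S`. -/
noncomputable def dwell (p : Finset (Fin K) → ℝ) (S : Finset (Fin K)) : ℝ :=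
  ((if S = ∅ then 1 else 0) + ∑ S₁ ∈ S.ssubsets.attach,
    dwell p S₁.1 * ∑ A ∈ moves S₁.1 S₁.1 S, p A) / pUnion p Sᶜ
termination_by S.card
decreasing_by exact Finset.card_lt_card (Finset.mem_ssubsets.1 S₁.2)

theorem ssubset_of_mem_moves {S S' A : Finset (Fin K)} (h : A ∈ moves S S S') : S ⊂ S' := by
  obtain ⟨h1, rfl⟩ := (Finset.mem_filter.1 h).2
  refine Finset.ssubset_iff_subset_ne.2 ⟨Finset.subset_union_left, fun h2 => h1 ?_⟩
  rw [h2]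
  exact Finset.subset_union_right

theorem sum_moves_eq_zero {S S' : Finset (Fin K)} (h : ¬ S ⊂ S') :
    ∑ A ∈ moves S S S', p A = 0 :=
  Finset.sum_eq_zero fun _ hA => absurd (ssubset_of_mem_moves hA) h

theorem dwell_eq (p : Finset (Fin K) → ℝ) (S : Finset (Fin K)) :
    dwell p S = ((if S = ∅ then 1 else 0) +
      ∑ S₁, dwell p S₁ * ∑ A ∈ moves S₁ S₁ S, p A) / pUnion p Sᶜ := by
  conv_lhs => rw [dwell]
  rw [Finset.sum_attach S.ssubsets (fun S₁ => dwell p S₁ * ∑ A ∈ moves S₁ S₁ S, p A)]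
  congr 2
  refine Finset.sum_subset (Finset.subset_univ _) fun S₁ _ hS₁ => ?_
  rw [sum_moves_eq_zero (by simpa using hS₁), mul_zero]

theorem dwell_nonneg (hp : IsPEC p) (S : Finset (Fin K)) : 0 ≤ dwell p S := by
  induction S using Finset.strongInduction with
  | H S ih =>
    rw [dwell]
    refine div_nonneg (add_nonneg (by split_ifs <;> norm_num) (Finset.sum_nonneg fun S₁ _ => ?_))
      (hp.pUnion_nonneg _)
    exact mul_nonneg (ih _ (Finset.mem_ssubsets.1 S₁.2)) (hp.sum_nonneg _)

theorem dwell_mul {S : Finset (Fin K)} (h : pUnion p Sᶜ ≠ 0) :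
    dwell p S * pUnion p Sᶜ = (if S = ∅ then 1 else 0) +
      ∑ S₁, dwell p S₁ * ∑ A ∈ moves S₁ S₁ S, p A := by
  rw [dwell_eq, div_mul_cancel₀ _ h]

theorem sum_dwell_subset (hp : IsPEC p) {B : Finset (Fin K)} (hB : pUnion p Bᶜ ≠ 0) :
    ∑ S ∈ B.powerset, dwell p S = 1 / pUnion p Bᶜ := by
  classical
  have hB0 : 0 < pUnion p Bᶜ := (hp.pUnion_nonneg _).lt_of_ne' hB
  have h1 : ∀ S ∈ B.powerset, dwell p S * pUnion p Sᶜ = (if S = ∅ then 1 else 0) +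
      ∑ S₁, dwell p S₁ * ∑ A ∈ moves S₁ S₁ S, p A := fun S hS =>
    dwell_mul (hB0.trans_le (hp.pUnion_mono
      (Finset.compl_subset_compl.2 (Finset.mem_powerset.1 hS)))).ne'
  have h2 : ∀ S₁ ∈ B.powerset, dwell p S₁ * pUnion p S₁ᶜ =
      dwell p S₁ * ∑ S ∈ B.powerset, ∑ A ∈ moves S₁ S₁ S, p A + dwell p S₁ * pUnion p Bᶜ := by
    intro S₁ hS₁
    rw [Finset.mem_powerset] at hS₁
    rw [← mul_add]
    congr 1
    have h3 : ∑ S ∈ B.powerset, ∑ A ∈ moves S₁ S₁ S, p A =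
        ∑ A ∈ ({A | ¬ A ⊆ S₁ ∧ A ⊆ B} : Finset (Finset (Fin K))), p A := by
      refine Eq.trans ?_ (Finset.sum_fiberwise_of_maps_to (t := B.powerset)
        (g := fun A => S₁ ∪ A) ?_ _)
      · refine Finset.sum_congr rfl fun S' hS' => Finset.sum_congr ?_ fun _ _ => rfl
        ext A
        simp only [moves, Finset.mem_filter, Finset.mem_univ, true_and, Finset.mem_powerset]
          at hS' ⊢
        constructor
        · rintro ⟨ha, rfl⟩
          exact ⟨⟨ha, Finset.subset_union_right.trans hS'⟩, rfl⟩
        · rintro ⟨⟨ha, -⟩, hb⟩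
          exact ⟨ha, hb⟩
      · intro A hA
        simp only [Finset.mem_filter, Finset.mem_univ, true_and, Finset.mem_powerset] at hA ⊢
        exact Finset.union_subset hS₁ hA.2
    rw [h3, ← sum_escapes, ← sum_escapes, ← Finset.sum_union]
    · refine Finset.sum_congr ?_ fun _ _ => rfl
      ext A
      simp only [escapes, Finset.mem_union, Finset.mem_filter, Finset.mem_univ, true_and]
      have : A ⊆ S₁ → A ⊆ B := fun h => h.trans hS₁
      tauto
    · rw [escapes, Finset.disjoint_filter]
      exact fun A _ ha hb => hb ha.2
  have h4 := (Finset.sum_congr rfl h1).symm.trans (Finset.sum_congr rfl h2)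
  rw [Finset.sum_add_distrib, Finset.sum_add_distrib, Finset.sum_ite_eq' _ ∅ (fun _ => (1 : ℝ)),
    if_pos (Finset.empty_mem_powerset _), ← Finset.sum_mul, Finset.sum_comm] at h4
  have h5 : ∑ S₁, ∑ S ∈ B.powerset, dwell p S₁ * ∑ A ∈ moves S₁ S₁ S, p A =
      ∑ S₁ ∈ B.powerset, dwell p S₁ * ∑ S ∈ B.powerset, ∑ A ∈ moves S₁ S₁ S, p A := by
    simp only [← Finset.mul_sum]
    symm
    refine Finset.sum_subset (Finset.subset_univ _) fun S₁ _ hS₁ => ?_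
    rw [Finset.sum_eq_zero fun S hS => ?_, mul_zero]
    refine sum_moves_eq_zero fun h => hS₁ ?_
    exact Finset.mem_powerset.2 (h.subset.trans (Finset.mem_powerset.1 hS))
  rw [h5] at h4
  rw [eq_div_iff hB]
  linarith

theorem rate_div_pUnion (hp : IsPEC p) (hR : IsRateVector p R) {k : Fin K} {C : Finset (Fin K)}
    (hk : k ∈ C) : R k / pUnion p C = R k * ∑ S ∈ Cᶜ.powerset, dwell p S := by
  by_cases h : pUnion p C = 0
  · have h1 : pMarg p k = 0 := le_antisymm (h ▸ hp.pMarg_le hk) (hp.pMarg_nonneg k)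
    simp [hR.2 k h1]
  · rw [sum_dwell_subset hp (by rwa [compl_compl]), compl_compl, mul_one_div]

theorem eq_univ_iff_erase_eq {M : Finset (Fin K)} {k : Fin K} (hk : k ∈ M) :
    M = Finset.univ ↔ M.erase k = {k}ᶜ := by
  constructor
  · rintro rfl
    ext l
    simp
  · intro h
    rw [← Finset.insert_erase hk, h]
    ext l
    simp

open Classical in
/-- Packets are mixed with respect to their full overhearing sets, except that the packets of session
`k` that all other destinations have overheard are distributed according to `z k`. -/
theorem nonempty_flowPlan_of_split (hp : IsPEC p) (hR : IsRateVector p R)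
    (x : Finset (Fin K) → ℝ) (z : Fin K → Finset (Fin K) → ℝ) (hx : ∀ M, 0 ≤ x M)
    (hx1 : ∑ M, x M < 1) (hz : ∀ k T, k ∉ T → 0 ≤ z k T)
    (hzs : ∀ k, ∑ T ∈ ({k}ᶜ : Finset (Fin K)).powerset, z k T = R k * dwell p {k}ᶜ)
    (hxz : ∀ M, ∀ k ∈ M, (if M = Finset.univ then 0 else R k * dwell p (M.erase k)) +
      z k (M.erase k) ≤ x M) : Nonempty (FlowPlan p R) := by
  let y : Fin K → Finset (Fin K) → Finset (Fin K) → ℝ := fun k T S =>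
    if T ⊆ S ∧ k ∉ S then
      (if S = {k}ᶜ then z k T else if T = S then R k * dwell p S else 0) else 0
  have hy0 : ∀ k T S, ¬ (T ⊆ S ∧ k ∉ S) → y k T S = 0 := fun k T S h => if_neg h
  have hyT : ∀ k S, k ∉ S → ∑ T, y k T S = R k * dwell p S := by
    intro k S hk
    by_cases hS : S = {k}ᶜ
    · subst hS
      rw [← hzs k]
      symm
      rw [← Finset.sum_subset (Finset.subset_univ ({k}ᶜ : Finset (Fin K)).powerset)]
      · refine Finset.sum_congr rfl fun T hT => ?_
        simp [y, Finset.mem_powerset.1 hT]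
      · intro T _ hT
        exact hy0 _ _ _ fun h => hT (Finset.mem_powerset.2 h.1)
    · rw [Finset.sum_eq_single S]
      · simp [y, hk, hS]
      · intro T _ hT
        simp [y, hS, hT]
      · simp
  refine ⟨⟨x, y, hx, hx1, fun k T S => ?_, hy0, fun M k hk => ?_, fun k S' hk => ?_, hR.1, hR.2⟩⟩
  · simp only [y]
    split_ifs with h1 h2 h3
    · exact hz k T fun h => h1.2 (h1.1 h)
    · exact mul_nonneg (hR.1 k) (dwell_nonneg hp S)
    · exact le_rfl
    · exact le_rfl
  · refine le_trans (le_of_eq ?_) (hxz M k hk)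
    have hMk : M.erase k ⊆ {k}ᶜ := by
      rw [Finset.subset_compl_comm, Finset.compl_erase]
      simp
    have huniv := eq_univ_iff_erase_eq hk
    have hself : y k (M.erase k) {k}ᶜ = z k (M.erase k) := by simp [y, hMk]
    by_cases hM : M = Finset.univ
    · rw [if_pos hM, zero_add, ← hself]
      refine Finset.sum_eq_single _ (fun S _ hS => ?_) (by simp)
      simp only [y, hS, if_false]
      split_ifs with h1 h2
      · exact absurd (h2 ▸ huniv.1 hM) hS
      · rfl
      · rfl
    · have hM' : M.erase k ≠ {k}ᶜ := fun h => hM (huniv.2 h)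
      rw [if_neg hM, ← hself]
      have h1 : y k (M.erase k) (M.erase k) = R k * dwell p (M.erase k) := by
        simp [y, hM']
      rw [← h1, ← Finset.sum_pair hM']
      symm
      refine Finset.sum_subset (Finset.subset_univ _) fun S _ hS => ?_
      simp only [Finset.mem_insert, Finset.mem_singleton, not_or] at hS
      simp [y, hS.2, Ne.symm hS.1]
  · have h1 : ∑ T, ∑ S, y k T S * ∑ A ∈ moves T S S', p A =
        R k * ∑ S, dwell p S * ∑ A ∈ moves S S S', p A := by
      rw [Finset.sum_comm, Finset.mul_sum]
      refine Finset.sum_congr rfl fun S _ => ?_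
      by_cases hkS : k ∈ S
      · rw [sum_moves_eq_zero fun h => hk (h.subset hkS), mul_zero, mul_zero]
        exact Finset.sum_eq_zero fun T _ => by rw [hy0 k T S fun h => h.2 hkS, zero_mul]
      by_cases hS : S = {k}ᶜ
      · have h2 : ∀ T, ∑ A ∈ moves T S S', p A = 0 := by
          intro T
          refine Finset.sum_eq_zero fun A hA => absurd ?_ hk
          obtain ⟨h1, rfl⟩ := (Finset.mem_filter.1 hA).2
          obtain ⟨l, hl, hlS⟩ := Finset.not_subset.1 h1
          have : l = k := by simpa [hS] using hlS
          exact Finset.mem_union_right _ (this ▸ hl)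
        simp [h2]
      · rw [Finset.sum_eq_single S]
        · simp [y, hkS, hS, mul_assoc]
        · intro T _ hT
          simp [y, hS, hT]
        · simp
    rw [h1, hyT k S' hk]
    have h2 : (if S' = ∅ then R k else 0) = R k * (if S' = ∅ then 1 else 0) := by
      split_ifs <;> simp
    rw [h2, ← mul_add, mul_assoc]
    by_cases hP : pUnion p S'ᶜ = 0
    · have h3 : pMarg p k = 0 :=
        le_antisymm (hP ▸ hp.pMarg_le (Finset.mem_compl.2 hk)) (hp.pMarg_nonneg k)
      simp [hR.2 k h3]
    · rw [dwell_mul hP]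

theorem outerSum_eq (hp : IsPEC p) (hR : IsRateVector p R) (π : Equiv.Perm (Fin K)) :
    outerSum p R π =
      ∑ k, R k * ∑ S ∈ ({l | π.symm k < π.symm l} : Finset (Fin K)).powerset, dwell p S := by
  unfold outerSum
  refine Eq.trans (Finset.sum_congr rfl fun j _ => ?_) (Equiv.sum_comp π _)
  have hC : (Finset.Iic j).image π = ({l | π.symm (π j) < π.symm l} : Finset (Fin K))ᶜ := by
    ext l
    simp only [Finset.mem_image, Finset.mem_Iic, Finset.mem_compl, Finset.mem_filter,
      Finset.mem_univ, true_and, Equiv.symm_apply_apply, not_lt]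
    constructor
    · rintro ⟨a, ha, rfl⟩
      simpa using ha
    · intro h
      exact ⟨π.symm l, h, by simp⟩
  rw [rate_div_pUnion hp hR (Finset.mem_image_of_mem _ (Finset.mem_Iic.2 le_rfl)), hC, compl_compl]

open Classical in
/-- If in each mixing set the first session with respect to `π` takes longest, the outer bound is
attained. -/
theorem nonempty_flowPlan_of_order (hp : IsPEC p) (hR : IsRateVector p R) (π : Equiv.Perm (Fin K))
    (hπ : ∀ M : Finset (Fin K), ∀ i ∈ M, ∀ j ∈ M, π.symm i < π.symm j →
      R j * dwell p (M.erase j) ≤ R i * dwell p (M.erase i)) (h : outerSum p R π < 1) :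
    Nonempty (FlowPlan p R) := by
  have hnn : ∀ k S, 0 ≤ R k * dwell p S := fun k S => mul_nonneg (hR.1 k) (dwell_nonneg hp S)
  let g : Fin K → Finset (Fin K) → ℝ := fun k T =>
    if ∀ l ∈ T, π.symm k < π.symm l then R k * dwell p T else 0
  have hg : ∀ k T, 0 ≤ g k T := fun k T => by
    simp only [g]
    split_ifs
    · exact hnn k T
    · exact le_rfl
  have hgk : ∀ (k : Fin K) (M : Finset (Fin K)), 0 ≤ if k ∈ M then g k (M.erase k) else 0 :=
      fun k M => by
    split_ifs
    · exact hg _ _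
    · exact le_rfl
  refine nonempty_flowPlan_of_split hp hR (fun M => ∑ k, if k ∈ M then g k (M.erase k) else 0)
    (fun k T => if T = {k}ᶜ then R k * dwell p T else 0)
    (fun M => Finset.sum_nonneg fun k _ => hgk k M) ?_ (fun k T _ => ?_) (fun k => ?_)
    (fun M k hk => ?_)
  · rw [Finset.sum_comm]
    refine lt_of_eq_of_lt ?_ h
    rw [outerSum_eq hp hR]
    refine Finset.sum_congr rfl fun k _ => ?_
    rw [sum_erase_eq k (g k), Finset.mul_sum]
    · simp only [g]
      rw [← Finset.sum_filter]
      refine Finset.sum_congr ?_ fun _ _ => rfl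
      ext T
      simp [Finset.subset_iff]
    · intro T hT
      exact if_neg fun hh => lt_irrefl _ (hh k hT)
  · split_ifs
    · exact hnn k T
    · exact le_rfl
  · rw [Finset.sum_ite_eq' _ ({k}ᶜ : Finset (Fin K)) (fun T => R k * dwell p T),
      if_pos (Finset.mem_powerset_self _)]
  · have h1 : (if M = Finset.univ then 0 else R k * dwell p (M.erase k)) +
        (if M.erase k = {k}ᶜ then R k * dwell p (M.erase k) else 0) = R k * dwell p (M.erase k) := by
      have huniv := eq_univ_iff_erase_eq hk
      by_cases hM : M = Finset.univ
      · rw [if_pos hM, if_pos (huniv.1 hM), zero_add]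
      · rw [if_neg hM, if_neg fun h => hM (huniv.2 h), add_zero]
    rw [h1]
    obtain ⟨i, hi, hmin⟩ := Finset.exists_min_image M π.symm ⟨k, hk⟩
    have h2 : R k * dwell p (M.erase k) ≤ R i * dwell p (M.erase i) := by
      rcases (hmin k hk).lt_or_eq with h | h
      · exact hπ M i hi k hk h
      · rw [π.symm.injective h]
    refine h2.trans (le_trans (le_of_eq ?_)
      (Finset.single_le_sum (fun k _ => hgk k M) (Finset.mem_univ i)))
    rw [if_pos hi]
    simp only [g]
    rw [if_pos]
    intro l hl
    obtain ⟨h3, h4⟩ := Finset.mem_erase.1 hl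
    exact lt_of_le_of_ne (hmin l h4) fun h => h3 (π.symm.injective h).symm

/-! ### Symmetric channels -/

theorem dwell_map {τ : Equiv.Perm (Fin K)} (hτ : ∀ S, p (S.map τ.toEmbedding) = p S)
    (S : Finset (Fin K)) : dwell p (S.map τ.toEmbedding) = dwell p S := by
  have hsum : ∀ q : Finset (Fin K) → Prop, ∀ [DecidablePred q],
      ∑ A : Finset (Fin K) with q A, p A =
        ∑ A : Finset (Fin K) with q (A.map τ.toEmbedding), p A := by
    intro q _
    rw [Finset.sum_filter, Finset.sum_filter, ← (Equiv.finsetCongr τ).sum_comp]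
    simp only [Equiv.finsetCongr_apply, hτ]
  induction S using Finset.strongInduction with
  | H S ih =>
    rw [dwell_eq, dwell_eq p S]
    congr 1
    · congr 1
      · simp
      · rw [← (Equiv.finsetCongr τ).sum_comp]
        refine Finset.sum_congr rfl fun S₁ _ => ?_
        simp only [Equiv.finsetCongr_apply]
        have h1 : ∑ A ∈ moves (S₁.map τ.toEmbedding) (S₁.map τ.toEmbedding) (S.map τ.toEmbedding),
            p A = ∑ A ∈ moves S₁ S₁ S, p A := by
          unfold moves
          rw [hsum]
          refine Finset.sum_congr (Finset.filter_congr fun A _ => ?_) fun _ _ => rfl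
          rw [← Finset.map_union, Finset.map_subset_map, (Finset.map_injective _).eq_iff]
        rw [h1]
        by_cases h2 : S₁ ⊂ S
        · rw [ih S₁ h2]
        · rw [sum_moves_eq_zero h2, mul_zero, mul_zero]
    · unfold pUnion
      rw [hsum]
      refine Finset.sum_congr (Finset.filter_congr fun A _ => ?_) fun _ _ => rfl
      have : (S.map τ.toEmbedding)ᶜ = Sᶜ.map τ.toEmbedding := by
        ext l
        simp only [Finset.mem_compl, Finset.mem_map_equiv]
      rw [this, ← Finset.map_inter, Finset.map_nonempty]

theorem nonempty_flowPlan_of_symmetric (hp : IsPEC p) (hs : IsSymmetric p) (hR : IsRateVector p R)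
    (h : ∀ π, outerSum p R π < 1) : Nonempty (FlowPlan p R) := by
  let π : Equiv.Perm (Fin K) := Tuple.sort fun k => -R k
  have hmono : Monotone ((fun k => -R k) ∘ π) := Tuple.monotone_sort _
  refine nonempty_flowPlan_of_order hp hR π (fun M i hi j hj hij => ?_) (h π)
  have h1 : R j ≤ R i := by
    have := hmono hij.le
    simp only [Function.comp, Equiv.apply_symm_apply] at this
    linarith
  have h2 : dwell p (M.erase j) = dwell p (M.erase i) := by
    rw [← dwell_map (τ := Equiv.swap i j) (fun S => hs _ _ (by simp)) (M.erase i)]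
    congr 1
    ext l
    simp only [Finset.mem_erase, Finset.mem_map_equiv, Equiv.symm_swap]
    by_cases hli : l = i
    · subst hli
      have : l ≠ j := fun h => hij.ne (h ▸ rfl)
      simp [this, hi, hj, this.symm]
    · by_cases hlj : l = j
      · subst hlj
        simp
      · rw [Equiv.swap_apply_of_ne_of_ne hli hlj]
        simp [hli, hlj]
  rw [h2]
  exact mul_le_mul_of_nonneg_right h1 (dwell_nonneg hp _)

/-! ### Spatially independent channels -/

theorem IsPEC.pMarg_le_one (hp : IsPEC p) (k : Fin K) : pMarg p k ≤ 1 := by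
  rw [← sum_mem_eq_pMarg]
  exact hp.sum_le_one _

theorem pUnion_of_independent (hp : IsPEC p) (hi : IsSpatiallyIndependent p) (S : Finset (Fin K)) :
    pUnion p S = 1 - ∏ k ∈ S, (1 - pMarg p k) := by
  classical
  have h1 : pUnion p S + ∑ A ∈ Sᶜ.powerset, p A = 1 := by
    rw [← hp.2, pUnion, ← Finset.sum_filter_add_sum_filter_not Finset.univ
      (fun A => (A ∩ S).Nonempty)]
    congr 1
    refine Finset.sum_congr ?_ fun _ _ => rfl
    ext A
    simp [Finset.not_nonempty_iff_eq_empty, ← Finset.disjoint_iff_inter_eq_empty,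
      Finset.subset_compl_iff_disjoint_right]
  have h2 : ∑ A ∈ Sᶜ.powerset, p A = ∏ k ∈ S, (1 - pMarg p k) := by
    have h3 : ∀ A ∈ Sᶜ.powerset, p A = (∏ k ∈ S, (1 - pMarg p k)) *
        ((∏ k ∈ A, pMarg p k) * ∏ k ∈ Sᶜ \ A, (1 - pMarg p k)) := by
      intro A hA
      have hAS : Aᶜ = S ∪ Sᶜ \ A := by
        ext l
        have h4 := Finset.mem_powerset.1 hA
        have := @h4 l
        simp only [Finset.mem_compl, Finset.mem_union, Finset.mem_sdiff] at this ⊢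
        tauto
      rw [hi A, hAS, Finset.prod_union]
      · ring
      · exact Finset.disjoint_left.2 fun l hl hl' =>
          (Finset.mem_compl.1 (Finset.mem_sdiff.1 hl').1) hl
    rw [Finset.sum_congr rfl h3, ← Finset.mul_sum, ← Finset.prod_add]
    simp
  linarith

/-- Probability that after `t` slots exactly the destinations in `S` have received a packet. -/
noncomputable def overheardProb (p : Finset (Fin K) → ℝ) (S : Finset (Fin K)) (t : ℕ) : ℝ :=
  (∏ k ∈ S, (1 - (1 - pMarg p k) ^ t)) * ∏ k ∈ Sᶜ, (1 - pMarg p k) ^ t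

theorem hasSum_overheardProb (hp : IsPEC p) (hi : IsSpatiallyIndependent p)
    (hpos : ∀ k, 0 < pMarg p k) {S : Finset (Fin K)} (hS : S ≠ Finset.univ) :
    HasSum (overheardProb p S) (dwell p S) := by
  classical
  induction S using Finset.strongInduction with
  | H S ih =>
    have hle1 : ∀ k, pMarg p k ≤ 1 := hp.pMarg_le_one
    obtain ⟨k, hk⟩ : ∃ k, k ∈ Sᶜ := by
      by_contra! h
      exact hS (by ext l; simpa using h l)
    have hP : 0 < pUnion p Sᶜ := (hpos k).trans_le (hp.pMarg_le hk)
    have hq : 1 - ∏ k ∈ Sᶜ, (1 - pMarg p k) = pUnion p Sᶜ := (pUnion_of_independent hp hi _).symm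
    have hq0 : 0 ≤ ∏ k ∈ Sᶜ, (1 - pMarg p k) :=
      Finset.prod_nonneg fun k _ => by linarith [hle1 k]
    have hgeo := hasSum_geometric_of_lt_one hq0 (by linarith)
    rw [hq] at hgeo
    have hsub : HasSum (fun t => ∑ S₁ ∈ S.ssubsets, overheardProb p S₁ t)
        (∑ S₁ ∈ S.ssubsets, dwell p S₁) :=
      hasSum_sum fun S₁ hS₁ => ih S₁ (Finset.mem_ssubsets.1 hS₁) fun h => by
        have := Finset.mem_ssubsets.1 hS₁
        rw [h] at this
        exact this.2 (Finset.subset_univ _)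
    have h1 := sum_dwell_subset hp hP.ne'
    rw [one_div] at h1
    have hsplit : ∀ f : Finset (Fin K) → ℝ,
        ∑ S₁ ∈ S.powerset, f S₁ = ∑ S₁ ∈ S.ssubsets, f S₁ + f S := by
      intro f
      rw [Finset.ssubsets, Finset.sum_erase_add _ _ (Finset.mem_powerset_self _)]
    rw [hsplit] at h1
    have h2 : dwell p S = (pUnion p Sᶜ)⁻¹ - ∑ S₁ ∈ S.ssubsets, dwell p S₁ := by linarith
    rw [h2]
    suffices h6 : overheardProb p S = fun t => (∏ k ∈ Sᶜ, (1 - pMarg p k)) ^ t -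
        ∑ S₁ ∈ S.ssubsets, overheardProb p S₁ t by
      rw [h6]
      exact hgeo.sub hsub
    funext t
    have h3 : ∑ S₁ ∈ S.powerset, overheardProb p S₁ t = (∏ k ∈ Sᶜ, (1 - pMarg p k)) ^ t := by
      have h4 : ∀ S₁ ∈ S.powerset, overheardProb p S₁ t = (∏ k ∈ Sᶜ, (1 - pMarg p k) ^ t) *
          ((∏ k ∈ S₁, (1 - (1 - pMarg p k) ^ t)) * ∏ k ∈ S \ S₁, (1 - pMarg p k) ^ t) := by
        intro S₁ hS₁
        have hAS : S₁ᶜ = Sᶜ ∪ S \ S₁ := by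
          ext l
          have h5 := Finset.mem_powerset.1 hS₁
          have := @h5 l
          simp only [Finset.mem_compl, Finset.mem_union, Finset.mem_sdiff] at this ⊢
          tauto
        rw [overheardProb, hAS, Finset.prod_union]
        · ring
        · exact Finset.disjoint_left.2 fun l hl hl' =>
            (Finset.mem_compl.1 hl) (Finset.mem_sdiff.1 hl').1
      rw [Finset.sum_congr rfl h4, ← Finset.mul_sum, ← Finset.prod_add, ← Finset.prod_pow]
      simp
    rw [hsplit] at h3
    linarith

theorem mul_one_sub_pow_mul_pow_le {a b : ℝ} (hb : 0 ≤ b) (hab : b ≤ a) (t : ℕ) :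
    a * ((1 - a ^ t) * b ^ t) ≤ b * ((1 - b ^ t) * a ^ t) := by
  cases t with
  | zero => simp
  | succ t =>
    have ha : 0 ≤ a := hb.trans hab
    have h2 : b ^ t ≤ a ^ t := pow_le_pow_left₀ hb hab t
    have h3 : 0 ≤ a * b * (a ^ t - b ^ t) := mul_nonneg (mul_nonneg ha hb) (sub_nonneg.2 h2)
    have h5 : 0 ≤ a * b * (a ^ t * b ^ t * (a - b)) :=
      mul_nonneg (mul_nonneg ha hb) (mul_nonneg (by positivity) (sub_nonneg.2 hab))
    rw [pow_succ, pow_succ]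
    linarith

theorem nonempty_flowPlan_of_independent (hp : IsPEC p) (hi : IsSpatiallyIndependent p)
    (hpos : ∀ k, 0 < pMarg p k) (hmono : Monotone (pMarg p)) (hR : ∀ k, 0 ≤ R k)
    (hfair : OneSidedlyFair p R) (h : osfSum p R < 1) : Nonempty (FlowPlan p R) := by
  classical
  have hR' : IsRateVector p R := ⟨hR, fun k hk => absurd hk (hpos k).ne'⟩
  have hle1 : ∀ k, pMarg p k ≤ 1 := hp.pMarg_le_one
  refine nonempty_flowPlan_of_order hp hR' 1 (fun M i hiM j hjM hij => ?_) ?_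
  swap
  · refine lt_of_eq_of_lt (Finset.sum_congr rfl fun k _ => ?_) h
    rw [← pUnion_of_independent hp hi]
    simp
  have hij : i < j := hij
  set qi := 1 - pMarg p i with hqi
  set qj := 1 - pMarg p j with hqj
  have hqj0 : 0 ≤ qj := by linarith [hle1 j]
  have hqij : qj ≤ qi := by linarith [hmono hij.le]
  have hqi1 : qi ≤ 1 := by linarith [(hpos i).le]
  have hne : ∀ k ∈ M, M.erase k ≠ Finset.univ := fun k _ h =>
    Finset.notMem_erase k M (h ▸ Finset.mem_univ k)
  have hsi := hasSum_overheardProb hp hi hpos (hne i hiM)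
  have hsj := hasSum_overheardProb hp hi hpos (hne j hjM)
  let B := (M.erase i).erase j
  let c : ℕ → ℝ := fun t => (∏ k ∈ B, (1 - (1 - pMarg p k) ^ t)) * ∏ k ∈ Mᶜ, (1 - pMarg p k) ^ t
  have hc : ∀ t, 0 ≤ c t := fun t => mul_nonneg
    (Finset.prod_nonneg fun k _ => sub_nonneg.2 (pow_le_one₀ (by linarith [hle1 k])
      (by linarith [(hpos k).le])))
    (Finset.prod_nonneg fun k _ => pow_nonneg (by linarith [hle1 k]) _)
  have hoi : ∀ t, overheardProb p (M.erase i) t = c t * ((1 - qj ^ t) * qi ^ t) := by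
    intro t
    have h1 : j ∈ M.erase i := Finset.mem_erase.2 ⟨hij.ne', hjM⟩
    rw [overheardProb, Finset.compl_erase, Finset.prod_insert (by simpa using hiM),
      ← Finset.mul_prod_erase _ _ h1]
    ring
  have hoj : ∀ t, overheardProb p (M.erase j) t = c t * ((1 - qi ^ t) * qj ^ t) := by
    intro t
    have h1 : i ∈ M.erase j := Finset.mem_erase.2 ⟨hij.ne, hiM⟩
    rw [overheardProb, Finset.compl_erase, Finset.prod_insert (by simpa using hjM),
      ← Finset.mul_prod_erase _ _ h1, Finset.erase_right_comm]
    ring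
  have hdi := dwell_nonneg hp (M.erase i)
  have hdj := dwell_nonneg hp (M.erase j)
  rcases hqj0.eq_or_lt with h0 | h0
  · have : dwell p (M.erase j) = 0 := by
      refine hsj.unique ?_
      have : overheardProb p (M.erase j) = fun _ => 0 := by
        funext t
        rw [hoj, ← h0]
        cases t <;> simp
      rw [this]
      exact hasSum_zero
    rw [this, mul_zero]
    exact mul_nonneg (hR i) hdi
  · have hqi0 : 0 < qi := h0.trans_le hqij
    have hcmp : qi * dwell p (M.erase j) ≤ qj * dwell p (M.erase i) := by
      refine hasSum_le (fun t => ?_) (hsj.mul_left qi) (hsi.mul_left qj)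
      rw [hoi, hoj]
      have h1 := mul_one_sub_pow_mul_pow_le hqj0 hqij t
      calc _ = c t * (qi * ((1 - qi ^ t) * qj ^ t)) := by ring
        _ ≤ c t * (qj * ((1 - qj ^ t) * qi ^ t)) := mul_le_mul_of_nonneg_left h1 (hc t)
        _ = _ := by ring
    have hf : R j * qj ≤ R i * qi := hfair i j hij
    have h4 : (R j * qj) * (qi * dwell p (M.erase j)) ≤
        (R i * qi) * (qj * dwell p (M.erase i)) :=
      mul_le_mul hf hcmp (mul_nonneg hqi0.le hdj) (mul_nonneg (hR i) hqi0.le)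
    refine le_of_mul_le_mul_left ?_ (mul_pos hqi0 h0)
    linarith

end Dwell

end BroadcastPEC

namespace BroadcastPEC

/-! ### Three destinations -/

section Three

theorem exists_sum_eq_min {ι : Type*} [Fintype ι] (q : ι → ℝ) (hq : ∀ i, 0 ≤ q i) {c : ℝ}
    (hc : 0 ≤ c) : ∃ s : ι → ℝ, (∀ i, 0 ≤ s i) ∧ (∀ i, s i ≤ q i) ∧
      ∑ i, s i = min c (∑ i, q i) := by
  set Q := ∑ i, q i with hQ
  have hQ0 : 0 ≤ Q := Finset.sum_nonneg fun i _ => hq i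
  rcases hQ0.eq_or_lt with h | h
  · refine ⟨q, hq, fun _ => le_rfl, ?_⟩
    rw [← hQ, ← h, min_eq_right hc]
  · have h1 : 0 ≤ min c Q / Q := by positivity
    have h2 : min c Q / Q ≤ 1 := (div_le_one h).2 (min_le_right _ _)
    refine ⟨fun i => q i * (min c Q / Q), fun i => mul_nonneg (hq i) h1,
      fun i => mul_le_of_le_one_right (hq i) h2, ?_⟩
    rw [← Finset.sum_mul, ← hQ, mul_div_cancel₀ _ h.ne']

/-- In a three-cycle of comparisons between products `r i * v j` and `r j * v i`, one is an
equality. -/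
theorem exists_le_of_cycle {r v : Fin 3 → ℝ} (hr : ∀ i, 0 ≤ r i) (hv : ∀ i, 0 ≤ v i)
    (i j k : Fin 3) :
    r i * v j ≤ r j * v i ∨ r j * v k ≤ r k * v j ∨ r k * v i ≤ r i * v k := by
  by_contra! h
  obtain ⟨h1, h2, h3⟩ := h
  have h4 := mul_lt_mul'' (mul_lt_mul'' h1 h2 (mul_nonneg (hr _) (hv _))
    (mul_nonneg (hr _) (hv _))) h3 (mul_nonneg (mul_nonneg (hr _) (hv _))
    (mul_nonneg (hr _) (hv _))) (mul_nonneg (hr _) (hv _))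
  linarith

variable {p : Finset (Fin 3) → ℝ} {R : Fin 3 → ℝ}

theorem outerSum_three (hp : IsPEC p) (hR : IsRateVector p R) (h : ∀ π, outerSum p R π < 1)
    {k j l : Fin 3} (hkj : k ≠ j) (hkl : k ≠ l) (hjl : j ≠ l) :
    R k * (dwell p ∅ + dwell p {j} + dwell p {l} + dwell p {k}ᶜ) +
      R j * (dwell p ∅ + dwell p {l}) + R l * dwell p ∅ < 1 := by
  have hb : Function.Bijective ![k, j, l] := by
    revert k j l
    decide
  have h1 := h (Equiv.ofBijective _ hb)
  have e0 : (Finset.Iic (0 : Fin 3)).image (Equiv.ofBijective _ hb) = {k} := by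
    rw [show Finset.Iic (0 : Fin 3) = {0} from by decide]
    simp
  have e1 : (Finset.Iic (1 : Fin 3)).image (Equiv.ofBijective _ hb) = {k, j} := by
    rw [show Finset.Iic (1 : Fin 3) = {0, 1} from by decide]
    simp [Finset.image_insert]
  have e2 : (Finset.Iic (2 : Fin 3)).image (Equiv.ofBijective _ hb) = {k, j, l} := by
    rw [show Finset.Iic (2 : Fin 3) = {0, 1, 2} from by decide]
    simp [Finset.image_insert]
  rw [outerSum, Fin.sum_univ_three, e0, e1, e2] at h1
  simp only [Equiv.ofBijective_apply, Matrix.cons_val_zero, Matrix.cons_val_one,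
    Matrix.cons_val] at h1
  have p0 : (({k} : Finset (Fin 3))ᶜ).powerset = {∅, {j}, {l}, {k}ᶜ} := by
    clear h1 e0 e1 e2 hb
    revert k j l
    decide
  have p1 : (({k, j} : Finset (Fin 3))ᶜ).powerset = {∅, {l}} := by
    clear h1 e0 e1 e2 p0 hb
    revert k j l
    decide
  have p2 : (({k, j, l} : Finset (Fin 3))ᶜ).powerset = {∅} := by
    clear h1 e0 e1 e2 p0 p1 hb
    revert k j l
    decide
  have q1 : (∅ : Finset (Fin 3)) ∉ ({{j}, {l}, {k}ᶜ} : Finset (Finset (Fin 3))) ∧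
      ({j} : Finset (Fin 3)) ∉ ({{l}, {k}ᶜ} : Finset (Finset (Fin 3))) ∧
      ({l} : Finset (Fin 3)) ∉ ({{k}ᶜ} : Finset (Finset (Fin 3))) := by
    clear h1 e0 e1 e2 p0 p1 p2 hb
    revert k j l
    decide
  have q3 : (∅ : Finset (Fin 3)) ≠ {l} := (Finset.singleton_ne_empty l).symm
  rw [rate_div_pUnion hp hR (by simp), rate_div_pUnion hp hR (by simp),
    rate_div_pUnion hp hR (by simp), p0, p1, p2, Finset.sum_insert q1.1, Finset.sum_insert q1.2.1,
    Finset.sum_insert q1.2.2, Finset.sum_singleton, Finset.sum_pair q3,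
    Finset.sum_singleton] at h1
  linarith

theorem nonempty_flowPlan_of_three (hp : IsPEC p) (hR : IsRateVector p R)
    (h : ∀ π, outerSum p R π < 1) : Nonempty (FlowPlan p R) := by
  have hu : ∀ S, 0 ≤ dwell p S := dwell_nonneg hp
  set a : Fin 3 → ℝ := fun k => R k * dwell p ∅ with ha
  set b : Fin 3 → Fin 3 → ℝ := fun k m => R k * dwell p {m} with hb
  set c : Fin 3 → ℝ := fun k => R k * dwell p {k}ᶜ with hc
  have ha0 : ∀ k, 0 ≤ a k := fun k => mul_nonneg (hR.1 k) (hu _)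
  have hb0 : ∀ k m, 0 ≤ b k m := fun k m => mul_nonneg (hR.1 k) (hu _)
  have hc0 : ∀ k, 0 ≤ c k := fun k => mul_nonneg (hR.1 k) (hu _)
  have H : ∀ {k j l : Fin 3}, k ≠ j → k ≠ l → j ≠ l →
      a 0 + a 1 + a 2 + b k j + b k l + b j l + c k < 1 := by
    intro k j l hkj hkl hjl
    have h1 := outerSum_three hp hR h hkj hkl hjl
    have h2 : a 0 + a 1 + a 2 = a k + a j + a l := by
      clear h1 ha0 hb0 hc0
      clear_value a b c
      fin_cases k <;> fin_cases j <;> fin_cases l <;> simp at hkj hkl hjl ⊢ <;> ring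
    rw [h2]
    simp only [ha, hb, hc]
    linarith
  set q : Fin 3 → Fin 3 → ℝ := fun k m => max (b m k - b k m) 0 with hq
  have hq0 : ∀ k m, 0 ≤ q k m := fun k m => le_max_right _ _
  choose s hs0 hsq hs using fun k => exists_sum_eq_min (q k) (hq0 k) (hc0 k)
  have hskk : ∀ k, s k k = 0 := fun k => le_antisymm (by simpa [hq] using hsq k k) (hs0 k k)
  set top : Fin 3 → ℝ := fun k => c k - ∑ m, s k m with htop
  have htop0 : ∀ k, 0 ≤ top k := fun k => by
    have := min_le_left (c k) (∑ m, q k m)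
    simp only [htop]
    linarith [hs k]
  set top' := max (top 0) (max (top 1) (top 2)) with htop'
  have htop'k : ∀ k, top k ≤ top' := by
    intro k
    fin_cases k <;> simp [htop']
  set mx : Fin 3 → Fin 3 → ℝ := fun k m => max (b k m) (b m k) with hmx
  have hmx0 : ∀ k m, 0 ≤ mx k m := fun k m => (hb0 k m).trans (le_max_left _ _)
  have hcases : ∀ M : Finset (Fin 3), ∀ k ∈ M,
      M = {k} ∨ (∃ m, k ≠ m ∧ M = {k, m}) ∨ M = Finset.univ := by decide
  have hbase : a 0 + a 1 + a 2 + mx 0 1 + mx 0 2 + mx 1 2 < 1 := by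
    have h012 := H (k := 0) (j := 1) (l := 2) (by decide) (by decide) (by decide)
    have h021 := H (k := 0) (j := 2) (l := 1) (by decide) (by decide) (by decide)
    have h102 := H (k := 1) (j := 0) (l := 2) (by decide) (by decide) (by decide)
    have h120 := H (k := 1) (j := 2) (l := 0) (by decide) (by decide) (by decide)
    have h201 := H (k := 2) (j := 0) (l := 1) (by decide) (by decide) (by decide)
    have h210 := H (k := 2) (j := 1) (l := 0) (by decide) (by decide) (by decide)
    have c1 := exists_le_of_cycle hR.1 (fun i => hu {i}) 0 1 2
    have c2 := exists_le_of_cycle hR.1 (fun i => hu {i}) 0 2 1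
    change b 0 1 ≤ b 1 0 ∨ b 1 2 ≤ b 2 1 ∨ b 2 0 ≤ b 0 2 at c1
    change b 0 2 ≤ b 2 0 ∨ b 2 1 ≤ b 1 2 ∨ b 1 0 ≤ b 0 1 at c2
    have := hc0 0
    have := hc0 1
    have := hc0 2
    simp only [hmx]
    clear_value a b c
    rcases le_total (b 0 1) (b 1 0) with h1 | h1 <;> rcases le_total (b 0 2) (b 2 0) with h2 | h2 <;>
      rcases le_total (b 1 2) (b 2 1) with h3 | h3 <;> simp only [max_eq_left, max_eq_right, h1, h2, h3]
    · linarith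
    · linarith
    · rcases c2 with h4 | h4 | h4 <;> linarith
    · linarith
    · linarith
    · rcases c1 with h4 | h4 | h4 <;> linarith
    · linarith
    · linarith
  have hmxq : ∀ k m, mx k m = b k m + q k m := fun k m => by
    simp only [hmx, hq]
    rcases le_total (b k m) (b m k) with h1 | h1
    · rw [max_eq_right h1, max_eq_left (by linarith)]
      ring
    · rw [max_eq_left h1, max_eq_right (by linarith)]
      ring
  have hmxc : ∀ k m, mx k m = mx m k := fun k m => max_comm _ _
  have hfinal : ∀ k, a 0 + a 1 + a 2 + mx 0 1 + mx 0 2 + mx 1 2 + top k < 1 := by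
    intro k
    rcases le_total (c k) (∑ m, q k m) with hle | hle
    · have : top k = 0 := by
        simp only [htop]
        rw [hs k, min_eq_left hle, sub_self]
      rw [this]
      linarith
    · have htk : top k = c k - ∑ m, q k m := by
        simp only [htop]
        rw [hs k, min_eq_right hle]
      rw [htk, Fin.sum_univ_three]
      have key : ∀ j l : Fin 3, k ≠ j → k ≠ l → j ≠ l → mx 0 1 + mx 0 2 + mx 1 2 =
          mx k j + mx k l + mx j l → q k 0 + q k 1 + q k 2 = q k j + q k l →
          a 0 + a 1 + a 2 + mx 0 1 + mx 0 2 + mx 1 2 + (c k - (q k 0 + q k 1 + q k 2)) < 1 := by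
        intro j l hkj hkl hjl h1 h2
        have h3 := H hkj hkl hjl
        have h4 := H hkl hkj hjl.symm
        have h5 := hmxq k j
        have h6 := hmxq k l
        have h7 : mx j l ≤ b j l ∨ mx j l ≤ b l j := le_max_iff.1 le_rfl
        rcases h7 with h7 | h7 <;> linarith
      have hqkk : q k k = 0 := by simp [hq]
      have hk : ∀ k : Fin 3, k = 0 ∨ k = 1 ∨ k = 2 := by decide
      have m1 := hmxc 1 0
      have m2 := hmxc 2 0
      have m3 := hmxc 2 1
      rcases hk k with rfl | rfl | rfl
      · exact key 1 2 (by decide) (by decide) (by decide) rfl (by linarith)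
      · exact key 0 2 (by decide) (by decide) (by decide) (by linarith) (by linarith)
      · exact key 0 1 (by decide) (by decide) (by decide) (by linarith) (by linarith)
  have hpair : ∀ k m : Fin 3, k ≠ m → ({k, m} : Finset (Fin 3)).card = 2 ∧
      ({k, m} : Finset (Fin 3)).erase k = {m} ∧ ({k, m} : Finset (Fin 3)).erase m = {k} := by
    decide
  have htop'0 : 0 ≤ top' := (htop0 0).trans (htop'k 0)
  obtain ⟨x, hx0, hxe, hx1, hx2, hx3⟩ : ∃ x : Finset (Fin 3) → ℝ, (∀ M, 0 ≤ x M) ∧ x ∅ = 0 ∧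
      (∀ k, x {k} = a k) ∧ (∀ k m, k ≠ m → x {k, m} = mx k m) ∧ x Finset.univ = top' := by
    refine ⟨fun M => if M.card = 1 then ∑ k ∈ M, a k else
      if M.card = 2 then (∑ k ∈ M, ∑ m ∈ M.erase k, mx k m) / 2 else
      if M.card = 3 then top' else 0, fun M => ?_, by simp, fun k => by simp,
      fun k m hkm => ?_, by simp⟩
    · dsimp only
      split_ifs
      · exact Finset.sum_nonneg fun k _ => ha0 k
      · exact div_nonneg (Finset.sum_nonneg fun k _ => Finset.sum_nonneg fun m _ => hmx0 k m)
          zero_le_two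
      · exact htop'0
      · exact le_rfl
    · obtain ⟨h1, h2, h3⟩ := hpair k m hkm
      have h4 : ∑ i ∈ ({k, m} : Finset (Fin 3)), ∑ j ∈ ({k, m} : Finset (Fin 3)).erase i, mx i j =
          mx k m + mx m k := by
        rw [Finset.sum_pair hkm, h2, h3, Finset.sum_singleton, Finset.sum_singleton]
      simp only [h1, h4, if_true, OfNat.ofNat_ne_one, if_false]
      linarith [hmxc k m]
  obtain ⟨z, hz0, hze, hz1, hz2⟩ : ∃ z : Fin 3 → Finset (Fin 3) → ℝ, (∀ k T, 0 ≤ z k T) ∧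
      (∀ k, z k ∅ = 0) ∧ (∀ k m, z k {m} = s k m) ∧ ∀ k, z k {k}ᶜ = top k := by
    have h1 : ∀ k m : Fin 3, (∅ : Finset (Fin 3)) ≠ {k}ᶜ ∧ ({m} : Finset (Fin 3)) ≠ {k}ᶜ := by
      decide
    refine ⟨fun k T => if T = {k}ᶜ then top k else if T.card = 1 then ∑ m ∈ T, s k m else 0,
      fun k T => ?_, fun k => by simp [(h1 k k).1], fun k m => by simp [(h1 k m).2],
      fun k => by simp⟩
    dsimp only
    split_ifs
    · exact htop0 k
    · exact Finset.sum_nonneg fun m _ => hs0 k m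
    · exact le_rfl
  refine nonempty_flowPlan_of_split hp hR x z hx0 ?_ (fun k T _ => hz0 k T) (fun k => ?_)
    (fun M k hk => ?_)
  · have huniv : (Finset.univ : Finset (Finset (Fin 3))) =
        {∅, {0}, {1}, {2}, {0, 1}, {0, 2}, {1, 2}, Finset.univ} := by decide
    rw [huniv, Finset.sum_insert (by decide), Finset.sum_insert (by decide),
      Finset.sum_insert (by decide), Finset.sum_insert (by decide),
      Finset.sum_insert (by decide), Finset.sum_insert (by decide),
      Finset.sum_insert (by decide), Finset.sum_singleton, hxe, hx1, hx1, hx1,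
      hx2 0 1 (by decide), hx2 0 2 (by decide), hx2 1 2 (by decide), hx3]
    have h0 := hfinal 0
    have h1 := hfinal 1
    have h2 := hfinal 2
    have h3 : top' = top 0 ∨ top' = top 1 ∨ top' = top 2 := by
      rcases max_choice (top 0) (max (top 1) (top 2)) with h4 | h4
      · exact Or.inl h4
      · rcases max_choice (top 1) (top 2) with h5 | h5
        · exact Or.inr (Or.inl (h4.trans h5))
        · exact Or.inr (Or.inr (h4.trans h5))
    rcases h3 with h3 | h3 | h3 <;> rw [h3] <;> linarith
  · obtain ⟨j, l, hkj, hkl, hjl, hpow⟩ : ∃ j l : Fin 3, k ≠ j ∧ k ≠ l ∧ j ≠ l ∧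
        (({k} : Finset (Fin 3))ᶜ).powerset = {∅, {j}, {l}, {k}ᶜ} := by
      revert k
      decide
    have q1 : (∅ : Finset (Fin 3)) ∉ ({{j}, {l}, {k}ᶜ} : Finset (Finset (Fin 3))) ∧
        ({j} : Finset (Fin 3)) ∉ ({{l}, {k}ᶜ} : Finset (Finset (Fin 3))) ∧
        ({l} : Finset (Fin 3)) ∉ ({{k}ᶜ} : Finset (Finset (Fin 3))) := by
      clear hpow
      revert k j l
      decide
    have q3 : ∑ m, s k m = s k k + s k j + s k l := by
      have : (Finset.univ : Finset (Fin 3)) = {k, j, l} := by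
        clear hpow q1
        revert k j l
        decide
      rw [this, Finset.sum_insert (by simp [hkj, hkl]), Finset.sum_pair hjl]
      ring
    rw [hpow, Finset.sum_insert q1.1, Finset.sum_insert q1.2.1, Finset.sum_insert q1.2.2,
      Finset.sum_singleton, hze, hz1, hz1, hz2]
    simp only [htop]
    rw [q3, hskk k]
    simp only [hc]
    ring
  · rcases hcases M k hk with rfl | ⟨m, hkm, rfl⟩ | rfl
    · have h1 : ({k} : Finset (Fin 3)) ≠ Finset.univ := by
        clear hk
        revert k
        decide
      have h2 : ({k} : Finset (Fin 3)).erase k = ∅ := by simp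
      rw [if_neg h1, h2, hze, hx1]
      simp [ha]
    · have h1 : ({k, m} : Finset (Fin 3)) ≠ Finset.univ := by
        clear hk
        revert k m
        decide
      rw [if_neg h1, (hpair k m hkm).2.1, hz1, hx2 k m hkm]
      have h6 := hsq k m
      have h7 := hmxq k m
      have h9 : R k * dwell p {m} = b k m := rfl
      linarith
    · have h1 : (Finset.univ : Finset (Fin 3)).erase k = {k}ᶜ := (eq_univ_iff_erase_eq hk).1 rfl
      rw [if_pos rfl, h1, hz2, zero_add, hx3]
      exact htop'k k

end Three

/-! ### The theorem -/

section Closure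

variable {K : ℕ} {p : Finset (Fin K) → ℝ} {R : Fin K → ℝ}

theorem mem_closure_of_smul_mem {s : Set (Fin K → ℝ)}
    (h : ∀ r : ℝ, 0 < r → r < 1 → r • R ∈ s) : R ∈ closure s := by
  have h1 : Filter.Tendsto (fun n : ℕ => (1 - 1 / ((n : ℝ) + 2)) • R) Filter.atTop (nhds R) := by
    have h2 : Filter.Tendsto (fun n : ℕ => 1 / ((n : ℝ) + 2)) Filter.atTop (nhds 0) := by
      have := (tendsto_one_div_add_atTop_nhds_zero_nat (𝕜 := ℝ)).comp (Filter.tendsto_add_atTop_nat 1)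
      refine this.congr fun n => ?_
      simp only [Function.comp]
      push_cast
      ring_nf
    have h3 := ((tendsto_const_nhds (x := (1 : ℝ))).sub h2).smul_const R
    simpa using h3
  refine mem_closure_of_tendsto h1 (Filter.Eventually.of_forall fun n => h _ ?_ ?_)
  · have : 1 / ((n : ℝ) + 2) < 1 := by
      rw [div_lt_one (by positivity)]
      linarith [(Nat.cast_nonneg n : (0 : ℝ) ≤ n)]
    linarith
  · have : 0 < 1 / ((n : ℝ) + 2) := by positivity
    linarith

theorem IsRateVector.smul (hR : IsRateVector p R) {r : ℝ} (hr : 0 ≤ r) :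
    IsRateVector p (r • R) :=
  ⟨fun k => mul_nonneg hr (hR.1 k), fun k hk => by simp [hR.2 k hk]⟩

theorem outerSum_smul (r : ℝ) (π : Equiv.Perm (Fin K)) :
    outerSum p (r • R) π = r * outerSum p R π := by
  unfold outerSum
  rw [Finset.mul_sum]
  exact Finset.sum_congr rfl fun j _ => mul_div_assoc _ _ _

theorem osfSum_smul (r : ℝ) : osfSum p (r • R) = r * osfSum p R := by
  unfold osfSum
  rw [Finset.mul_sum]
  exact Finset.sum_congr rfl fun j _ => mul_div_assoc _ _ _

theorem mul_lt_one_of_le_one {r a : ℝ} (hr0 : 0 < r) (hr1 : r < 1) (ha : a ≤ 1) : r * a < 1 := by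
  nlinarith

end Closure

end BroadcastPEC

theorem mainTheorem7 {K : ℕ} (hK : 0 < K) {F : Type*} [Field F] [Fintype F]
    (hF : K < Fintype.card F) (p : Finset (Fin K) → ℝ) (hp : BroadcastPEC.IsPEC p) :
    -- in every scheme, mixing coefficients giving decodability with probability one are computable
    (∀ (N : Fin K → ℕ) (alg : BroadcastPEC.Algorithm F N), alg.Valid →
      ∃ coeff : BroadcastPEC.History K → Fin K → F,
        (BroadcastPEC.Algorithm.mk alg.select coeff).Valid ∧
        (BroadcastPEC.Algorithm.mk alg.select coeff).SurelyDecodable) ∧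
    -- general channels with three destinations: the outer bound is attained
    (K = 3 → ∀ R : Fin K → ℝ, BroadcastPEC.IsRateVector p R →
      ((∀ π, BroadcastPEC.outerSum p R π < 1) → BroadcastPEC.Attains F p R) ∧
      ((∀ π, BroadcastPEC.outerSum p R π ≤ 1) → R ∈ closure {R' | BroadcastPEC.Attains F p R'})) ∧
    -- general channels: the linear-programming inner bound is attained
    (∀ prec : Finset (Fin K) → Finset (Fin K) → Prop, IsStrictTotalOrder (Finset (Fin K)) prec →
      BroadcastPEC.CardCompatible prec →
      ∀ R : Fin K → ℝ, (∀ k, 0 ≤ R k) → BroadcastPEC.InnerBound p prec R →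
        BroadcastPEC.Attains F p R) ∧
    -- symmetric channels: the outer bound is attained
    (BroadcastPEC.IsSymmetric p → ∀ R : Fin K → ℝ, BroadcastPEC.IsRateVector p R →
      ((∀ π, BroadcastPEC.outerSum p R π < 1) → BroadcastPEC.Attains F p R) ∧
      ((∀ π, BroadcastPEC.outerSum p R π ≤ 1) → R ∈ closure {R' | BroadcastPEC.Attains F p R'})) ∧
    -- spatially independent channels and one-sidedly fair rates
    (BroadcastPEC.IsSpatiallyIndependent p → (∀ k, 0 < BroadcastPEC.pMarg p k) →
      Monotone (BroadcastPEC.pMarg p) →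
      ∀ R : Fin K → ℝ, (∀ k, 0 ≤ R k) → BroadcastPEC.OneSidedlyFair p R →
        (BroadcastPEC.osfSum p R < 1 → BroadcastPEC.Attains F p R) ∧
        (BroadcastPEC.osfSum p R ≤ 1 → R ∈ closure {R' | BroadcastPEC.Attains F p R'})) := by
  open BroadcastPEC in
  have attains : ∀ R : Fin K → ℝ, Nonempty (FlowPlan p R) → Attains F p R :=
    fun R ⟨P⟩ => P.attains hp hK hF
  have outer : (∀ R : Fin K → ℝ, IsRateVector p R → (∀ π, outerSum p R π < 1) → Attains F p R) →
      ∀ R : Fin K → ℝ, IsRateVector p R →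
        ((∀ π, outerSum p R π < 1) → Attains F p R) ∧
        ((∀ π, outerSum p R π ≤ 1) → R ∈ closure {R' | Attains F p R'}) := by
    refine fun h R hR => ⟨h R hR, fun hle => mem_closure_of_smul_mem fun r hr0 hr1 => ?_⟩
    refine h _ (hR.smul hr0.le) fun π => ?_
    rw [outerSum_smul]
    exact mul_lt_one_of_le_one hr0 hr1 (hle π)
  refine ⟨fun N alg hv => ?_, ?_, ?_, ?_, ?_⟩
  · have hv' : (goodAlgorithm hF alg.select).Valid := Algorithm.Valid.congr (alg := alg) rfl hv
    exact ⟨(goodAlgorithm hF alg.select).coeff, hv', goodAlgorithm_surelyDecodable hF _ hv'⟩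
  · rintro rfl
    exact outer fun R hR h => attains R (nonempty_flowPlan_of_three hp hR h)
  · exact fun prec _ _ R hR h => attains R (h.nonempty_flowPlan hp hR)
  · exact fun hs => outer fun R hR h => attains R (nonempty_flowPlan_of_symmetric hp hs hR h)
  · intro hi hpos hmono R hR hfair
    refine ⟨fun h => attains R (nonempty_flowPlan_of_independent hp hi hpos hmono hR hfair h),
      fun hle => mem_closure_of_smul_mem fun r hr0 hr1 => attains _ ?_⟩
    refine nonempty_flowPlan_of_independent hp hi hpos hmono (fun k => mul_nonneg hr0.le (hR k))
      (fun i j hij => ?_) ?_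
    · have := mul_le_mul_of_nonneg_left (hfair i j hij) hr0.le
      simpa [mul_assoc] using this
    · rw [osfSum_smul]
      exact mul_lt_one_of_le_one hr0 hr1 hle
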